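/- **Setting.** Let $\mathbb E=\mathbb R^d\times\{1,\dots,m\}$ be the space of coloured points, on which $\mathbb R^d$ acts by $t+(x,i)=(t+x,i)$. Let $\ell$ be Lebesgue measure on $\mathbb R^d$ and $C_R$ the open cube of edge length $R$ centred at $0$. Let $M_p$ be the set of positive Borel measures $\lambda$ on $\mathbb E$ with $\lambda(A)\in\mathbb N=\{0,1,2,\dots\}$ for all relatively compact Borel sets $A$, with the vague topology (the coarsest one making $\lambda\mapsto\lambda(f)$ continuous for all $f\in C_c(\mathbb E)$), its Borel $\sigma$-algebra, and the translation action $(T_t\lambda)(A)=\lambda(-t+A)$. For $\lambda\in M_p$ let $\lambda^i(A)=\lambda(A\times\{i\})$ for Borel sets $A\subset\mathbb R^d$. Let $\xi:(\Omega,\mathcal A,P)\to M_p$ be a point process (a measurable map from a probability space) with law $\mu=\xi(P)$ and let $X\subset M_p$ be the support of $\mu$. Assume that * for some $r>0$, every $\lambda\in X$ satisfies $\lambda\big((a+C_r)\times\{1,\dots,m\}\big)\le 1$ for all $a\in\mathbb R^d$; * $\mu$ is translation invariant and ergodic; * every colour has positive intensity: $\int_X\lambda^i(C_1)\,d\mu(\lambda)>0$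 for $i=1,\dots,m$. Let $w=(w_1,\dots,w_m)\in\mathbb R^m$ and put $\lambda^w=\sum_{i}w_i\lambda^i$. The $w$-weighted Palm measure is the signed measure $$\dot\mu^w(D)=\frac1{\ell(B)}\int_X\sum_{x\in B}\lambda^w(\{x\})\,\mathbf 1_D(T_{-x}\lambda)\,d\mu(\lambda),$$ where $B$ is any bounded Borel set of positive Lebesgue measure (the value does not depend on $B$; for instance $B=C_1$). Its weighted first moment is $\dot\mu^w_1(f)=\int_X\lambda^w(f)\,d\dot\mu^w(\lambda)$. By a (complex) Radon measure on $\mathbb R^d$ we mean a linear functional on $C_c(\mathbb R^d)$ that is bounded in the sup norm on the functions supported in any given compact set. The $w$-weighted autocorrelation of $\lambda$ is, if it exists, the vague limit $$\gamma^w_\lambda=\lim_{R\to\infty}\frac1{\ell(C_R)}\,\lambda^w|_{C_R}*\widetilde{\lambda^w|_{C_R}},$$ that is, $\gamma^w_\lambda(f)=\lim_{R\to\infty}\ell(C_R)^{-1}\sum_{x,y\in C_R}\lambda^w(\{x\})\lambda^w(\{y\})f(x-y)$ for all $f\in C_c(\mathbb R^d)$. **Theorem.** 1. $\dot\mu^w_1$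 is a Radon measure on $\mathbb R^d$, and it is positive definite: $\dot\mu^w_1(g*\tilde g)\ge 0$ for all $g\in C_c(\mathbb R^d)$, where $\tilde g(x)=\overline{g(-x)}$. 2. $\dot\mu^w_1$ is Fourier transformable and its transform is a positive translation bounded measure: there is a positive Borel measure $\sigma$ on $\mathbb R^d$ with $\sup_{t\in\mathbb R^d}\sigma(t+K)<\infty$ for all compact $K$ such that $\sigma(f)=\dot\mu^w_1(\hat f)$ for all Schwartz functions $f$, all integrals being absolutely convergent; here $\hat f(k)=\int f(x)e^{-2\pi i k\cdot x}\,dx$. 3. For $\mu$-almost every $\lambda$, the $w$-weighted autocorrelation $\gamma^w_\lambda$ exists and $\gamma^w_\lambda=\dot\mu^w_1$. 4. If $X$ is uniquely ergodic (that is, $\mu$ is the only translation invariant Borel probability measure on $X$), then $\gamma^w_\lambda$ exists and equals $\dot\mu^w_1$ for every $\lambda\in X$. 5. In the one-colour unweighted case ($m=1$, $w_1=1$), $\dot\mu^w_1$ is moreover a positive translation bounded measure. -/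

import Mathlib

open MeasureTheory Filter Topology
open scoped CompactlySupported SchwartzMap FourierTransform ENNReal

noncomputable section

namespace PointProcess

/-- The ambient Euclidean space `ℝ^d`. -/
abbrev Space (d : ℕ) : Type := EuclideanSpace ℝ (Fin d)

/-- The space `ℝ^d × {1, …, m}` of coloured points. -/
abbrev ColSpace (d m : ℕ) : Type := Space d × Fin m

/-- The open cube `C_R` of edge length `R` about `0`. -/
def cube (d : ℕ) (R : ℝ) : Set (Space d) := {x | ∀ i, |x i| < R / 2}

/-- Point measures on `ℝ^d × {1, …, m}`: positive Borel measures taking values in `ℕ`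
on all relatively compact Borel sets. -/
def PointMeasure (d m : ℕ) : Type :=
  {lam : Measure (ColSpace d m) //
    ∀ A, MeasurableSet A → IsCompact (closure A) → ∃ n : ℕ, lam A = n}

variable {d m : ℕ}

/-- The vague topology: the coarsest one making `λ ↦ λ(f)` continuous for all continuous
compactly supported `f` (real-valued `f` suffice). -/
instance : TopologicalSpace (PointMeasure d m) :=
  TopologicalSpace.induced (fun lam (f : C_c(ColSpace d m, ℝ)) => ∫ p, f p ∂lam.1) inferInstance

instance : MeasurableSpace (PointMeasure d m) := borel _

instance : BorelSpace (PointMeasure d m) := ⟨rfl⟩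

/-- Translation on coloured points. -/
def shift (m : ℕ) (t : Space d) : ColSpace d m ≃ₜ ColSpace d m :=
  (Homeomorph.addLeft t).prodCongr (Homeomorph.refl (Fin m))

/-- Translation of point measures, `(T_t λ)(A) = λ(-t + A)`. -/
def translate (t : Space d) (lam : PointMeasure d m) : PointMeasure d m :=
  ⟨lam.1.map (shift m t), fun A hA hc => by
    rw [Measure.map_apply (shift m t).continuous.measurable hA]
    refine lam.2 _ ((shift m t).continuous.measurable hA) ?_
    rw [← (shift m t).preimage_closure]
    exact (shift m t).isCompact_preimage.2 hc⟩

/-- The action of `ℝ^d` by translation: `t +ᵥ λ = T_t λ`. -/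
instance : AddAction (Space d) (PointMeasure d m) where
  vadd := translate
  zero_vadd lam := by
    apply Subtype.ext
    change lam.1.map (shift m 0) = lam.1
    have : (shift m (0 : Space d) : ColSpace d m → ColSpace d m) = id := by
      funext p
      change ((0 : Space d) + p.1, p.2) = p
      rw [zero_add]
    rw [this, Measure.map_id]
  add_vadd s t lam := by
    apply Subtype.ext
    change lam.1.map (shift m (s + t)) = (lam.1.map (shift m t)).map (shift m s)
    rw [Measure.map_map (shift m s).continuous.measurable (shift m t).continuous.measurable]
    congr 1
    funext p
    change ((s + t) + p.1, p.2) = (s + (t + p.1), p.2)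
    rw [add_assoc]

/-- The restriction `λ^i` of `λ` to the colour `i`, as a measure on `ℝ^d`:
`λ^i(A) = λ(A × {i})`. -/
def comp (i : Fin m) (lam : PointMeasure d m) : Measure (Space d) :=
  (lam.1.restrict (Prod.snd ⁻¹' {i})).map Prod.fst

/-- The intensity `I^(i)` of the points of colour `i`: the expected number of them in a set of
Lebesgue measure one, here the unit cube. -/
def intensity (μ : Measure (PointMeasure d m)) (i : Fin m) : ℝ≥0∞ :=
  ∫⁻ lam, comp i lam (cube d 1) ∂μ

/-- The law `μ` belongs to a uniformly discrete, stationary, ergodic point process in which every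
colour has positive intensity. -/
structure IsUniformlyDiscreteErgodic (μ : Measure (PointMeasure d m)) : Prop where
  /-- For some `r > 0`, every configuration in the support of `μ` has at most one point (of any
  colour) in each translate of `C_r`. -/
  uniformlyDiscrete : ∃ r : ℝ, 0 < r ∧ ∀ lam ∈ μ.support, ∀ a : Space d,
    lam.1 (((fun x => a + x) '' cube d r) ×ˢ Set.univ) ≤ 1
  /-- `μ` is invariant under translations (this is part of `ErgodicVAdd`) and ergodic. -/
  ergodic : ErgodicVAdd (Space d) (PointMeasure d m) μ
  intensity_pos : ∀ i, 0 < intensity μ i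

/-- Unique ergodicity of the translation action on `X = supp μ`: `μ` is the only translation
invariant Borel probability measure on `X`. -/
def IsUniquelyErgodic (μ : Measure (PointMeasure d m)) : Prop :=
  ∀ ν : Measure (PointMeasure d m), IsProbabilityMeasure ν →
    VAddInvariantMeasure (Space d) (PointMeasure d m) ν → ν μ.supportᶜ = 0 → ν = μ

/-- `N^w_f(λ) = λ^w(f)`, where `λ^w = ∑ i, w i • λ^i`. -/
def count (w : Fin m → ℝ) (f : Space d → ℂ) (lam : PointMeasure d m) : ℂ :=
  ∑ i, (w i : ℂ) * ∫ x, f x ∂(comp i lam)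

/-- The Palm measure of the points of colour `i`,
`D ↦ ℓ(B)⁻¹ ∫ ∑_{x ∈ B} λ^i({x}) 1_D(T_{-x} λ) dμ(λ)`, with the unit cube as `B`. -/
def palm (μ : Measure (PointMeasure d m)) (i : Fin m) : Measure (PointMeasure d m) :=
  μ.bind fun lam => ((comp i lam).restrict (cube d 1)).map fun x : Space d => (-x) +ᵥ lam

/-- The integral of `F` against the `w`-weighted Palm measure. That signed measure is defined by
`ℓ(B)⁻¹ ∫ ∑_{x ∈ B} λ^w({x}) 1_D(T_{-x} λ) dμ(λ)`, which is linear in `w`, so that it is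
`∑ i, w i • palm μ i`. -/
def weightedPalm (μ : Measure (PointMeasure d m)) (w : Fin m → ℝ) (F : PointMeasure d m → ℂ) : ℂ :=
  ∑ i, (w i : ℂ) * ∫ lam, F lam ∂(palm μ i)

/-- The weighted first moment of the weighted Palm measure, evaluated at `f`. -/
def weightedMoment (μ : Measure (PointMeasure d m)) (w : Fin m → ℝ) (f : Space d → ℂ) : ℂ :=
  weightedPalm μ w (count w f)

/-- Absolute convergence of the integrals in `weightedMoment μ w f`, for all `w`. -/
def MomentIntegrable (μ : Measure (PointMeasure d m)) (f : Space d → ℂ) : Prop :=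
  ∀ i j : Fin m, ∫⁻ lam, ∫⁻ x, ‖f x‖ₑ ∂(comp j lam) ∂(palm μ i) < ∞

/-- `Φ` is a (complex Radon) measure on `ℝ^d`: a linear functional on the continuous compactly
supported functions, bounded in the sup norm on those supported in a given compact set. -/
structure IsRadonMeasure (Φ : (Space d → ℂ) → ℂ) : Prop where
  map_add : ∀ f g : C_c(Space d, ℂ), Φ (fun x => f x + g x) = Φ f + Φ g
  map_smul : ∀ (c : ℂ) (f : C_c(Space d, ℂ)), Φ (fun x => c * f x) = c * Φ f
  bounded : ∀ K : Set (Space d), IsCompact K → ∃ C : ℝ, ∀ f : C_c(Space d, ℂ), tsupport f ⊆ K →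
    ∀ M : ℝ, (∀ x, ‖f x‖ ≤ M) → ‖Φ f‖ ≤ C * M

/-- `Φ(g * g̃) ≥ 0` for all continuous compactly supported `g`,
where `g̃(x)` is the conjugate of `g(-x)`. -/
def IsPositiveDefinite (Φ : (Space d → ℂ) → ℂ) : Prop :=
  ∀ g : C_c(Space d, ℂ), ∃ c : ℝ, 0 ≤ c ∧
    Φ (fun x => ∫ y, g y * (starRingEnd ℂ) (g (y - x))) = (c : ℂ)

/-- A positive measure is translation bounded if the translates of any compact set have bounded
measure. -/
def IsTranslationBounded (σ : Measure (Space d)) : Prop :=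
  ∀ K : Set (Space d), IsCompact K → ∃ C : ℝ≥0∞, C < ∞ ∧ ∀ t : Space d,
    σ ((fun x => t + x) '' K) ≤ C

/-- The positive measure `σ` is the Fourier transform of the weighted first moment `ω`:
`σ(f) = ω(𝓕 f)` for all rapidly decreasing `f`, all integrals being absolutely convergent. -/
def IsMomentFourierTransform (μ : Measure (PointMeasure d m)) (w : Fin m → ℝ)
    (σ : Measure (Space d)) : Prop :=
  ∀ f : 𝓢(Space d, ℂ), MomentIntegrable μ (𝓕 (f : Space d → ℂ)) ∧ Integrable f σ ∧
    ∫ x, f x ∂σ = weightedMoment μ w (𝓕 (f : Space d → ℂ))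

/-- `ℓ(C_R)⁻¹ (λ^w|_{C_R} * (λ^w|_{C_R})^~)(f)`. The weights are real, so this is
`ℓ(C_R)⁻¹ ∑_{x, y ∈ C_R} λ^w({x}) λ^w({y}) f(x - y)`. -/
def autocorrelationAt (w : Fin m → ℝ) (lam : PointMeasure d m) (R : ℝ) (f : Space d → ℂ) : ℂ :=
  ((volume (cube d R)).toReal : ℂ)⁻¹ *
    count w ((cube d R).indicator fun x =>
      count w ((cube d R).indicator fun y => f (x - y)) lam) lam

/-- The `w`-weighted autocorrelation of `λ` exists and equals `γ`: vague convergence as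
`R → ∞`. -/
def HasAutocorrelation (w : Fin m → ℝ) (lam : PointMeasure d m) (γ : (Space d → ℂ) → ℂ) : Prop :=
  ∀ f : C_c(Space d, ℂ), Tendsto (fun R : ℝ => autocorrelationAt w lam R f) atTop (𝓝 (γ f))

end PointProcess

end

noncomputable section

namespace PointProcess

variable {d m : ℕ}

/-! The weighted moment is the spatial average of a pair statistic along the orbit of a typical
configuration. Everything follows from this and from limits of finite-volume objects.

The hard-core condition makes the support `X` of `μ` vaguely compact
(`isCompact_uniformlyDiscrete`). A configuration in `X` is called generic if cube averages of every
continuous function on `X` along its orbit converge to the `μ`-mean. By the pointwise ergodic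
theorem (`ae_tendsto_cubeAverage`) and separability of `C(X)`, almost every configuration is
generic. The theorem comes from a Vitali maximal inequality together with the `L²`-density of
constants plus functions with vanishing averages. Under unique ergodicity every limit of orbital
averages is an invariant probability measure on `X`, hence `μ`, so every configuration of `X` is
generic.

For test functions `f, ψ` with `∫ ψ = 1`, the sum of `ψ(y) f(x - y)` over points `y` of colour `j`
and `x` of colour `i` is a continuous function `pairSum` of the configuration. Its orbital integral
over `C_R` counts the `f`-weighted pairs inside `C_R`, up to a boundary layer of negligible relative
volume. Its mean is, by the refined Campbell formula (`lintegral_campbell`), the integral of `f`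
against the first moment of colour `i` under the Palm measure of colour `j`. Hence a generic
configuration has autocorrelation `weightedMoment μ w`.

Positive definiteness is inherited from the finite-volume autocorrelations. The Fourier transform is
a vague limit of the measures with density `R⁻ᵈ |∑ w e(-k·x)|²`, which are the transforms of the
finite-volume autocorrelations. Hard-core bounds make both families translation bounded uniformly in
`R`, so the identity passes to the limit on Schwartz functions. -/

/-! ### Geometry of cubes. -/

theorem isOpen_cube (R : ℝ) : IsOpen (cube d R) := by
  have : cube d R = ⋂ i : Fin d, {x : Space d | |x i| < R / 2} := by
    ext x; simp [cube]
  rw [this]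
  exact isOpen_iInter_of_finite fun i => isOpen_lt (by fun_prop) continuous_const

theorem measurableSet_cube (R : ℝ) : MeasurableSet (cube d R) := (isOpen_cube R).measurableSet

theorem volume_cube (R : ℝ) : volume (cube d R) = ENNReal.ofReal R ^ d := by
  have h : cube d R = (MeasurableEquiv.toLp 2 (Fin d → ℝ)).symm ⁻¹'
      (Set.univ.pi fun _ => Set.Ioo (-(R / 2)) (R / 2)) := by
    ext x
    simp [cube, abs_lt]
  rw [h, (EuclideanSpace.volume_preserving_symm_measurableEquiv_toLp (Fin d)).measure_preimage_equiv,
    Real.volume_pi_Ioo]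
  simp

theorem zero_mem_cube {R : ℝ} (hR : 0 < R) : (0 : Space d) ∈ cube d R := fun i => by
  simpa using hR

theorem neg_mem_cube {R : ℝ} {x : Space d} (hx : x ∈ cube d R) : -x ∈ cube d R := fun i => by
  simpa using hx i

theorem neg_mem_cube_iff {R : ℝ} {x : Space d} : -x ∈ cube d R ↔ x ∈ cube d R :=
  ⟨fun h => by simpa using neg_mem_cube h, neg_mem_cube⟩

theorem add_mem_cube {R S T : ℝ} {x y : Space d} (hx : x ∈ cube d R) (hy : y ∈ cube d S)
    (h : R + S ≤ T) : x + y ∈ cube d T := fun i => by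
  have h1 := abs_add_le (x i) (y i)
  have h2 := hx i
  have h3 := hy i
  change |x i + y i| < T / 2
  linarith

theorem sub_mem_cube {R S T : ℝ} {x y : Space d} (hx : x ∈ cube d R) (hy : y ∈ cube d S)
    (h : R + S ≤ T) : x - y ∈ cube d T := by
  rw [sub_eq_add_neg]; exact add_mem_cube hx (neg_mem_cube hy) h

theorem cube_mono {R S : ℝ} (h : R ≤ S) : cube d R ⊆ cube d S := fun x hx i => by
  have := hx i
  linarith

theorem abs_apply_le_norm (x : Space d) (i : Fin d) : |x i| ≤ ‖x‖ := by
  simpa using PiLp.norm_apply_le x i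

theorem mem_cube_of_norm_lt {x : Space d} {R : ℝ} (h : ‖x‖ < R / 2) : x ∈ cube d R := fun i =>
  (abs_apply_le_norm x i).trans_lt h

theorem norm_le_of_mem_cube {x : Space d} {R : ℝ} (h : x ∈ cube d R) : ‖x‖ ≤ d * |R| := by
  have h1 : ‖x‖ ≤ ∑ i, |x i| := by
    have hs : 0 ≤ ∑ i, |x i| := Finset.sum_nonneg fun i _ => abs_nonneg _
    rw [EuclideanSpace.norm_eq]
    refine Real.sqrt_le_iff.2 ⟨hs, ?_⟩
    simp only [Real.norm_eq_abs]
    exact Finset.sum_sq_le_sq_sum_of_nonneg fun i _ => abs_nonneg _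
  refine h1.trans ?_
  have : ∑ i, |x i| ≤ ∑ _i : Fin d, |R| := Finset.sum_le_sum fun i _ => by
    have := h i
    have := le_abs_self R
    have := abs_nonneg (x i)
    linarith
  simpa using this

theorem isBounded_cube (R : ℝ) : Bornology.IsBounded (cube d R) :=
  (Metric.isBounded_closedBall (x := (0 : Space d)) (r := d * |R|)).subset fun x hx => by
    simpa using norm_le_of_mem_cube hx

theorem exists_subset_cube {K : Set (Space d)} (hK : Bornology.IsBounded K) :
    ∃ R : ℝ, 0 < R ∧ K ⊆ cube d R := by
  obtain ⟨C, hC⟩ := hK.exists_norm_le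
  refine ⟨2 * (|C| + 1), by positivity, fun x hx => mem_cube_of_norm_lt ?_⟩
  have := hC x hx
  have := le_abs_self C
  linarith

theorem image_add_eq_preimage_sub (t : Space d) (s : Set (Space d)) :
    (fun x => t + x) '' s = (fun x => x - t) ⁻¹' s := by
  ext x
  constructor
  · rintro ⟨y, hy, rfl⟩; simpa using hy
  · intro h; exact ⟨x - t, h, by simp⟩

theorem mem_translate {t x : Space d} {s : Set (Space d)} :
    x ∈ (fun y => t + y) '' s ↔ x - t ∈ s := by
  rw [image_add_eq_preimage_sub]; rfl

theorem isOpen_translate_cube (t : Space d) (R : ℝ) : IsOpen ((fun x => t + x) '' cube d R) := by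
  rw [image_add_eq_preimage_sub]
  exact (isOpen_cube R).preimage (by fun_prop)

theorem volume_translate (t : Space d) (s : Set (Space d)) :
    volume ((fun x => t + x) '' s) = volume s := by
  rw [image_add_eq_preimage_sub]
  simp only [sub_eq_add_neg]
  exact measure_preimage_add_right _ _ _

/-! ### Uniform translation bounds. -/

/-- A measure with masses of translated cubes at most `N` integrates a function `g` to at most
`N r⁻ᵈ` times the Lebesgue integral of a local majorant `h` of `g`. -/
theorem lintegral_le_of_translate_cube_le {ν : Measure (Space d)} [SFinite ν] {r : ℝ} (hr : 0 < r)
    {N : ℝ≥0∞} (hN : ∀ t, ν ((fun x => t + x) '' cube d r) ≤ N) {g h : Space d → ℝ≥0∞}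
    (hg : Measurable g) (hh : Measurable h) (hgh : ∀ y t, y - t ∈ cube d r → g y ≤ h t) :
    ∫⁻ y, g y ∂ν ≤ N * (ENNReal.ofReal r ^ d)⁻¹ * ∫⁻ t, h t := by
  have hr0 : ENNReal.ofReal r ^ d ≠ 0 := by positivity
  have hrt : ENNReal.ofReal r ^ d ≠ ∞ := ENNReal.pow_ne_top ENNReal.ofReal_ne_top
  have hm : MeasurableSet {p : Space d × Space d | p.1 - p.2 ∈ cube d r} :=
    (measurableSet_cube r).preimage (by fun_prop)
  -- Insert the window `1[y - t ∈ C_r]`, whose `t`-integral is `rᵈ`. On the window `g y` may be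
  -- replaced by `h t`; integrating `y` first then leaves the mass of `t + C_r`, at most `N`.
  have key : ENNReal.ofReal r ^ d * ∫⁻ y, g y ∂ν ≤ N * ∫⁻ t, h t := by
    calc ENNReal.ofReal r ^ d * ∫⁻ y, g y ∂ν
        = ∫⁻ y, (∫⁻ t, {p : Space d × Space d | p.1 - p.2 ∈ cube d r}.indicator
            (fun p => g p.1) (y, t)) ∂ν := by
          rw [← lintegral_const_mul _ hg]
          refine lintegral_congr fun y => ?_
          have : (fun t => {p : Space d × Space d | p.1 - p.2 ∈ cube d r}.indicator
              (fun p => g p.1) (y, t)) =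
              ((fun x => y + x) '' cube d r).indicator fun _ => g y := by
            funext t
            refine Set.indicator_eq_indicator ?_ rfl
            rw [mem_translate, ← neg_mem_cube_iff, neg_sub]
            rfl
          rw [this, lintegral_indicator_const (isOpen_translate_cube y r).measurableSet,
            volume_translate, volume_cube, mul_comm]
      _ ≤ ∫⁻ y, (∫⁻ t, {p : Space d × Space d | p.1 - p.2 ∈ cube d r}.indicator
            (fun p => h p.2) (y, t)) ∂ν := by
          refine lintegral_mono fun y => lintegral_mono fun t => ?_
          simp only [Set.indicator, Set.mem_ofPred_eq]
          split_ifs with hc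
          · exact hgh y t hc
          · exact le_rfl
      _ = ∫⁻ t, (∫⁻ y, {p : Space d × Space d | p.1 - p.2 ∈ cube d r}.indicator
            (fun p => h p.2) (y, t) ∂ν) :=
          lintegral_lintegral_swap ((hh.comp measurable_snd).indicator hm).aemeasurable
      _ ≤ ∫⁻ t, N * h t := by
          refine lintegral_mono fun t => ?_
          have : (fun y => {p : Space d × Space d | p.1 - p.2 ∈ cube d r}.indicator
              (fun p => h p.2) (y, t)) =
              ((fun x => t + x) '' cube d r).indicator fun _ => h t := by
            funext y
            refine Set.indicator_eq_indicator ?_ rfl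
            rw [mem_translate]
            rfl
          rw [this, lintegral_indicator_const (isOpen_translate_cube t r).measurableSet, mul_comm]
          exact mul_le_mul_left (hN t) _
      _ = N * ∫⁻ t, h t := lintegral_const_mul _ hh
  rw [mul_right_comm, ← div_eq_mul_inv, ENNReal.le_div_iff_mul_le (Or.inl hr0) (Or.inl hrt),
    mul_comm]
  exact key

/-- The weight `(1 + ‖x‖)^{-(d+1)}`. -/
def decay (x : Space d) : ℝ := ((1 + ‖x‖) ^ (d + 1))⁻¹

theorem decay_pos (x : Space d) : 0 < decay x := by
  unfold decay; positivity

theorem continuous_decay : Continuous (decay : Space d → ℝ) := by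
  unfold decay
  exact Continuous.inv₀ (by fun_prop) fun x => by positivity

theorem lintegral_decay_lt_top : ∫⁻ x : Space d, ENNReal.ofReal (decay x) < ∞ := by
  have h := finite_integral_one_add_norm (E := Space d) (μ := volume) (r := (d + 1 : ℕ))
    (by simp)
  convert h using 3 with x
  rw [Real.rpow_neg (by positivity), Real.rpow_natCast, decay]

/-- Points of one cube `t + C_r` are at distance at most `ρ` from `t`, so `1 + ‖t‖ ≤ (1 + ρ)(1 +
‖y‖)` and `decay` varies there by at most the factor `(1 + ρ)^(d+1)`. The constant `D` depends only
on `d` and `r`; this uniformity is what later controls tails for whole families of measures. -/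
theorem exists_lintegral_decay_le {r : ℝ} (hr : 0 < r) : ∃ D : ℝ≥0∞, D < ∞ ∧
    ∀ (ν : Measure (Space d)) [SFinite ν] (N : ℝ≥0∞),
      (∀ t, ν ((fun x => t + x) '' cube d r) ≤ N) →
      ∫⁻ x, ENNReal.ofReal (decay x) ∂ν ≤ N * D := by
  set ρ : ℝ := d * |r|
  have hρ : 0 ≤ ρ := by positivity
  refine ⟨(ENNReal.ofReal r ^ d)⁻¹ * (ENNReal.ofReal ((1 + ρ) ^ (d + 1)) *
    ∫⁻ x : Space d, ENNReal.ofReal (decay x)), ?_, fun ν _ N hN => ?_⟩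
  · refine ENNReal.mul_lt_top (ENNReal.inv_lt_top.2 (by positivity)) ?_
    exact ENNReal.mul_lt_top ENNReal.ofReal_lt_top lintegral_decay_lt_top
  · have hm : Measurable fun x : Space d => ENNReal.ofReal (decay x) :=
      continuous_decay.measurable.ennreal_ofReal
    have := lintegral_le_of_translate_cube_le hr hN hm
      (hm.const_mul (ENNReal.ofReal ((1 + ρ) ^ (d + 1)))) fun y t hyt => by
        rw [← ENNReal.ofReal_mul (by positivity)]
        refine ENNReal.ofReal_le_ofReal ?_
        unfold decay
        rw [← div_eq_mul_inv, inv_eq_one_div, div_le_div_iff₀ (by positivity) (by positivity),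
          one_mul, ← mul_pow]
        refine pow_le_pow_left₀ (by positivity) ?_ _
        have h1 := norm_le_of_mem_cube hyt
        have h2 : ‖t‖ ≤ ‖y‖ + ‖y - t‖ := by
          have := norm_sub_le y (y - t)
          simpa using this
        nlinarith [norm_nonneg y]
    rw [lintegral_const_mul _ hm] at this
    rw [← mul_assoc]
    exact this

theorem exists_measure_translate_le {r : ℝ} (hr : 0 < r) {K : Set (Space d)}
    (hK : Bornology.IsBounded K) : ∃ D : ℝ≥0∞, D < ∞ ∧
    ∀ (ν : Measure (Space d)) [SFinite ν] (N : ℝ≥0∞),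
      (∀ t, ν ((fun x => t + x) '' cube d r) ≤ N) → ∀ t, ν ((fun x => t + x) '' K) ≤ N * D := by
  obtain ⟨R, hR, hKR⟩ := exists_subset_cube hK
  refine ⟨(ENNReal.ofReal r ^ d)⁻¹ * volume (cube d (R + r)), ?_, fun ν _ N hN t => ?_⟩
  · refine ENNReal.mul_lt_top (ENNReal.inv_lt_top.2 (by positivity)) ?_
    rw [volume_cube]
    exact ENNReal.pow_lt_top ENNReal.ofReal_lt_top
  · have hm (S : ℝ) := (isOpen_translate_cube t S).measurableSet
    have := lintegral_le_of_translate_cube_le hr hN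
      (measurable_one.indicator (hm R)) (measurable_one.indicator (hm (R + r)))
      fun y s hys => by
        simp only [image_add_eq_preimage_sub]
        by_cases hy : y - t ∈ cube d R
        · have : s - t ∈ cube d (R + r) := by
            have := sub_mem_cube hy hys le_rfl
            simpa using this
          rw [Set.indicator_of_mem (by exact hy), Set.indicator_of_mem (by exact this)]
          exact le_rfl
        · rw [Set.indicator_of_notMem (by exact hy)]
          exact zero_le
    rw [lintegral_indicator_one (hm R), lintegral_indicator_one (hm _), volume_translate] at this
    rw [← mul_assoc]
    exact (measure_mono (Set.image_mono hKR)).trans this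

/-! ### Orbit averages and the maximal inequality. -/

section Ergodic

variable {Y : Type*} [AddAction (Space d) Y]

/-- The average of `F` along the part of the orbit of `y` parametrized by the cube `C_R`. -/
def cubeAverage (d : ℕ) {Y : Type*} [AddAction (Space d) Y] (F : Y → ℝ) (R : ℝ) (y : Y) : ℝ :=
  (R ^ d)⁻¹ * ∫ t in cube d R, F (t +ᵥ y)

theorem volume_cube_ne_top (R : ℝ) : volume (cube d R) ≠ ∞ := by
  rw [volume_cube]; exact ENNReal.pow_ne_top ENNReal.ofReal_ne_top

theorem volume_real_cube {R : ℝ} (hR : 0 ≤ R) : volume.real (cube d R) = R ^ d := by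
  rw [measureReal_def, volume_cube, ENNReal.toReal_pow, ENNReal.toReal_ofReal hR]

theorem integrableOn_cube_of_bounded {f : Space d → ℝ} (hf : Measurable f) {C : ℝ}
    (hC : ∀ t, |f t| ≤ C) (R : ℝ) : IntegrableOn f (cube d R) := by
  have : IsFiniteMeasure (volume.restrict (cube d R)) :=
    ⟨by simpa using (volume_cube_ne_top R).lt_top⟩
  exact Integrable.of_bound hf.aestronglyMeasurable C (ae_of_all _ hC)

/-- The Følner property of cubes: a boundary layer of fixed width has negligible relative volume. -/
theorem tendsto_cube_ratio (c : ℝ) :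
    Tendsto (fun R : ℝ => (R + c) ^ d / R ^ d) atTop (𝓝 1) := by
  have h : Tendsto (fun R : ℝ => (1 + c / R) ^ d) atTop (𝓝 ((1 + 0) ^ d)) :=
    (tendsto_const_nhds.add (tendsto_const_nhds.div_atTop tendsto_id)).pow d
  simp only [add_zero, one_pow] at h
  refine h.congr' ?_
  filter_upwards [eventually_gt_atTop 0] with R hR
  rw [← div_pow, add_div, div_self hR.ne']

theorem setIntegral_vadd_vadd (F : Y → ℝ) (g : Space d) (y : Y) (s : Set (Space d))
    (hs : MeasurableSet s) :
    ∫ t in s, F (t +ᵥ (g +ᵥ y)) = ∫ t in (fun x => g + x) '' s, F (t +ᵥ y) := by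
  have hms : MeasurableSet ((fun x => g + x) '' s) := by
    rw [image_add_eq_preimage_sub]; exact hs.preimage (by fun_prop)
  rw [← integral_indicator hs, ← integral_indicator hms,
    ← integral_add_right_eq_self (((fun x => g + x) '' s).indicator fun t => F (t +ᵥ y)) g]
  refine integral_congr_ae (ae_of_all _ fun t => ?_)
  simp only [← add_vadd]
  refine Set.indicator_eq_indicator ?_ rfl
  rw [mem_translate, add_sub_cancel_right]

theorem setLIntegral_vadd_vadd (F : Y → ℝ≥0∞) (g : Space d) (y : Y) (s : Set (Space d))
    (hs : MeasurableSet s) :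
    ∫⁻ t in s, F (t +ᵥ (g +ᵥ y)) = ∫⁻ t in (fun x => g + x) '' s, F (t +ᵥ y) := by
  have hms : MeasurableSet ((fun x => g + x) '' s) := by
    rw [image_add_eq_preimage_sub]; exact hs.preimage (by fun_prop)
  rw [← lintegral_indicator hs, ← lintegral_indicator hms,
    ← lintegral_add_right_eq_self (((fun x => g + x) '' s).indicator fun t => F (t +ᵥ y)) g]
  refine lintegral_congr fun t => ?_
  simp only [← add_vadd]
  refine Set.indicator_eq_indicator ?_ rfl
  rw [mem_translate, add_sub_cancel_right]

theorem abs_setIntegral_sub_le {f : Space d → ℝ} (hf : Measurable f) {C : ℝ}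
    (hC : ∀ t, |f t| ≤ C) {R S : ℝ} (hR : 0 ≤ R) (hRS : R ≤ S) {s : Set (Space d)}
    (hs : MeasurableSet s) (hsS : s ⊆ cube d S) (hv : volume s = volume (cube d R)) :
    |(∫ t in cube d S, f t) - ∫ t in s, f t| ≤ C * (S ^ d - R ^ d) := by
  have hi := integrableOn_cube_of_bounded hf hC S
  rw [← setIntegral_sdiff hs hi hsS]
  have h := norm_setIntegral_le_of_norm_le_const (μ := volume) (s := cube d S \ s) (f := f) (C := C)
    ((measure_mono Set.sdiff_subset).trans_lt (volume_cube_ne_top S).lt_top)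
    fun t _ => hC t
  rw [measureReal_sdiff hsS hs (volume_cube_ne_top S),
    measureReal_def volume s, hv, ← measureReal_def, volume_real_cube hR,
    volume_real_cube (hR.trans hRS)] at h
  exact h

/-- The two averages run over `g + C_R` and `C_R`. Both sets have volume `Rᵈ` and lie in `C_{R+c}`,
so each integral differs from that over `C_{R+c}` by at most `C((R+c)ᵈ - Rᵈ)`. This holds on every
orbit, with no measure on `Y`. -/
theorem tendsto_cubeAverage_vadd_sub {F : Y → ℝ} {C : ℝ} (hC : ∀ y, |F y| ≤ C) (g : Space d)
    (y : Y) (hF : Measurable fun t : Space d => F (t +ᵥ y)) :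
    Tendsto (fun R => cubeAverage d F R (g +ᵥ y) - cubeAverage d F R y) atTop (𝓝 0) := by
  obtain ⟨c, hc, hgc⟩ := exists_subset_cube (Bornology.isBounded_singleton (x := g))
  rw [Set.singleton_subset_iff] at hgc
  have hlim : Tendsto (fun R : ℝ => 2 * C * ((R + c) ^ d / R ^ d - 1)) atTop (𝓝 0) := by
    simpa using ((tendsto_cube_ratio (d := d) c).sub_const 1).const_mul (2 * C)
  refine squeeze_zero_norm' ?_ hlim
  filter_upwards [eventually_gt_atTop 0] with R hR
  have h1 := abs_setIntegral_sub_le hF (fun t => hC _) hR.le (le_add_of_nonneg_right hc.le)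
    (measurableSet_cube R) (cube_mono (le_add_of_nonneg_right hc.le)) rfl
  have h2 := abs_setIntegral_sub_le hF (fun t => hC _) hR.le (le_add_of_nonneg_right hc.le)
    (isOpen_translate_cube g R).measurableSet (by
      rintro _ ⟨x, hx, rfl⟩
      exact add_mem_cube hgc hx (by linarith)) (volume_translate _ _)
  unfold cubeAverage
  rw [setIntegral_vadd_vadd F g y _ (measurableSet_cube R), ← mul_sub, Real.norm_eq_abs, abs_mul,
    abs_of_pos (by positivity), inv_mul_le_iff₀ (by positivity)]
  have h3 := abs_sub_le_iff.1 h1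
  have h4 := abs_sub_le_iff.1 h2
  have h5 : R ^ d * (2 * C * ((R + c) ^ d / R ^ d - 1)) = 2 * (C * ((R + c) ^ d - R ^ d)) := by
    field_simp
  rw [h5, abs_sub_le_iff]
  constructor <;> linarith

/-- The maximal inequality on a single orbit. Each bad `t` is the centre of a cube `t + C_n` on
which `G` has large integral. A disjoint Vitali subfamily, enlarged three times, covers the bad set,
while disjointness adds up the integrals inside `C_{L+N}`. The cutoff `N` bounds the sizes and
confines the cubes to `C_{L+N}`. -/
theorem measure_maximal_pointwise {G : Y → ℝ≥0∞} (a : ℝ≥0∞) (N : ℕ) (L : ℝ) (y : Y) :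
    a * volume {t : Space d | t ∈ cube d L ∧ ∃ n : ℕ, 1 ≤ n ∧ n ≤ N ∧
      a * (n : ℝ≥0∞) ^ d < ∫⁻ s in cube d (n : ℝ), G (s +ᵥ (t +ᵥ y))} ≤
    3 ^ d * ∫⁻ t in cube d (L + N), G (t +ᵥ y) := by
  set T : Set (Space d × ℕ) := {p | p.1 ∈ cube d L ∧ 1 ≤ p.2 ∧ p.2 ≤ N ∧
    a * (p.2 : ℝ≥0∞) ^ d < ∫⁻ s in cube d (p.2 : ℝ), G (s +ᵥ (p.1 +ᵥ y))} with hT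
  let B : Space d × ℕ → Set (Space d) := fun p => (fun x => p.1 + x) '' cube d (p.2 : ℝ)
  have hself : ∀ p ∈ T, p.1 ∈ B p := fun p hp =>
    ⟨0, zero_mem_cube (by exact_mod_cast hp.2.1), by simp⟩
  -- With ratio 2, each cube `t + C_n` meets a selected cube `b + C_k` with `n ≤ 2k`. Hence `t - b ∈
  -- C_{n+k} ⊆ C_{3k}`, which produces the constant `3ᵈ`.
  obtain ⟨u, huT, hud, hu⟩ := Vitali.exists_disjoint_subfamily_covering_enlargement B T
    (fun p => (p.2 : ℝ)) 2 one_lt_two (fun p _ => Nat.cast_nonneg _) N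
    (fun p hp => Nat.cast_le.2 hp.2.2.1) (fun p hp => ⟨_, hself p hp⟩)
  have huc : u.Countable := hud.countable_of_isOpen (fun p _ => isOpen_translate_cube _ _)
    fun p hp => ⟨_, hself p (huT hp)⟩
  have hcov : {t : Space d | t ∈ cube d L ∧ ∃ n : ℕ, 1 ≤ n ∧ n ≤ N ∧
      a * (n : ℝ≥0∞) ^ d < ∫⁻ s in cube d (n : ℝ), G (s +ᵥ (t +ᵥ y))} ⊆
      ⋃ p ∈ u, (fun x => p.1 + x) '' cube d (3 * (p.2 : ℝ)) := by
    rintro t ⟨htL, n, hn1, hnN, hn⟩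
    obtain ⟨b, hb, ⟨z, hz1, hz2⟩, hle⟩ := hu (t, n) ⟨htL, hn1, hnN, hn⟩
    refine Set.mem_biUnion hb ?_
    rw [mem_translate] at hz1 hz2 ⊢
    have := sub_mem_cube (T := 3 * (b.2 : ℝ)) hz2 hz1 (by dsimp only at hle ⊢; linarith)
    simpa using this
  have hsub : ⋃ p ∈ u, B p ⊆ cube d (L + N) := by
    refine Set.iUnion₂_subset fun p hp => ?_
    rintro _ ⟨x, hx, rfl⟩
    refine add_mem_cube (huT hp).1 hx ?_
    have : (p.2 : ℝ) ≤ N := Nat.cast_le.2 (huT hp).2.2.1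
    linarith
  calc _ ≤ a * volume (⋃ p ∈ u, (fun x => p.1 + x) '' cube d (3 * (p.2 : ℝ))) := by gcongr
    _ ≤ a * ∑' p : u, volume ((fun x => p.1.1 + x) '' cube d (3 * (p.1.2 : ℝ))) := by
        gcongr; exact measure_biUnion_le _ huc _
    _ = ∑' p : u, 3 ^ d * (a * (p.1.2 : ℝ≥0∞) ^ d) := by
        rw [← ENNReal.tsum_mul_left]
        refine tsum_congr fun p => ?_
        rw [volume_translate, volume_cube, ENNReal.ofReal_mul (by norm_num), ENNReal.ofReal_natCast,
          mul_pow]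
        simp only [ENNReal.ofReal_ofNat]
        ring
    _ ≤ ∑' p : u, 3 ^ d * ∫⁻ t in B p, G (t +ᵥ y) := by
        refine ENNReal.tsum_le_tsum fun p => ?_
        gcongr
        have := (huT p.2).2.2.2.le
        rwa [setLIntegral_vadd_vadd G _ y _ (measurableSet_cube _)] at this
    _ = 3 ^ d * ∫⁻ t in ⋃ p ∈ u, B p, G (t +ᵥ y) := by
        rw [ENNReal.tsum_mul_left, lintegral_biUnion huc
          (fun p _ => (isOpen_translate_cube _ _).measurableSet) hud]
    _ ≤ _ := by
        gcongr

variable [MeasurableSpace Y]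

theorem lintegral_orbit_lintegral {μ : Measure Y} [SFinite μ]
    [VAddInvariantMeasure (Space d) Y μ] (hm : Measurable fun p : Space d × Y => p.1 +ᵥ p.2)
    {G : Y → ℝ≥0∞} (hG : Measurable G) (s : Set (Space d)) :
    ∫⁻ y, (∫⁻ t in s, G (t +ᵥ y)) ∂μ = volume s * ∫⁻ y, G y ∂μ := by
  have hmt : ∀ t : Space d, Measurable fun y : Y => t +ᵥ y := fun t =>
    hm.comp measurable_prodMk_left
  rw [lintegral_lintegral_swap (by
    exact ((hG.comp hm).comp measurable_swap).aemeasurable)]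
  have : ∀ t : Space d, ∫⁻ y, G (t +ᵥ y) ∂μ = ∫⁻ y, G y ∂μ := fun t => by
    rw [← lintegral_map hG (hmt t)]
    congr 1
    ext A hA
    rw [Measure.map_apply (hmt t) hA]
    exact VAddInvariantMeasure.measure_preimage_vadd t hA
  simp [this, mul_comm]

/-- Transference: the inequality on orbits is integrated over `μ`, and invariance turns orbital
volumes into `μ`-measures. The loss `(1 + N/L)ᵈ` disappears as `L → ∞` with `N` fixed. -/
theorem measure_maximal_le_aux {μ : Measure Y} [SFinite μ]
    [VAddInvariantMeasure (Space d) Y μ] (hm : Measurable fun p : Space d × Y => p.1 +ᵥ p.2)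
    {G : Y → ℝ≥0∞} (hG : Measurable G) (a : ℝ≥0∞) (N : ℕ) :
    a * μ {y | ∃ n : ℕ, 1 ≤ n ∧ n ≤ N ∧
      a * (n : ℝ≥0∞) ^ d < ∫⁻ s in cube d (n : ℝ), G (s +ᵥ y)} ≤ 3 ^ d * ∫⁻ y, G y ∂μ := by
  set E : Set Y := {y | ∃ n : ℕ, 1 ≤ n ∧ n ≤ N ∧
      a * (n : ℝ≥0∞) ^ d < ∫⁻ s in cube d (n : ℝ), G (s +ᵥ y)} with hE
  have hEm : MeasurableSet E := by
    have : E = ⋃ n : ℕ, {y | 1 ≤ n ∧ n ≤ N ∧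
        a * (n : ℝ≥0∞) ^ d < ∫⁻ s in cube d (n : ℝ), G (s +ᵥ y)} := by
      ext y; simp [hE]
    rw [this]
    refine MeasurableSet.iUnion fun n => ?_
    refine (MeasurableSet.const _).inter ((MeasurableSet.const _).inter ?_)
    exact measurableSet_lt measurable_const
      (((hG.comp hm).comp measurable_swap).lintegral_prod_right')
  have key : ∀ L : ℕ, 1 ≤ L → a * μ E ≤ (1 + N / L) ^ d * (3 ^ d * ∫⁻ y, G y ∂μ) := by
    intro L hL
    have h1 : volume (cube d (L : ℝ)) * (a * μ E) ≤
        3 ^ d * (volume (cube d ((L : ℝ) + N)) * ∫⁻ y, G y ∂μ) := by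
      rw [← lintegral_orbit_lintegral hm hG, mul_left_comm, ← lintegral_indicator_one hEm,
        ← lintegral_orbit_lintegral hm (measurable_one.indicator hEm) (cube d (L : ℝ)),
        ← lintegral_const_mul' _ _ (ENNReal.pow_ne_top (by simp)),
        ← lintegral_const_mul a (by
          exact (((measurable_one.indicator hEm).comp hm).comp
            measurable_swap).lintegral_prod_right')]
      refine lintegral_mono fun y => ?_
      have hmE : MeasurableSet {t : Space d | t +ᵥ y ∈ E} :=
        hEm.preimage (hm.comp measurable_prodMk_right)
      have h2 : ∫⁻ t in cube d (L : ℝ), E.indicator 1 (t +ᵥ y) =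
          volume {t : Space d | t ∈ cube d (L : ℝ) ∧ t +ᵥ y ∈ E} := by
        have : (fun t : Space d => E.indicator (1 : Y → ℝ≥0∞) (t +ᵥ y)) =
            {t : Space d | t +ᵥ y ∈ E}.indicator 1 := by
          funext t
          exact Set.indicator_eq_indicator Iff.rfl rfl
        rw [this, lintegral_indicator_one hmE, Measure.restrict_apply hmE, Set.inter_comm]
        rfl
      rw [h2]
      exact measure_maximal_pointwise a N L y
    have hL0 : (L : ℝ≥0∞) ≠ 0 := by simp; omega
    have hLt : (L : ℝ≥0∞) ≠ ∞ := by simp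
    rw [volume_cube, volume_cube, ENNReal.ofReal_natCast,
      ENNReal.ofReal_add (by positivity) (by positivity), ENNReal.ofReal_natCast,
      ENNReal.ofReal_natCast, mul_left_comm] at h1
    have h3 : (1 + N / L : ℝ≥0∞) = (L + N) / L := by
      rw [ENNReal.add_div, ENNReal.div_self hL0 hLt]
    rw [h3, div_eq_mul_inv, mul_pow, ← ENNReal.inv_pow, ← div_eq_mul_inv, ENNReal.mul_comm_div,
      ← mul_div_assoc, ENNReal.le_div_iff_mul_le (Or.inl (by positivity))
      (Or.inl (ENNReal.pow_ne_top hLt))]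
    calc _ = a * (L ^ d * μ E) := by ring
      _ ≤ _ := h1
      _ = _ := by ring
  by_cases hI : ∫⁻ y, G y ∂μ = ∞
  · rw [hI, ENNReal.mul_top (by positivity)]; exact le_top
  have hlim : Tendsto (fun L : ℕ => (1 + N / L : ℝ≥0∞) ^ d * (3 ^ d * ∫⁻ y, G y ∂μ)) atTop
      (𝓝 ((1 + 0) ^ d * (3 ^ d * ∫⁻ y, G y ∂μ))) := by
    refine ENNReal.Tendsto.mul_const ?_ (Or.inl (by simp))
    refine ENNReal.Tendsto.pow ?_
    refine tendsto_const_nhds.add ?_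
    have := ENNReal.Tendsto.const_div (a := (N : ℝ≥0∞)) ENNReal.tendsto_nat_nhds_top (Or.inr (by simp))
    simpa using this
  rw [add_zero, one_pow, one_mul] at hlim
  refine ge_of_tendsto hlim ?_
  filter_upwards [eventually_ge_atTop 1] with L hL using key L hL

/-- The weak-type maximal inequality for averages over integer cubes. -/
theorem measure_maximal_le {μ : Measure Y} [SFinite μ]
    [VAddInvariantMeasure (Space d) Y μ] (hm : Measurable fun p : Space d × Y => p.1 +ᵥ p.2)
    {G : Y → ℝ≥0∞} (hG : Measurable G) (a : ℝ≥0∞) :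
    a * μ {y | ∃ n : ℕ, 1 ≤ n ∧
      a * (n : ℝ≥0∞) ^ d < ∫⁻ s in cube d (n : ℝ), G (s +ᵥ y)} ≤ 3 ^ d * ∫⁻ y, G y ∂μ := by
  have hU : {y | ∃ n : ℕ, 1 ≤ n ∧ a * (n : ℝ≥0∞) ^ d < ∫⁻ s in cube d (n : ℝ), G (s +ᵥ y)} =
      ⋃ N : ℕ, {y | ∃ n : ℕ, 1 ≤ n ∧ n ≤ N ∧
        a * (n : ℝ≥0∞) ^ d < ∫⁻ s in cube d (n : ℝ), G (s +ᵥ y)} := by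
    ext y
    simp only [Set.mem_iUnion]
    constructor
    · rintro ⟨n, h1, h2⟩; exact ⟨n, n, h1, le_rfl, h2⟩
    · rintro ⟨N, n, h1, _, h2⟩; exact ⟨n, h1, h2⟩
  rw [hU, Monotone.measure_iUnion (by
    rintro N N' h y ⟨n, h1, h2, h3⟩; exact ⟨n, h1, h2.trans h, h3⟩), ENNReal.mul_iSup]
  exact iSup_le fun N => measure_maximal_le_aux hm hG a N

end Ergodic

/-! ### The pointwise ergodic theorem. -/

section Ergodic

variable {Y : Type*} [AddAction (Space d) Y]

theorem cubeAverage_add {F G : Y → ℝ} {R : ℝ} {y : Y}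
    (hF : IntegrableOn (fun t : Space d => F (t +ᵥ y)) (cube d R))
    (hG : IntegrableOn (fun t : Space d => G (t +ᵥ y)) (cube d R)) :
    cubeAverage d (F + G) R y = cubeAverage d F R y + cubeAverage d G R y := by
  unfold cubeAverage
  rw [← mul_add, ← integral_add hF hG]
  rfl

theorem cubeAverage_smul (c : ℝ) (F : Y → ℝ) (R : ℝ) (y : Y) :
    cubeAverage d (c • F) R y = c * cubeAverage d F R y := by
  unfold cubeAverage
  rw [mul_left_comm, ← integral_const_mul c]
  rfl

variable [MeasurableSpace Y]

/-- Bounded measurable functions whose averages over cubes tend to zero along every orbit. -/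
structure NullAverages (d : ℕ) {Y : Type*} [AddAction (Space d) Y] [MeasurableSpace Y]
    (v : Y → ℝ) : Prop where
  measurable : Measurable v
  bounded : ∃ C, ∀ y, |v y| ≤ C
  tendsto : ∀ y, Tendsto (fun R => cubeAverage d v R y) atTop (𝓝 0)

theorem integrableOn_orbit (hm : Measurable fun p : Space d × Y => p.1 +ᵥ p.2) {F : Y → ℝ}
    (hF : Measurable F) {C : ℝ} (hC : ∀ y, |F y| ≤ C) (R : ℝ) (y : Y) :
    IntegrableOn (fun t : Space d => F (t +ᵥ y)) (cube d R) :=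
  integrableOn_cube_of_bounded (hF.comp (hm.comp measurable_prodMk_right)) (fun _ => hC _) R

theorem NullAverages.add (hm : Measurable fun p : Space d × Y => p.1 +ᵥ p.2) {v w : Y → ℝ}
    (hv : NullAverages d v) (hw : NullAverages d w) : NullAverages d (v + w) := by
  obtain ⟨C, hC⟩ := hv.bounded
  obtain ⟨D, hD⟩ := hw.bounded
  refine ⟨hv.measurable.add hw.measurable, ⟨C + D, fun y => ?_⟩, fun y => ?_⟩
  · exact (abs_add_le _ _).trans (add_le_add (hC y) (hD y))
  · have := (hv.tendsto y).add (hw.tendsto y)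
    rw [add_zero] at this
    refine this.congr fun R => ?_
    rw [cubeAverage_add (integrableOn_orbit hm hv.measurable hC R y)
      (integrableOn_orbit hm hw.measurable hD R y)]

theorem NullAverages.smul {v : Y → ℝ} (hv : NullAverages d v) (c : ℝ) :
    NullAverages d (c • v) := by
  obtain ⟨C, hC⟩ := hv.bounded
  refine ⟨hv.measurable.const_smul c, ⟨|c| * C, fun y => ?_⟩, fun y => ?_⟩
  · simp only [Pi.smul_apply, smul_eq_mul, abs_mul]
    exact mul_le_mul_of_nonneg_left (hC y) (abs_nonneg _)
  · simpa [cubeAverage_smul] using (hv.tendsto y).const_mul c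

theorem nullAverages_zero : NullAverages d (0 : Y → ℝ) :=
  ⟨measurable_const, ⟨0, fun y => by simp⟩, fun y => by simp [cubeAverage]⟩

/-- Coboundaries of indicator functions have vanishing averages. -/
theorem nullAverages_coboundary (hm : Measurable fun p : Space d × Y => p.1 +ᵥ p.2) (g : Space d)
    {A : Set Y} (hA : MeasurableSet A) :
    NullAverages d (((g +ᵥ ·) ⁻¹' A).indicator 1 - A.indicator 1 : Y → ℝ) := by
  have hmg : Measurable fun y : Y => g +ᵥ y := hm.comp measurable_prodMk_left
  have h1 : ∀ (B : Set Y) y, |B.indicator (1 : Y → ℝ) y| ≤ 1 := fun B y => by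
    by_cases h : y ∈ B <;> simp [h]
  have hB := hmg hA
  refine ⟨(measurable_one.indicator hB).sub (measurable_one.indicator hA), ⟨1 + 1, fun y =>
    (abs_sub _ _).trans (add_le_add (h1 _ _) (h1 _ _))⟩, fun y => ?_⟩
  have hAi : Measurable (A.indicator (1 : Y → ℝ)) := measurable_one.indicator hA
  have hBi : Measurable (((g +ᵥ ·) ⁻¹' A).indicator (1 : Y → ℝ)) := measurable_one.indicator hB
  refine (tendsto_cubeAverage_vadd_sub (h1 A) g y
    (hAi.comp (hm.comp measurable_prodMk_right))).congr fun R => ?_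
  have hneg : (((g +ᵥ ·) ⁻¹' A).indicator 1 - A.indicator 1 : Y → ℝ) =
      ((g +ᵥ ·) ⁻¹' A).indicator 1 + (-1 : ℝ) • A.indicator 1 := by
    rw [neg_one_smul, sub_eq_add_neg]
  have hAi' : IntegrableOn (fun t : Space d => ((-1 : ℝ) • A.indicator (1 : Y → ℝ)) (t +ᵥ y))
      (cube d R) := Integrable.smul (-1 : ℝ) (integrableOn_orbit hm hAi (h1 _) R y)
  rw [hneg, cubeAverage_add (integrableOn_orbit hm hBi (h1 _) R y) hAi', cubeAverage_smul]
  have : cubeAverage d (((g +ᵥ ·) ⁻¹' A).indicator (1 : Y → ℝ)) R y =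
      cubeAverage d (A.indicator 1) R (g +ᵥ y) := by
    unfold cubeAverage
    congr 2
    funext t
    refine Set.indicator_eq_indicator ?_ rfl
    rw [Set.mem_preimage, vadd_vadd, vadd_vadd, add_comm]
  rw [this]; ring

/-- The classes in `L²` of functions with vanishing averages. -/
def nullAveragesSubmodule (hm : Measurable fun p : Space d × Y => p.1 +ᵥ p.2) (μ : Measure Y) :
    Submodule ℝ (Lp ℝ 2 μ) where
  carrier := {g | ∃ v, NullAverages d v ∧ g =ᵐ[μ] v}
  add_mem' := by
    rintro g h ⟨v, hv, hgv⟩ ⟨w, hw, hhw⟩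
    exact ⟨v + w, hv.add hm hw, (Lp.coeFn_add g h).trans (hgv.add hhw)⟩
  zero_mem' := ⟨0, nullAverages_zero, Lp.coeFn_zero _ _ _⟩
  smul_mem' := by
    rintro c g ⟨v, hv, hgv⟩
    exact ⟨c • v, hv.smul c, (Lp.coeFn_smul c g).trans (hgv.const_smul c)⟩

/-- Orthogonality to coboundaries of indicators says that `∫ k` over `A` and over its translate
agree. Therefore `k` is almost everywhere invariant under each translation, its level sets are
almost invariant, and ergodicity makes each of them null or conull. -/
theorem ae_eq_const_of_mem_orthogonal {μ : Measure Y} [IsProbabilityMeasure μ]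
    [ErgodicVAdd (Space d) Y μ] (hm : Measurable fun p : Space d × Y => p.1 +ᵥ p.2)
    {k : Lp ℝ 2 μ} (hk : k ∈ (nullAveragesSubmodule hm μ)ᗮ) : ∃ c : ℝ, k =ᵐ[μ] fun _ => c := by
  have hmg : ∀ g : Space d, MeasurePreserving (fun y : Y => g +ᵥ y) μ μ := fun g =>
    ⟨hm.comp measurable_prodMk_left, by
      ext A hA
      rw [Measure.map_apply (by exact hm.comp measurable_prodMk_left) hA]
      exact VAddInvariantMeasure.measure_preimage_vadd g hA⟩
  have hki : Integrable k μ := (Lp.memLp k).integrable one_le_two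
  have hset : ∀ (g : Space d) (A : Set Y), MeasurableSet A →
      ∫ y in (g +ᵥ ·) ⁻¹' A, k y ∂μ = ∫ y in A, k y ∂μ := by
    intro g A hA
    have hB := (hmg g).measurable hA
    have hmem : indicatorConstLp 2 hB (measure_ne_top μ _) (1 : ℝ) -
        indicatorConstLp 2 hA (measure_ne_top μ _) (1 : ℝ) ∈ nullAveragesSubmodule hm μ := by
      refine ⟨_, nullAverages_coboundary hm g hA, (Lp.coeFn_sub _ _).trans ?_⟩
      exact indicatorConstLp_coeFn.sub indicatorConstLp_coeFn
    have h0 := (Submodule.mem_orthogonal _ _).1 hk _ hmem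
    rw [inner_sub_left, L2.inner_indicatorConstLp_one, L2.inner_indicatorConstLp_one] at h0
    linarith
  have hinv : ∀ g : Space d, (fun y => k (g +ᵥ y)) =ᵐ[μ] k := by
    intro g
    refine Integrable.ae_eq_of_forall_setIntegral_eq _ _
      ((hmg g).integrable_comp_of_integrable hki) hki fun s hs _ => ?_
    -- Writing `s` as a preimage under `g` allows a change of variables; `hset` at `-g` then removes
    -- the remaining translation.
    have hs' : s = (g +ᵥ ·) ⁻¹' ((-g +ᵥ ·) ⁻¹' s) := by
      ext y; simp
    have h2 := (hmg g).setIntegral_preimage_emb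
      (MeasurableEquiv.measurableEmbedding
        { toFun := fun y : Y => g +ᵥ y, invFun := fun y => -g +ᵥ y,
          left_inv := fun y => by simp, right_inv := fun y => by simp,
          measurable_toFun := (hmg g).measurable,
          measurable_invFun := (hmg (-g)).measurable }) k ((-g +ᵥ ·) ⁻¹' s)
    rw [← hs'] at h2
    rw [h2, hset _ _ hs]
  refine exists_eventuallyEq_const_of_forall_separating MeasurableSet fun U hU => ?_
  have h3 := ErgodicVAdd.aeconst_of_forall_preimage_vadd_ae_eq (G := Space d) (μ := μ)
    (s := k ⁻¹' U) ((Lp.stronglyMeasurable k).measurable hU) fun g => by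
      filter_upwards [hinv g] with y hy
      exact propext (by change k (g +ᵥ y) ∈ U ↔ k y ∈ U; rw [hy])
  rw [eventuallyConst_set] at h3
  exact h3

/-- The orthogonal complement of the functions with vanishing averages consists of constants, and `F
- ∫ F` is orthogonal to constants. It therefore lies in the double complement, which is the
`L²`-closure; on a probability space `L²`-closeness gives `L¹`-closeness. -/
theorem exists_nullAverages_lintegral_lt {μ : Measure Y} [IsProbabilityMeasure μ]
    [ErgodicVAdd (Space d) Y μ] (hm : Measurable fun p : Space d × Y => p.1 +ᵥ p.2)
    {F : Y → ℝ} (hF : Measurable F) {C : ℝ} (hC : ∀ y, |F y| ≤ C) {ε : ℝ≥0∞} (hε : ε ≠ 0) :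
    ∃ v, NullAverages d v ∧ ∫⁻ y, ‖F y - ∫ z, F z ∂μ - v y‖ₑ ∂μ < ε := by
  set c := ∫ z, F z ∂μ
  have hFi : Integrable F μ := Integrable.of_bound hF.aestronglyMeasurable C (ae_of_all _ hC)
  have hL : MemLp (fun y => F y - c) 2 μ :=
    (MemLp.of_bound hF.aestronglyMeasurable C (ae_of_all _ hC)).sub (memLp_const c)
  have hcl : hL.toLp _ ∈ (nullAveragesSubmodule hm μ).topologicalClosure := by
    rw [← Submodule.orthogonal_orthogonal_eq_closure, Submodule.mem_orthogonal]
    intro k hk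
    obtain ⟨a, ha⟩ := ae_eq_const_of_mem_orthogonal hm hk
    rw [L2.inner_def]
    have : ∫ y, inner ℝ (k y) (hL.toLp (fun y => F y - c) y) ∂μ = ∫ y, a * (F y - c) ∂μ := by
      refine integral_congr_ae ?_
      filter_upwards [ha, hL.coeFn_toLp] with y h1 h2
      rw [h1, h2]; simp [mul_comm]
    rw [this, integral_const_mul, integral_sub hFi (integrable_const c)]
    simp [c]
  have hε' : 0 < ε := pos_iff_ne_zero.2 hε
  obtain ⟨g, ⟨v, hv, hgv⟩, hd⟩ := EMetric.mem_closure_iff.1 hcl ε hε'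
  refine ⟨v, hv, lt_of_le_of_lt ?_ hd⟩
  rw [Lp.edist_def]
  have h1 : eLpNorm (fun y => F y - c - v y) 1 μ ≤ eLpNorm (fun y => F y - c - v y) 2 μ :=
    eLpNorm_le_eLpNorm_of_exponent_le one_le_two
      ((hF.sub_const c).sub hv.measurable).aestronglyMeasurable
  rw [eLpNorm_one_eq_lintegral_enorm] at h1
  refine h1.trans (le_of_eq (eLpNorm_congr_ae ?_))
  filter_upwards [hgv, hL.coeFn_toLp] with y h2 h3
  rw [Pi.sub_apply, h2, h3]

/-- Passes from integer cubes to real edge lengths: `C_R ⊆ C_n` with `n = ⌈R⌉ ≤ 2R`, at the price of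
`2ᵈ`. -/
theorem abs_cubeAverage_le (hm : Measurable fun p : Space d × Y => p.1 +ᵥ p.2)
    {e : Y → ℝ} (he : Measurable e) {C : ℝ} (hC : ∀ y, |e y| ≤ C) {a : ℝ} (ha : 0 ≤ a) {y : Y}
    (hy : ∀ n : ℕ, 1 ≤ n →
      ∫⁻ s in cube d (n : ℝ), ‖e (s +ᵥ y)‖ₑ ≤ ENNReal.ofReal a * (n : ℝ≥0∞) ^ d)
    {R : ℝ} (hR : 1 ≤ R) : |cubeAverage d e R y| ≤ 2 ^ d * a := by
  set n := ⌈R⌉₊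
  have hRn : R ≤ n := Nat.le_ceil R
  have hn2 : (n : ℝ) ≤ 2 * R := by
    have := Nat.ceil_lt_add_one (zero_le_one.trans hR)
    linarith
  have hn1 : 1 ≤ n := by
    have : (1 : ℝ) ≤ n := hR.trans hRn
    exact_mod_cast this
  have hi := integrableOn_orbit hm he hC n y
  have h1 : ∫ s in cube d (n : ℝ), |e (s +ᵥ y)| ≤ a * n ^ d := by
    simp only [← Real.norm_eq_abs]
    rw [integral_norm_eq_lintegral_enorm hi.aestronglyMeasurable]
    refine ENNReal.toReal_le_of_le_ofReal (by positivity) ((hy n hn1).trans (le_of_eq ?_))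
    rw [ENNReal.ofReal_mul ha, ENNReal.ofReal_pow (by positivity), ENNReal.ofReal_natCast]
  have h2 : |∫ s in cube d R, e (s +ᵥ y)| ≤ a * n ^ d := by
    refine (abs_integral_le_integral_abs).trans (le_trans ?_ h1)
    exact setIntegral_mono_set hi.abs (ae_of_all _ fun _ => abs_nonneg _)
      (LE.le.eventuallyLE (cube_mono hRn))
  unfold cubeAverage
  have hR0 : 0 < R := by linarith
  rw [abs_mul, abs_of_pos (by positivity), inv_mul_le_iff₀ (by positivity)]
  refine h2.trans ?_
  have : (n : ℝ) ^ d ≤ (2 * R) ^ d := pow_le_pow_left₀ (by positivity) hn2 d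
  rw [mul_pow] at this
  nlinarith

/-- The pointwise ergodic theorem for ergodic actions of `ℝᵈ`, averages over cubes, bounded
functions. -/
theorem ae_tendsto_cubeAverage {μ : Measure Y} [IsProbabilityMeasure μ]
    [ErgodicVAdd (Space d) Y μ] (hm : Measurable fun p : Space d × Y => p.1 +ᵥ p.2)
    {F : Y → ℝ} (hF : Measurable F) {C : ℝ} (hC : ∀ y, |F y| ≤ C) :
    ∀ᵐ y ∂μ, Tendsto (fun R => cubeAverage d F R y) atTop (𝓝 (∫ z, F z ∂μ)) := by
  set c := ∫ z, F z ∂μ with hc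
  have key : ∀ a : ℝ, 0 < a → ∀ᵐ y ∂μ, ∀ᶠ R in atTop,
      |cubeAverage d F R y - c| ≤ (1 + 2 ^ d) * a := by
    intro a ha
    rw [ae_iff]
    refine le_antisymm (le_of_forall_gt fun δ hδ => ?_) zero_le
    -- Chosen so that the maximal inequality at level `a` gives the exceptional set measure below
    -- `δ`. The minimum with 1 keeps `ε` finite.
    set ε : ℝ≥0∞ := min δ 1 * ENNReal.ofReal a / 3 ^ d with hεdef
    have hmin0 : min δ 1 ≠ 0 := (lt_min hδ one_pos).ne'
    have hε : ε ≠ 0 := by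
      refine (ENNReal.div_pos (mul_ne_zero hmin0 ?_) (ENNReal.pow_ne_top (by simp))).ne'
      simpa using ha
    obtain ⟨v, hv, hlt⟩ := exists_nullAverages_lintegral_lt (μ := μ) hm hF hC hε
    obtain ⟨D, hD⟩ := hv.bounded
    set e : Y → ℝ := fun y => F y - c - v y with hedef
    have he : Measurable e := (hF.sub_const c).sub hv.measurable
    have heb : ∀ y, |e y| ≤ C + |c| + D := fun y =>
      (abs_sub _ _).trans (add_le_add ((abs_sub _ _).trans (add_le_add_left (hC y) _)) (hD y))
    have hmax := measure_maximal_le hm (μ := μ) he.enorm (ENNReal.ofReal a)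
    set E : Set Y := {y | ∃ n : ℕ, 1 ≤ n ∧
      ENNReal.ofReal a * (n : ℝ≥0∞) ^ d < ∫⁻ s in cube d (n : ℝ), ‖e (s +ᵥ y)‖ₑ} with hE
    have hEδ : μ E < δ := by
      have h1 : 3 ^ d * ∫⁻ y, ‖e y‖ₑ ∂μ < min δ 1 * ENNReal.ofReal a := by
        rw [ENNReal.lt_div_iff_mul_lt (Or.inl (by positivity))
          (Or.inl (ENNReal.pow_ne_top (by simp)))] at hlt
        rwa [mul_comm]
      have h2 := hmax.trans_lt h1
      rw [mul_comm] at h2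
      exact (lt_of_mul_lt_mul_right' h2).trans_le (min_le_left _ _)
    refine lt_of_le_of_lt (measure_mono fun y hy => ?_) hEδ
    by_contra hyE
    refine hy ?_
    have hyE' : ∀ n : ℕ, 1 ≤ n →
      ∫⁻ s in cube d (n : ℝ), ‖e (s +ᵥ y)‖ₑ ≤ ENNReal.ofReal a * (n : ℝ≥0∞) ^ d := by
      intro n hn
      by_contra h
      exact hyE ⟨n, hn, not_le.1 h⟩
    have hv0 : ∀ᶠ R in atTop, |cubeAverage d v R y| < a := by
      have := (hv.tendsto y).abs
      rw [abs_zero] at this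
      exact this.eventually_lt_const ha
    filter_upwards [hv0, eventually_ge_atTop 1] with R h1 hR
    have h2 := abs_cubeAverage_le hm he heb ha.le hyE' hR
    have hR0 : 0 < R := by linarith
    have hconst : cubeAverage d (fun _ : Y => c) R y = c := by
      unfold cubeAverage
      rw [setIntegral_const, volume_real_cube hR0.le, smul_eq_mul, inv_mul_cancel_left₀]
      positivity
    -- Split `F = e + v + c`. Off the exceptional set the average of `e` is at most `2ᵈ a` for all
    -- `R ≥ 1`, and that of `v` is eventually below `a`.
    have h3 : cubeAverage d F R y = cubeAverage d e R y + cubeAverage d v R y + c := by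
      have hFe : F = e + v + fun _ => c := by
        funext z; simp [hedef]
      conv_lhs => rw [hFe]
      have i1 := integrableOn_orbit hm he heb R y
      have i2 := integrableOn_orbit hm hv.measurable hD R y
      have i3 := integrableOn_orbit hm (measurable_const (a := c)) (fun _ => le_rfl) R y
      have i12 : IntegrableOn (fun t : Space d => (e + v) (t +ᵥ y)) (cube d R) := i1.add i2
      rw [cubeAverage_add i12 i3, cubeAverage_add i1 i2, hconst]
    rw [h3, add_sub_cancel_right]
    refine (abs_add_le _ _).trans ?_
    linarith
  have hall : ∀ᵐ y ∂μ, ∀ k : ℕ, ∀ᶠ R in atTop,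
      |cubeAverage d F R y - c| ≤ (1 + 2 ^ d) * (1 / ((k : ℝ) + 1)) :=
    ae_all_iff.2 fun k => key _ (by positivity)
  filter_upwards [hall] with y hy
  rw [Metric.tendsto_nhds]
  intro ε hε
  have hlim : Tendsto (fun k : ℕ => (1 + 2 ^ d : ℝ) * (1 / ((k : ℝ) + 1))) atTop (𝓝 0) := by
    simpa using tendsto_one_div_add_atTop_nhds_zero_nat.const_mul (1 + 2 ^ d : ℝ)
  obtain ⟨k, hk⟩ := (hlim.eventually_lt_const hε).exists
  filter_upwards [hy k] with R hR
  exact hR.trans_lt hk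

end Ergodic

/-! ### Approximation of compactly supported functions. -/

section CompactSupport

variable {E : Type*} [TopologicalSpace E]

theorem abs_integral_sub_le [MeasurableSpace E] [BorelSpace E] {ν : Measure E}
    [IsFiniteMeasureOnCompacts ν] {f g ψ : E → ℝ} (hf : Integrable f ν) (hg : Integrable g ν)
    (hψ : Integrable ψ ν) {ε : ℝ} (h : ∀ x, |f x - g x| ≤ ε * ψ x) :
    |∫ x, f x ∂ν - ∫ x, g x ∂ν| ≤ ε * ∫ x, ψ x ∂ν := by
  rw [← integral_sub hf hg, ← integral_const_mul]
  exact (abs_integral_le_integral_abs).trans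
    (integral_mono (hf.sub hg).abs (hψ.const_mul ε) h)

theorem integrable_compactlySupported [MeasurableSpace E] [BorelSpace E] (ν : Measure E)
    [IsFiniteMeasureOnCompacts ν] {F : Type*} [NormedAddCommGroup F] (f : C_c(E, F)) :
    Integrable f ν :=
  f.continuous.integrable_of_hasCompactSupport f.hasCompactSupport

variable [T2Space E] [LocallyCompactSpace E]

theorem exists_cutoff {K : Set E} (hK : IsCompact K) :
    ∃ ψ : C_c(E, ℝ), (∀ x ∈ K, ψ x = 1) ∧ ∀ x, 0 ≤ ψ x ∧ ψ x ≤ 1 := by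
  obtain ⟨f, hf1, _, hfc, hf⟩ := exists_continuous_one_zero_of_isCompact hK isClosed_empty
    (Set.disjoint_empty K)
  exact ⟨⟨f, hfc⟩, fun x hx => hf1 hx, fun x => hf x⟩

/-- A countable family of compactly supported functions that approximates every compactly supported
function uniformly, relative to a cutoff function in the family. -/
theorem exists_countable_approx [SecondCountableTopology E] : ∃ S : Set C_c(E, ℝ), S.Countable ∧
    ∀ f : C_c(E, ℝ), ∃ ψ ∈ S, (∀ x, 0 ≤ ψ x) ∧
      ∀ ε : ℝ, 0 < ε → ∃ g ∈ S, ∀ x, |f x - g x| ≤ ε * ψ x := by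
  let K : CompactExhaustion E := default
  choose ψ hψ1 hψ using fun n => exists_cutoff (K.isCompact n)
  have hD : ∀ n, ∃ D : Set C_c(E, ℝ), D.Countable ∧ ∀ f : C_c(E, ℝ), tsupport f ⊆ K n →
      ∀ ε : ℝ, 0 < ε → ∃ g ∈ D, tsupport g ⊆ K n ∧ ∀ x ∈ K n, |f x - g x| < ε := by
    intro n
    let T : Type _ := {f : C_c(E, ℝ) // tsupport f ⊆ K n}
    -- Compact-open convergence suffices: it is uniform on `K n`, and off `K n` all functions of `T`
    -- vanish.
    let _ : TopologicalSpace T := TopologicalSpace.induced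
      (fun f => (f.1.toContinuousMap : C(E, ℝ))) inferInstance
    have : SecondCountableTopology T := TopologicalSpace.secondCountableTopology_induced _ _ _
    obtain ⟨D, hDc, hDd⟩ := TopologicalSpace.exists_countable_dense T
    refine ⟨Subtype.val '' D, hDc.image _, fun f hf ε hε => ?_⟩
    have : CompactSpace (K n) := isCompact_iff_compactSpace.1 (K.isCompact n)
    have hc : Continuous fun g : T => ContinuousMap.restrict (K n) g.1.toContinuousMap :=
      (ContinuousMap.continuous_restrict _).comp continuous_induced_dom
    let f' : T := ⟨f, hf⟩
    have hU : IsOpen {g : T | dist (ContinuousMap.restrict (K n) g.1.toContinuousMap)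
        (ContinuousMap.restrict (K n) f.toContinuousMap) < ε} :=
      isOpen_lt (hc.dist continuous_const) continuous_const
    obtain ⟨g, hgU, hgD⟩ := hDd.inter_open_nonempty _ hU ⟨f', by
      change dist (ContinuousMap.restrict (K n) f.toContinuousMap) _ < ε
      rwa [dist_self]⟩
    refine ⟨g.1, ⟨g, hgD, rfl⟩, g.2, fun x hx => ?_⟩
    have h1 := (ContinuousMap.dist_apply_le_dist (f := ContinuousMap.restrict (K n)
      g.1.toContinuousMap) (g := ContinuousMap.restrict (K n) f.toContinuousMap)
      (⟨x, hx⟩ : K n)).trans_lt hgU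
    rw [dist_comm, Real.dist_eq] at h1
    exact h1
  choose D hDc hD using hD
  refine ⟨Set.range ψ ∪ ⋃ n, D n, (Set.countable_range ψ).union (Set.countable_iUnion hDc),
    fun f => ?_⟩
  obtain ⟨n, hn⟩ := K.exists_superset_of_isCompact f.hasCompactSupport
  refine ⟨ψ n, Or.inl ⟨n, rfl⟩, fun x => (hψ n x).1, fun ε hε => ?_⟩
  obtain ⟨g, hgD, hgK, hg⟩ := hD n f hn ε hε
  refine ⟨g, Or.inr (Set.mem_iUnion.2 ⟨n, hgD⟩), fun x => ?_⟩
  by_cases hx : x ∈ K n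
  · rw [hψ1 n x hx, mul_one]; exact (hg x hx).le
  · rw [image_eq_zero_of_notMem_tsupport fun h => hx (hn h),
      image_eq_zero_of_notMem_tsupport fun h => hx (hgK h)]
    simpa using mul_nonneg hε.le (hψ n x).1

end CompactSupport

/-! ### The vague topology on point measures. -/

theorem PointMeasure.lt_top_of_isCompact (lam : PointMeasure d m) {K : Set (ColSpace d m)}
    (hK : IsCompact K) : lam.1 K < ∞ := by
  obtain ⟨n, hn⟩ := lam.2 K hK.measurableSet (by rwa [hK.isClosed.closure_eq])
  rw [hn]; exact ENNReal.natCast_lt_top n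

instance (lam : PointMeasure d m) : IsFiniteMeasureOnCompacts lam.1 :=
  ⟨fun _ hK => lam.lt_top_of_isCompact hK⟩

theorem isInducing_eval : IsInducing
    (fun (lam : PointMeasure d m) (f : C_c(ColSpace d m, ℝ)) => ∫ p, f p ∂lam.1) := ⟨rfl⟩

theorem continuous_eval (f : C_c(ColSpace d m, ℝ)) :
    Continuous fun lam : PointMeasure d m => ∫ p, f p ∂lam.1 :=
  (continuous_apply f).comp isInducing_eval.continuous

instance : T2Space (PointMeasure d m) := by
  refine T2Space.of_injective_continuous (fun lam lam' h => ?_) isInducing_eval.continuous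
  exact Subtype.ext (Measure.ext_of_integral_eq_on_compactlySupported fun f => congrFun h f)

/-- Integrals of functions with support in a common compact set depend continuously on the
function and on the point measure. -/
theorem continuous_integral_param {Z : Type*} [TopologicalSpace Z] {Λ : Z → PointMeasure d m}
    (hΛ : Continuous Λ) {h : Z → ColSpace d m → ℝ} (hh : Continuous fun q : Z × ColSpace d m =>
      h q.1 q.2) (hK : ∀ z₀, ∃ K, IsCompact K ∧ ∀ᶠ z in 𝓝 z₀, ∀ p ∉ K, h z p = 0) :
    Continuous fun z => ∫ p, h z p ∂(Λ z).1 := by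
  refine continuous_iff_continuousAt.2 fun z₀ => ?_
  obtain ⟨K, hKc, hKs⟩ := hK z₀
  obtain ⟨ψ, hψ1, hψ⟩ := exists_cutoff hKc
  have hcont : ∀ z, Continuous (h z) := fun z =>
    show Continuous ((fun q : Z × ColSpace d m => h q.1 q.2) ∘ fun p => (z, p)) from
      hh.comp (by fun_prop)
  have hint : ∀ z, (∀ p ∉ K, h z p = 0) → ∀ ν : Measure (ColSpace d m),
      IsFiniteMeasureOnCompacts ν → Integrable (h z) ν := fun z hz ν _ =>
    (hcont z).integrable_of_hasCompactSupport (HasCompactSupport.intro hKc hz)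
  have hz₀ := hKs.self_of_nhds
  let f₀ : C_c(ColSpace d m, ℝ) := ⟨⟨h z₀, hcont z₀⟩, HasCompactSupport.intro hKc hz₀⟩
  rw [ContinuousAt, Metric.tendsto_nhds]
  intro ε hε
  have e1 := ((continuous_eval ψ).comp hΛ).continuousAt (x := z₀)
  have e2 := ((continuous_eval f₀).comp hΛ).continuousAt (x := z₀)
  set c := ∫ p, ψ p ∂(Λ z₀).1
  have hc : 0 ≤ c := integral_nonneg fun p => (hψ p).1
  -- Changing the integrand on `K` by less than `δ` costs at most `δ ∫ ψ`, and `∫ ψ < c + 1` for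
  -- nearby configurations. This uses half of `ε`; the other half pays for changing the measure with
  -- the integrand `f₀` fixed.
  set δ := ε / (2 * (c + 1)) with hδ
  have hδ0 : 0 < δ := by positivity
  have e3 : ∀ᶠ z in 𝓝 z₀, ∀ p ∈ K, |h z p - h z₀ p| < δ := by
    refine hKc.eventually_forall_of_forall_eventually fun p _ => ?_
    have : Continuous fun q : Z × ColSpace d m => |h q.1 q.2 - h z₀ q.2| :=
      (hh.sub ((hcont z₀).comp continuous_snd)).abs
    refine (this.tendsto (z₀, p)).eventually_lt_const ?_
    simpa using hδ0
  filter_upwards [hKs, e3, e1.tendsto.eventually_lt_const (lt_add_one c),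
    Metric.tendsto_nhds.1 e2.tendsto (ε / 2) (by positivity)] with z h1 h2 h3 h4
  have h5 := abs_integral_sub_le (hint z h1 (Λ z).1 inferInstance)
    (hint z₀ hz₀ (Λ z).1 inferInstance) (integrable_compactlySupported (Λ z).1 ψ) (ε := δ)
    fun p => by
      by_cases hp : p ∈ K
      · rw [hψ1 p hp, mul_one]; exact (h2 p hp).le
      · rw [h1 p hp, hz₀ p hp]; simpa using mul_nonneg hδ0.le (hψ p).1
  have h6 : δ * ∫ p, ψ p ∂(Λ z).1 ≤ ε / 2 := by
    calc δ * ∫ p, ψ p ∂(Λ z).1 ≤ δ * (c + 1) := by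
          have : ∫ p, ψ p ∂(Λ z).1 < c + 1 := h3
          gcongr
      _ = ε / 2 := by rw [hδ]; field_simp
  refine (dist_triangle _ (∫ p, h z₀ p ∂(Λ z).1) _).trans_lt ?_
  have h7 : dist (∫ p, h z₀ p ∂(Λ z).1) (∫ p, h z₀ p ∂(Λ z₀).1) < ε / 2 := h4
  rw [Real.dist_eq]
  linarith

/-- Countably many evaluations already induce the vague topology: `f` is approximated by some `g`
with error `δ ψ`, and `∫ ψ` is locally bounded because `ψ` is itself in the family. Second
countability makes the Borel σ-algebra compatible with products, gives the support full measure, and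
makes `C(X)` separable for compact `X`. -/
instance : SecondCountableTopology (PointMeasure d m) := by
  obtain ⟨S, hSc, hS⟩ := exists_countable_approx (E := ColSpace d m)
  have : Countable S := hSc.to_subtype
  let ev : PointMeasure d m → S → ℝ := fun lam f => ∫ p, f.1 p ∂lam.1
  have htop : (inferInstance : TopologicalSpace (PointMeasure d m)) =
      TopologicalSpace.induced ev inferInstance := by
    refine le_antisymm ?_ ?_
    · rw [← continuous_iff_le_induced]
      exact continuous_pi fun f => continuous_eval f.1
    · let τ : TopologicalSpace (PointMeasure d m) := TopologicalSpace.induced ev inferInstance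
      have hev : ∀ f ∈ S, Continuous fun lam : PointMeasure d m => ∫ p, f p ∂lam.1 := fun f hf =>
        continuous_pi_iff.1 (continuous_induced_dom (f := ev)) ⟨f, hf⟩
      refine continuous_iff_le_induced.1 (continuous_pi fun f => ?_)
      refine continuous_iff_continuousAt.2 fun lam₀ => ?_
      obtain ⟨ψ, hψS, hψ, hf⟩ := hS f
      rw [ContinuousAt, Metric.tendsto_nhds]
      intro ε hε
      set c := ∫ p, ψ p ∂lam₀.1
      have hc : 0 ≤ c := integral_nonneg hψ
      set δ := ε / (3 * (c + 1)) with hδ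
      have hδ0 : 0 < δ := by positivity
      obtain ⟨g, hgS, hg⟩ := hf δ hδ0
      have key : ∀ lam : PointMeasure d m, ∫ p, ψ p ∂lam.1 < c + 1 →
          |∫ p, f p ∂lam.1 - ∫ p, g p ∂lam.1| ≤ ε / 3 := by
        intro lam hlam
        refine (abs_integral_sub_le (integrable_compactlySupported lam.1 f)
          (integrable_compactlySupported lam.1 g) (integrable_compactlySupported lam.1 ψ) hg).trans
          ?_
        calc δ * ∫ p, ψ p ∂lam.1 ≤ δ * (c + 1) := by gcongr
          _ = ε / 3 := by rw [hδ]; field_simp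
      filter_upwards [(hev ψ hψS).continuousAt.tendsto.eventually_lt_const (lt_add_one c),
        Metric.tendsto_nhds.1 (hev g hgS).continuousAt.tendsto (ε / 3) (by positivity)]
        with lam h1 h2
      have h3 := key lam h1
      have h4 := key lam₀ (lt_add_one c)
      rw [Real.dist_eq] at h2 ⊢
      rw [abs_le] at h3 h4
      rw [abs_lt] at h2 ⊢
      constructor <;> linarith
  have h := TopologicalSpace.secondCountableTopology_induced _ _ ev
  rw [← htop] at h
  exact h

theorem integral_vadd (t : Space d) (lam : PointMeasure d m) {F : Type*} [NormedAddCommGroup F]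
    [NormedSpace ℝ F] (f : ColSpace d m → F) :
    ∫ p, f p ∂(t +ᵥ lam).1 = ∫ p, f (shift m t p) ∂lam.1 :=
  (shift m t).toMeasurableEquiv.measurableEmbedding.integral_map f

/-- Joint continuity is `continuous_integral_param` for the integrand `f(t + ·)`. For `t` in a
compact neighbourhood `C`, all these functions are supported in the compact set of points of
`tsupport f` translated by `-C`. -/
instance : ContinuousVAdd (Space d) (PointMeasure d m) := by
  refine ⟨isInducing_eval.continuous_iff.2 (continuous_pi fun f => ?_)⟩
  have hcs : Continuous fun q : Space d × ColSpace d m => shift m q.1 q.2 := by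
    change Continuous fun q : Space d × ColSpace d m => ((q.1 + q.2.1, q.2.2) : ColSpace d m)
    fun_prop
  have hh : Continuous fun q : (Space d × PointMeasure d m) × ColSpace d m =>
      f (shift m q.1.1 q.2) :=
    f.continuous.comp (hcs.comp ((continuous_fst.comp continuous_fst).prodMk continuous_snd))
  have hloc : ∀ z₀ : Space d × PointMeasure d m, ∃ K : Set (ColSpace d m), IsCompact K ∧
      ∀ᶠ z in 𝓝 z₀, ∀ p ∉ K, f (shift m z.1 p) = 0 := by
    intro z₀
    obtain ⟨C, hC, hCz⟩ := exists_compact_mem_nhds z₀.1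
    have hcs' : Continuous fun q : Space d × ColSpace d m => shift m (-q.1) q.2 := by
      change Continuous fun q : Space d × ColSpace d m => ((-q.1 + q.2.1, q.2.2) : ColSpace d m)
      fun_prop
    have hcpt : IsCompact ((fun q : Space d × ColSpace d m => shift m (-q.1) q.2) ''
        (C ×ˢ tsupport f)) := (hC.prod f.hasCompactSupport).image hcs'
    refine ⟨_, hcpt, ?_⟩
    have : ∀ᶠ z : Space d × PointMeasure d m in 𝓝 z₀, z.1 ∈ C :=
      continuous_fst.continuousAt hCz
    filter_upwards [this] with z hz p hp
    refine image_eq_zero_of_notMem_tsupport fun hmem => hp ⟨(z.1, shift m z.1 p), ⟨hz, hmem⟩, ?_⟩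
    change ((-z.1 + (z.1 + p.1), p.2) : ColSpace d m) = p
    rw [neg_add_cancel_left]
  have := continuous_integral_param (Z := Space d × PointMeasure d m) (Λ := Prod.snd)
    continuous_snd (h := fun z p => f (shift m z.1 p)) hh hloc
  refine this.congr fun z => ?_
  exact (integral_vadd z.1 z.2 f).symm

theorem measurable_vadd_pointMeasure :
    Measurable fun p : Space d × PointMeasure d m => p.1 +ᵥ p.2 :=
  continuous_vadd.measurable

/-- A compact `K` is a `Gδ`, so some compactly supported `f` equals 1 exactly on `K`, and the powers
`f ^ (n + 1)` tend to its indicator. This gives measurability of `λ(K)`. Closed sets, a π-system,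
extend it to all Borel sets after restriction to the members of a compact covering, where the
measures are finite. -/
theorem measurable_val : Measurable fun lam : PointMeasure d m => lam.1 := by
  have hcomp : ∀ K : Set (ColSpace d m), IsCompact K →
      Measurable fun lam : PointMeasure d m => lam.1 K := by
    intro K hK
    obtain ⟨f, hf1, _, hfc, hf⟩ := exists_continuous_one_zero_of_isCompact_of_isGδ hK
      hK.isClosed.isGδ isClosed_empty (Set.disjoint_empty K)
    have hlim : ∀ lam : PointMeasure d m,
        Tendsto (fun n : ℕ => ∫ p, (f p) ^ (n + 1) ∂lam.1) atTop (𝓝 (lam.1.real K)) := by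
      intro lam
      rw [← integral_indicator_one hK.measurableSet]
      refine tendsto_integral_of_dominated_convergence f (fun n => by fun_prop)
        (f.continuous.integrable_of_hasCompactSupport hfc) (fun n => ae_of_all _ fun p => ?_)
        (ae_of_all _ fun p => ?_)
      · rw [Real.norm_of_nonneg (pow_nonneg (hf p).1 _)]
        exact pow_le_of_le_one (hf p).1 (hf p).2 (Nat.succ_ne_zero n)
      · by_cases hp : p ∈ K
        · have : f p = 1 := by rw [hf1] at hp; exact hp
          simp [this, hp]
        · have : f p < 1 := lt_of_le_of_ne (hf p).2 fun h => hp (by rw [hf1]; exact h)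
          rw [Set.indicator_of_notMem hp]
          exact (tendsto_pow_atTop_nhds_zero_of_lt_one (hf p).1 this).comp (tendsto_add_atTop_nat 1)
    have hmr : Measurable fun lam : PointMeasure d m => lam.1.real K := by
      refine measurable_of_tendsto_metrizable (f := fun (n : ℕ) (lam : PointMeasure d m) =>
        ∫ p, (f p) ^ (n + 1) ∂lam.1) (fun n => ?_) (tendsto_pi_nhds.2 hlim)
      exact (continuous_eval ⟨⟨fun p => f p ^ (n + 1), by fun_prop⟩,
        hfc.comp_left (g := fun x : ℝ => x ^ (n + 1)) (by simp)⟩).measurable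
    have heq : (fun lam : PointMeasure d m => lam.1 K) =
        fun lam => ENNReal.ofReal (lam.1.real K) := by
      funext lam
      exact (ENNReal.ofReal_toReal (lam.lt_top_of_isCompact hK).ne).symm
    rw [heq]
    exact hmr.ennreal_ofReal
  let K := compactCovering (ColSpace d m)
  have hKc : ∀ n, IsCompact (K n) := isCompact_compactCovering _
  have hfin : ∀ n (lam : PointMeasure d m), IsFiniteMeasure (lam.1.restrict (K n)) := fun n lam =>
    ⟨by simpa using lam.lt_top_of_isCompact (hKc n)⟩
  have hres : ∀ n, Measurable fun lam : PointMeasure d m => lam.1.restrict (K n) := by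
    intro n
    have := hfin n
    refine Measurable.measure_of_isPiSystem (S := {s | IsClosed s})
      (BorelSpace.measurable_eq.trans borel_eq_generateFrom_isClosed) isPiSystem_isClosed
      (fun s hs => ?_) ?_
    · simp only [Measure.restrict_apply (IsClosed.measurableSet hs)]
      exact hcomp _ ((hKc n).inter_left hs)
    · simpa using hcomp _ (hKc n)
  refine Measure.measurable_of_measurable_coe _ fun A hA => ?_
  have heq : (fun lam : PointMeasure d m => lam.1 A) =
      fun lam => ⨆ n, lam.1.restrict (K n) A := by
    funext lam
    simp only [Measure.restrict_apply hA]
    have hU : A = ⋃ n, A ∩ K n := by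
      rw [← Set.inter_iUnion, iUnion_compactCovering, Set.inter_univ]
    conv_lhs => rw [hU]
    exact Monotone.measure_iUnion fun i j hij =>
      Set.inter_subset_inter_right _ (compactCovering_subset _ hij)
  rw [heq]
  exact Measurable.iSup fun n => (Measure.measurable_coe hA).comp (hres n)

/-! ### The points of one colour as a kernel. -/

open ProbabilityTheory

/-- The parameter space is split according to the integer part of the total mass. No uniform bound
on the masses is assumed, and none is available for cubes over the whole of `PointMeasure d m`. -/
theorem isSFiniteKernel_of_lt_top {α β : Type*} [MeasurableSpace α] [MeasurableSpace β]
    (η : Kernel α β) (h : ∀ a, η a Set.univ < ∞) : IsSFiniteKernel η := by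
  have hmeas : Measurable fun a => ⌊(η a Set.univ).toReal⌋₊ :=
    (η.measurable_coe MeasurableSet.univ).ennreal_toReal.nat_floor
  have hS : ∀ k : ℕ, MeasurableSet {a | ⌊(η a Set.univ).toReal⌋₊ = k} := fun k =>
    hmeas (MeasurableSet.singleton k)
  classical
  have hsum : η = Kernel.sum fun k : ℕ => Kernel.piecewise (hS k) η 0 := by
    ext a s hs
    rw [Kernel.sum_apply' _ _ hs, tsum_eq_single ⌊(η a Set.univ).toReal⌋₊]
    · rw [Kernel.piecewise_apply, if_pos (by exact rfl)]
    · intro k hk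
      rw [Kernel.piecewise_apply, if_neg (fun h => hk h.symm)]
      simp
  rw [hsum]
  refine Kernel.isSFiniteKernel_sum (hκs := fun k => ?_)
  have : IsFiniteKernel (Kernel.piecewise (hS k) η 0) := by
    refine ⟨k + 1, by simp, fun a => ?_⟩
    rw [Kernel.piecewise_apply]
    split_ifs with ha
    · have h1 := Nat.lt_floor_add_one (η a Set.univ).toReal
      have ha' : ⌊(η a Set.univ).toReal⌋₊ = k := ha
      rw [ha'] at h1
      rw [← ENNReal.ofReal_toReal (h a).ne]
      refine (ENNReal.ofReal_le_ofReal h1.le).trans ?_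
      rw [ENNReal.ofReal_add (by positivity) (by positivity)]
      simp
    · simp
  infer_instance

theorem comp_apply (i : Fin m) (lam : PointMeasure d m) {A : Set (Space d)}
    (hA : MeasurableSet A) : comp i lam A = lam.1 (A ×ˢ {i}) := by
  rw [comp, Measure.map_apply measurable_fst hA, Measure.restrict_apply (measurable_fst hA)]
  rfl

theorem measurableSet_colour (i : Fin m) :
    MeasurableSet (Prod.snd ⁻¹' {i} : Set (ColSpace d m)) :=
  measurable_snd (MeasurableSet.singleton i)

theorem integral_comp (i : Fin m) (lam : PointMeasure d m) {F : Type*} [NormedAddCommGroup F]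
    [NormedSpace ℝ F] {f : Space d → F} (hf : StronglyMeasurable f) :
    ∫ x, f x ∂(comp i lam) = ∫ p, (Prod.snd ⁻¹' {i}).indicator (fun p => f p.1) p ∂lam.1 := by
  rw [comp, integral_map measurable_fst.aemeasurable hf.aestronglyMeasurable,
    integral_indicator (measurableSet_colour i)]

instance (i : Fin m) (lam : PointMeasure d m) : IsFiniteMeasureOnCompacts (comp i lam) :=
  ⟨fun K hK => by
    rw [comp_apply i lam hK.measurableSet]
    exact lam.lt_top_of_isCompact (hK.prod isCompact_singleton)⟩

theorem comp_lt_top_of_isBounded (i : Fin m) (lam : PointMeasure d m) {s : Set (Space d)}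
    (hs : Bornology.IsBounded s) : comp i lam s < ∞ :=
  (measure_mono subset_closure).trans_lt hs.isCompact_closure.measure_lt_top

theorem comp_vadd (i : Fin m) (t : Space d) (lam : PointMeasure d m) :
    comp i (t +ᵥ lam) = (comp i lam).map (fun x => t + x) := by
  ext A hA
  rw [comp_apply _ _ hA, Measure.map_apply (by fun_prop) hA,
    comp_apply _ _ (hA.preimage (by fun_prop))]
  change (lam.1.map (shift m t)) _ = _
  rw [Measure.map_apply (shift m t).continuous.measurable (hA.prod (MeasurableSet.singleton i))]
  rfl

theorem lintegral_comp_vadd (i : Fin m) (t : Space d) (lam : PointMeasure d m)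
    (f : Space d → ℝ≥0∞) :
    ∫⁻ x, f x ∂(comp i (t +ᵥ lam)) = ∫⁻ x, f (t + x) ∂(comp i lam) := by
  rw [comp_vadd]
  exact (Homeomorph.addLeft t).toMeasurableEquiv.measurableEmbedding.lintegral_map f

theorem measurable_comp (i : Fin m) : Measurable fun lam : PointMeasure d m => comp i lam := by
  refine Measure.measurable_of_measurable_coe _ fun A hA => ?_
  simp only [comp_apply i _ hA]
  exact (Measure.measurable_coe (hA.prod (MeasurableSet.singleton i))).comp measurable_val

/-- The points of colour `i` as a kernel. -/
def compKernel (d : ℕ) (i : Fin m) : Kernel (PointMeasure d m) (Space d) :=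
  ⟨fun lam => comp i lam, measurable_comp i⟩

theorem compKernel_apply (i : Fin m) (lam : PointMeasure d m) :
    compKernel d i lam = comp i lam := rfl

theorem iUnion_cube_nat : ⋃ n : ℕ, cube d (n : ℝ) = Set.univ := by
  refine Set.eq_univ_of_forall fun x => ?_
  obtain ⟨n, hn⟩ := exists_nat_gt (2 * ‖x‖)
  exact Set.mem_iUnion.2 ⟨n, mem_cube_of_norm_lt (by linarith)⟩

instance (i : Fin m) : IsSFiniteKernel (compKernel d i) := by
  let B : ℕ → Set (Space d) := disjointed fun n => cube d (n : ℝ)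
  have hB : ∀ n, MeasurableSet (B n) := MeasurableSet.disjointed fun n => measurableSet_cube _
  have hsum : compKernel d i = Kernel.sum fun n => (compKernel d i).restrict (hB n) := by
    ext lam s hs
    rw [Kernel.sum_apply' _ _ hs]
    simp only [Kernel.restrict_apply' _ (hB _) _ hs]
    rw [← measure_iUnion (fun a b hab => ((disjoint_disjointed _ hab).mono
      Set.inter_subset_right Set.inter_subset_right)) fun n => hs.inter (hB n),
      ← Set.inter_iUnion, iUnion_disjointed, iUnion_cube_nat, Set.inter_univ]
  rw [hsum]
  refine Kernel.isSFiniteKernel_sum (hκs := fun n => isSFiniteKernel_of_lt_top _ fun lam => ?_)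
  rw [Kernel.restrict_apply' _ _ _ MeasurableSet.univ, Set.univ_inter]
  exact comp_lt_top_of_isBounded i lam ((isBounded_cube _).subset (disjointed_subset _ n))

theorem measurable_lintegral_comp (i : Fin m) {Z : Type*} [MeasurableSpace Z]
    {Λ : Z → PointMeasure d m} (hΛ : Measurable Λ) {f : Z → Space d → ℝ≥0∞}
    (hf : Measurable (Function.uncurry f)) :
    Measurable fun z => ∫⁻ x, f z x ∂(comp i (Λ z)) :=
  Measurable.lintegral_kernel_prod_right (κ := (compKernel d i).comap Λ hΛ) hf

/-! ### Vague limits and compactness of uniformly discrete configurations. -/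

section LimitMeasure

variable {X : Type*} [TopologicalSpace X]

theorem exists_cutoff_subset [T2Space X] [LocallyCompactSpace X] {K U : Set X} (hK : IsCompact K) (hU : IsOpen U) (hKU : K ⊆ U) :
    ∃ f : C_c(X, ℝ), (∀ x ∈ K, f x = 1) ∧ tsupport f ⊆ U ∧ ∀ x, 0 ≤ f x ∧ f x ≤ 1 := by
  obtain ⟨f, hf1, hf2, hf3⟩ := exists_continuousMap_one_of_isCompact_subset_isOpen hK hU hKU
  exact ⟨⟨f, hf2⟩, fun x hx => hf1 hx, hf3.1, fun x => hf3.2 x⟩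

variable [MeasurableSpace X] [BorelSpace X]

/-- Vague limits of measures along an ultrafilter. -/
theorem exists_vague_limit [T2Space X] [LocallyCompactSpace X] {ι : Type*} (U : Ultrafilter ι) (ν : ι → Measure X)
    [∀ i, IsFiniteMeasureOnCompacts (ν i)]
    (hb : ∀ f : C_c(X, ℝ), ∃ C : ℝ, ∀ᶠ i in (U : Filter ι), |∫ x, f x ∂(ν i)| ≤ C) :
    ∃ ρ : Measure X, ρ.Regular ∧ ∀ f : C_c(X, ℝ),
      Tendsto (fun i => ∫ x, f x ∂(ν i)) U (𝓝 (∫ x, f x ∂ρ)) := by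
  have hL : ∀ f : C_c(X, ℝ), ∃ l : ℝ, Tendsto (fun i => ∫ x, f x ∂(ν i)) U (𝓝 l) := by
    intro f
    obtain ⟨C, hC⟩ := hb f
    obtain ⟨l, _, hl⟩ := (isCompact_Icc (a := -C) (b := C)).ultrafilter_le_nhds
      (U.map fun i => ∫ x, f x ∂(ν i)) (by
        rw [le_principal_iff]
        exact hC.mono fun i hi => abs_le.1 hi)
    exact ⟨l, hl⟩
  choose L hL using hL
  -- The limits along the ultrafilter form a positive linear functional, represented by the
  -- Riesz–Markov theorem.
  let Λ : C_c(X, ℝ) →ₚ[ℝ] ℝ := PositiveLinearMap.mk₀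
    { toFun := L
      map_add' := fun f g => tendsto_nhds_unique (hL (f + g)) (((hL f).add (hL g)).congr fun i =>
        (integral_add (integrable_compactlySupported (ν i) f)
          (integrable_compactlySupported (ν i) g)).symm)
      map_smul' := fun c f => tendsto_nhds_unique (hL (c • f)) (((hL f).const_mul c).congr
        fun i => (integral_const_mul c _).symm) }
    fun f hf => ge_of_tendsto' (hL f) fun i => integral_nonneg hf
  refine ⟨RealRMK.rieszMeasure Λ, inferInstance, fun f => ?_⟩
  rw [RealRMK.integral_rieszMeasure]
  exact hL f

theorem ofReal_integral_le_measure (ν : Measure X) [IsFiniteMeasureOnCompacts ν] {f : C_c(X, ℝ)}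
    (hf : ∀ x, 0 ≤ f x ∧ f x ≤ 1) {s : Set X} (hs : tsupport f ⊆ s) :
    ENNReal.ofReal (∫ x, f x ∂ν) ≤ ν s := by
  rw [ofReal_integral_eq_lintegral_ofReal (integrable_compactlySupported ν f)
    (ae_of_all _ fun x => (hf x).1)]
  refine le_trans ?_ (measure_mono hs)
  rw [← lintegral_indicator_one (isClosed_tsupport f).measurableSet]
  refine lintegral_mono fun x => ?_
  by_cases hx : x ∈ tsupport f
  · rw [Set.indicator_of_mem hx]; simpa using (hf x).2
  · rw [image_eq_zero_of_notMem_tsupport hx]; simp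

theorem measure_le_ofReal_integral [T2Space X] (ν : Measure X) [IsFiniteMeasureOnCompacts ν] {f : C_c(X, ℝ)}
    (hf : ∀ x, 0 ≤ f x) {K : Set X} (hK : IsCompact K) (hfK : ∀ x ∈ K, 1 ≤ f x) :
    ν K ≤ ENNReal.ofReal (∫ x, f x ∂ν) := by
  rw [ofReal_integral_eq_lintegral_ofReal (integrable_compactlySupported ν f) (ae_of_all _ hf),
    ← lintegral_indicator_one hK.measurableSet]
  refine lintegral_mono fun x => ?_
  by_cases hx : x ∈ K
  · rw [Set.indicator_of_mem hx]; simpa using hfK x hx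
  · rw [Set.indicator_of_notMem hx]; exact zero_le

end LimitMeasure

/-- Configurations with at most one point, of any colour, in each translate of the cube `C_r`. -/
def uniformlyDiscrete (d m : ℕ) (r : ℝ) : Set (PointMeasure d m) :=
  {lam | ∀ a : Space d, lam.1 (((fun x => a + x) '' cube d r) ×ˢ Set.univ) ≤ 1}

theorem isOpen_box (a : Space d) (r : ℝ) :
    IsOpen (((fun x => a + x) '' cube d r) ×ˢ (Set.univ : Set (Fin m))) :=
  (isOpen_translate_cube a r).prod isOpen_univ

theorem exists_box_cover {r : ℝ} (hr : 0 < r) {K : Set (ColSpace d m)} (hK : IsCompact K) :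
    ∃ t : Finset (Space d), K ⊆ ⋃ a ∈ t, ((fun x => a + x) '' cube d r) ×ˢ Set.univ :=
  hK.elim_finite_subcover _ (fun a => isOpen_box a r) fun p _ =>
    Set.mem_iUnion.2 ⟨p.1, ⟨⟨0, zero_mem_cube hr, by simp⟩, trivial⟩⟩

theorem exists_measure_le_of_uniformlyDiscrete {r : ℝ} (hr : 0 < r) {K : Set (ColSpace d m)}
    (hK : IsCompact K) : ∃ N : ℕ, ∀ lam ∈ uniformlyDiscrete d m r, lam.1 K ≤ N := by
  obtain ⟨t, ht⟩ := exists_box_cover hr hK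
  refine ⟨t.card, fun lam hlam => (measure_mono ht).trans ?_⟩
  refine (measure_biUnion_finset_le t _).trans ((Finset.sum_le_sum fun a _ => hlam a).trans ?_)
  simp

theorem measure_one_le_of_pos (lam : PointMeasure d m) {K : Set (ColSpace d m)} (hK : IsCompact K)
    (h : lam.1 K ≠ 0) : 1 ≤ lam.1 K := by
  obtain ⟨n, hn⟩ := lam.2 K hK.measurableSet (by rwa [hK.isClosed.closure_eq])
  rw [hn] at h ⊢
  have : n ≠ 0 := fun h0 => h (by simp [h0])
  exact_mod_cast Nat.one_le_iff_ne_zero.2 this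

/-- Vague limits of uniformly discrete configurations are uniformly discrete configurations. -/
theorem isCompact_uniformlyDiscrete {r : ℝ} (hr : 0 < r) :
    IsCompact (uniformlyDiscrete d m r) := by
  rw [isCompact_iff_ultrafilter_le_nhds']
  intro U hU
  obtain ⟨ρ, hρ, hlim⟩ := exists_vague_limit U (fun lam : PointMeasure d m => lam.1) fun f => by
    obtain ⟨N, hN⟩ := exists_measure_le_of_uniformlyDiscrete (m := m) hr f.hasCompactSupport
    obtain ⟨C, hC⟩ := f.hasCompactSupport.exists_bound_of_continuous f.continuous
    refine ⟨|C| * N, ?_⟩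
    filter_upwards [hU] with lam hlam
    rw [← setIntegral_tsupport]
    refine (norm_setIntegral_le_of_norm_le_const (μ := lam.1) (s := tsupport f) (f := f)
      (lam.lt_top_of_isCompact f.hasCompactSupport)
      fun x _ => (hC x).trans (le_abs_self C)).trans ?_
    gcongr
    exact ENNReal.toReal_le_of_le_ofReal (by positivity) (by simpa using hN lam hlam)
  have hudU : ∀ᶠ lam : PointMeasure d m in (U : Filter _), lam ∈ uniformlyDiscrete d m r := hU
  -- The boxes are open, so inner regularity reduces the bound to a cutoff supported in the box,
  -- whose integral is at most 1 before the limit.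
  have hbox : ∀ a : Space d, ρ (((fun x => a + x) '' cube d r) ×ˢ Set.univ) ≤ 1 := by
    intro a
    rw [(isOpen_box a r).measure_eq_iSup_isCompact]
    refine iSup₂_le fun K hKQ => iSup_le fun hK => ?_
    obtain ⟨f, hf1, hfQ, hf⟩ := exists_cutoff_subset hK (isOpen_box a r) hKQ
    refine (measure_le_ofReal_integral ρ (fun x => (hf x).1) hK fun x hx => (hf1 x hx).ge).trans ?_
    rw [ENNReal.ofReal_le_one]
    refine le_of_tendsto (hlim f) (hudU.mono fun lam hlam => ?_)
    rw [← ENNReal.ofReal_le_one]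
    exact (ofReal_integral_le_measure lam.1 hf hfQ).trans (hlam a)
  -- Integrality survives the limit: if `f` supported in `V` has positive integral for `ρ`, then
  -- eventually `λ(tsupport f) ≠ 0`, hence is at least 1. A second cutoff `g`, equal to 1 on
  -- `tsupport f`, carries this bound to `ρ V`.
  have hopen : ∀ (a : Space d) (V : Set (ColSpace d m)), IsOpen V →
      V ⊆ ((fun x => a + x) '' cube d r) ×ˢ Set.univ → ρ V ≠ 0 → 1 ≤ ρ V := by
    intro a V hV hVQ hV0
    obtain ⟨K, hKV, hK, hK0⟩ := hV.exists_lt_isCompact (pos_iff_ne_zero.2 hV0)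
    obtain ⟨f, hf1, hfV, hf⟩ := exists_cutoff_subset hK hV hKV
    obtain ⟨g, hg1, hgV, hg⟩ := exists_cutoff_subset f.hasCompactSupport hV hfV
    have hfpos : 0 < ∫ p, f p ∂ρ := by
      rw [← ENNReal.ofReal_pos]
      exact hK0.trans_le
        (measure_le_ofReal_integral ρ (fun x => (hf x).1) hK fun x hx => (hf1 x hx).ge)
    have hg1' : 1 ≤ ∫ p, g p ∂ρ := by
      refine ge_of_tendsto (hlim g) (((hlim f).eventually_const_lt hfpos).mono fun lam hlam => ?_)
      have h1 : lam.1 (tsupport f) ≠ 0 := by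
        rw [← pos_iff_ne_zero]
        exact (ENNReal.ofReal_pos.2 hlam).trans_le
          (ofReal_integral_le_measure lam.1 hf subset_rfl)
      have h2 := (measure_one_le_of_pos lam f.hasCompactSupport h1).trans
        (measure_le_ofReal_integral lam.1 (fun x => (hg x).1) f.hasCompactSupport
          fun x hx => (hg1 x hx).ge)
      exact ENNReal.one_le_ofReal.1 h2
    exact (ENNReal.one_le_ofReal.2 hg1').trans (ofReal_integral_le_measure ρ hg hgV)
  -- A subset of a box with mass below 1 lies, by outer regularity, in an open set of mass below 1;
  -- the part of it in the box is null by `hopen`. Otherwise the mass is exactly 1 by `hbox`.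
  have hmeas : ∀ (a : Space d) (A : Set (ColSpace d m)),
      A ⊆ ((fun x => a + x) '' cube d r) ×ˢ Set.univ → ∃ n : ℕ, ρ A = n := by
    intro a A hAQ
    rcases lt_or_ge (ρ A) 1 with h | h
    · refine ⟨0, ?_⟩
      obtain ⟨V, hAV, hV, hV1⟩ := A.exists_isOpen_lt_of_lt 1 h
      have h0 : ρ (V ∩ ((fun x => a + x) '' cube d r) ×ˢ Set.univ) = 0 := by
        by_contra hne
        have := hopen a _ (hV.inter (isOpen_box a r)) Set.inter_subset_right hne
        exact absurd (this.trans (measure_mono Set.inter_subset_left)) (not_le.2 hV1)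
      simpa using measure_mono_null (Set.subset_inter hAV hAQ) h0
    · exact ⟨1, by simpa using le_antisymm ((measure_mono hAQ).trans (hbox a)) h⟩
  have hfinite : ∀ (t : Finset (Space d)) (A : Set (ColSpace d m)), MeasurableSet A →
      A ⊆ ⋃ a ∈ t, ((fun x => a + x) '' cube d r) ×ˢ Set.univ → ∃ n : ℕ, ρ A = n := by
    classical
    intro t
    induction t using Finset.induction_on with
    | empty => exact fun A _ hA => ⟨0, by simp_all⟩
    | insert a t _ ih =>
      intro A hA hAt
      obtain ⟨n, hn⟩ := hmeas a (A ∩ ((fun x => a + x) '' cube d r) ×ˢ Set.univ)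
        Set.inter_subset_right
      obtain ⟨k, hk⟩ := ih (A \ ((fun x => a + x) '' cube d r) ×ˢ Set.univ)
        (hA.diff (isOpen_box a r).measurableSet) fun p hp => by
          have := hAt hp.1
          rw [Finset.set_biUnion_insert] at this
          exact this.resolve_left hp.2
      refine ⟨n + k, ?_⟩
      rw [← measure_inter_add_sdiff A (isOpen_box a r).measurableSet, hn, hk, Nat.cast_add]
  let lam : PointMeasure d m := ⟨ρ, fun A hA hc => by
    obtain ⟨t, ht⟩ := exists_box_cover hr hc
    exact hfinite t A hA (subset_closure.trans ht)⟩
  refine ⟨lam, hbox, ?_⟩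
  rw [isInducing_eval.nhds_eq_comap, ← map_le_iff_le_comap]
  exact tendsto_pi_nhds.2 hlim

/-! ### Generic configurations. -/

section Generic

theorem vadd_mem_support {μ : Measure (PointMeasure d m)}
    [VAddInvariantMeasure (Space d) (PointMeasure d m) μ] (t : Space d) {lam : PointMeasure d m}
    (h : lam ∈ μ.support) : t +ᵥ lam ∈ μ.support := by
  rw [Measure.mem_support_iff_forall] at h ⊢
  intro U hU
  have h1 : (t +ᵥ ·) ⁻¹' U ∈ 𝓝 lam := (continuous_const_vadd t).continuousAt hU
  rw [← measure_preimage_vadd μ t U]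
  exact h _ h1

/-- A configuration in the support of `μ` along whose orbit the averages of all continuous functions
converge to their integrals. -/
def IsGeneric (μ : Measure (PointMeasure d m)) (lam : PointMeasure d m) : Prop :=
  lam ∈ μ.support ∧ ∀ F : PointMeasure d m → ℝ, ContinuousOn F μ.support →
    Tendsto (fun R => cubeAverage d F R lam) atTop (𝓝 (∫ z, F z ∂μ))

theorem abs_cubeAverage_sub_le {F G : PointMeasure d m → ℝ} {lam : PointMeasure d m} {R ε : ℝ}
    (hR : 0 < R) (hF : IntegrableOn (fun t : Space d => F (t +ᵥ lam)) (cube d R))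
    (hG : IntegrableOn (fun t : Space d => G (t +ᵥ lam)) (cube d R))
    (h : ∀ t : Space d, |F (t +ᵥ lam) - G (t +ᵥ lam)| ≤ ε) :
    |cubeAverage d F R lam - cubeAverage d G R lam| ≤ ε := by
  unfold cubeAverage
  rw [← mul_sub, ← integral_sub hF hG, abs_mul, abs_of_pos (by positivity),
    inv_mul_le_iff₀ (by positivity), ← volume_real_cube hR.le, mul_comm]
  exact norm_setIntegral_le_of_norm_le_const (f := fun t => F (t +ᵥ lam) - G (t +ᵥ lam))
    (volume_cube_ne_top R).lt_top fun t _ => h t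

variable {μ : Measure (PointMeasure d m)}

theorem exists_bound_on_support (hc : IsCompact μ.support) {F : PointMeasure d m → ℝ}
    (hF : ContinuousOn F μ.support) : ∃ C, ∀ lam ∈ μ.support, |F lam| ≤ C :=
  hc.exists_bound_of_continuousOn hF

theorem measurableEmbedding_support_val :
    MeasurableEmbedding (Subtype.val : μ.support → PointMeasure d m) :=
  MeasurableEmbedding.subtype_coe Measure.isClosed_support.measurableSet

section Invariant

variable [VAddInvariantMeasure (Space d) (PointMeasure d m) μ]

theorem continuous_orbit {F : PointMeasure d m → ℝ} (hF : ContinuousOn F μ.support)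
    {lam : PointMeasure d m} (hlam : lam ∈ μ.support) :
    Continuous fun t : Space d => F (t +ᵥ lam) :=
  hF.comp_continuous (by fun_prop) fun t => vadd_mem_support t hlam

theorem integrableOn_orbit_support (hc : IsCompact μ.support) {F : PointMeasure d m → ℝ}
    (hF : ContinuousOn F μ.support) {lam : PointMeasure d m} (hlam : lam ∈ μ.support) (R : ℝ) :
    IntegrableOn (fun t : Space d => F (t +ᵥ lam)) (cube d R) := by
  obtain ⟨C, hC⟩ := exists_bound_on_support hc hF
  exact integrableOn_cube_of_bounded (continuous_orbit hF hlam).measurable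
    (fun t => hC _ (vadd_mem_support t hlam)) R

/-- If the action on the support is uniquely ergodic, every configuration is generic. -/
theorem isGeneric_of_isUniquelyErgodic (hc : IsCompact μ.support) (hu : IsUniquelyErgodic μ)
    {lam : PointMeasure d m} (hlam : lam ∈ μ.support) : IsGeneric μ lam := by
  have : CompactSpace μ.support := isCompact_iff_compactSpace.1 hc
  refine ⟨hlam, fun F hF => tendsto_iff_ultrafilter _ _ _ |>.2 fun U hU => ?_⟩
  let T : Space d → μ.support → μ.support := fun t z => ⟨t +ᵥ z.1, vadd_mem_support t z.2⟩
  have hT : ∀ t, Continuous (T t) := fun t =>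
    Continuous.subtype_mk ((continuous_const_vadd t).comp continuous_subtype_val) _
  let z₀ : μ.support := ⟨lam, hlam⟩
  have hTz : Continuous fun t => T t z₀ := Continuous.subtype_mk (by fun_prop) _
  -- The empirical measure of the orbit of `lam` over `C_R`, carried by the compact support. Every
  -- ultrafilter finer than `atTop` yields a vague limit `ρ`; it remains to identify `ρ` with `μ`.
  let ν : ℝ → Measure μ.support := fun R =>
    ENNReal.ofReal (R ^ d)⁻¹ • (volume.restrict (cube d R)).map fun t => T t z₀
  have hν : ∀ R, IsFiniteMeasure (ν R) := fun R => by
    refine ⟨?_⟩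
    simp only [ν, Measure.smul_apply, smul_eq_mul]
    rw [Measure.map_apply hTz.measurable MeasurableSet.univ, Set.preimage_univ,
      Measure.restrict_apply_univ]
    exact ENNReal.mul_lt_top ENNReal.ofReal_lt_top (volume_cube_ne_top R).lt_top
  have hνint : ∀ (G : PointMeasure d m → ℝ), ContinuousOn G μ.support → ∀ R : ℝ, 0 < R →
      ∫ z, G z.1 ∂(ν R) = cubeAverage d G R lam := by
    intro G hG R hR
    have hGc := continuousOn_iff_continuous_domRestrict.1 hG
    simp only [ν]
    rw [integral_smul_measure, integral_map hTz.aemeasurable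
      (by exact hGc.measurable.aestronglyMeasurable), ENNReal.toReal_ofReal (by positivity),
      smul_eq_mul]
    rfl
  have hpos : ∀ᶠ R : ℝ in (U : Filter ℝ), 0 < R := hU (eventually_gt_atTop 0)
  have hνuniv : ∀ R : ℝ, 0 < R → (ν R).real Set.univ = 1 := by
    intro R hR
    simp only [ν, measureReal_def, Measure.smul_apply, smul_eq_mul]
    rw [Measure.map_apply hTz.measurable MeasurableSet.univ, Set.preimage_univ,
      Measure.restrict_apply_univ, ENNReal.toReal_mul, ENNReal.toReal_ofReal (by positivity),
      ← measureReal_def, volume_real_cube hR.le, inv_mul_cancel₀ (by positivity)]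
  obtain ⟨ρ, hρ, hlim⟩ := exists_vague_limit U ν fun f => by
    obtain ⟨C, hC⟩ := f.hasCompactSupport.exists_bound_of_continuous f.continuous
    refine ⟨C, hpos.mono fun R hR => ?_⟩
    have := norm_integral_le_of_norm_le_const (μ := ν R) (ae_of_all _ hC)
    rwa [hνuniv R hR, mul_one] at this
  have hlim' : ∀ G : PointMeasure d m → ℝ, ContinuousOn G μ.support →
      Tendsto (fun R => cubeAverage d G R lam) U (𝓝 (∫ z : μ.support, G z.1 ∂ρ)) := by
    intro G hG
    have := hlim ⟨⟨μ.support.domRestrict G, continuousOn_iff_continuous_domRestrict.1 hG⟩,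
      HasCompactSupport.of_compactSpace _⟩
    exact this.congr' (hpos.mono fun R hR => hνint G hG R hR)
  have hρfin : IsFiniteMeasure ρ := inferInstance
  have hρ1 : ρ Set.univ = 1 := by
    have h1 := hlim' (fun _ => 1) continuousOn_const
    have h2 : Tendsto (fun R => cubeAverage d (fun _ : PointMeasure d m => (1 : ℝ)) R lam) U
        (𝓝 1) := by
      refine tendsto_const_nhds.congr' (hpos.mono fun R hR => ?_)
      simp only [cubeAverage]
      rw [setIntegral_const, volume_real_cube hR.le, smul_eq_mul, mul_one, inv_mul_cancel₀]
      positivity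
    have h3 := tendsto_nhds_unique h1 h2
    rw [integral_const, smul_eq_mul, mul_one, measureReal_def] at h3
    rw [← ENNReal.ofReal_toReal (measure_ne_top ρ _), h3, ENNReal.ofReal_one]
  have hρT : ∀ t, ρ.map (T t) = ρ := by
    intro t
    have : IsFiniteMeasure (ρ.map (T t)) := Measure.isFiniteMeasure_map _ _
    refine Measure.ext_of_integral_eq_on_compactlySupported fun f => ?_
    rw [integral_map (φ := T t) (f := fun z => f z) (hT t).aemeasurable
      (by exact f.continuous.measurable.aestronglyMeasurable)]
    -- Extension by zero gives a function bounded everywhere, as `tendsto_cubeAverage_vadd_sub`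
    -- requires; orbits starting in the support never see the extension.
    let G : PointMeasure d m → ℝ := Function.extend Subtype.val f 0
    have hGf : ∀ z : μ.support, G z.1 = f z := fun z => Subtype.val_injective.extend_apply _ _ _
    have hG : ContinuousOn G μ.support := by
      rw [continuousOn_iff_continuous_domRestrict]
      exact f.continuous.congr fun z => (hGf z).symm
    have hGt : ContinuousOn (fun z => G (t +ᵥ z)) μ.support :=
      hG.comp (continuous_const_vadd t).continuousOn fun z hz => vadd_mem_support t hz
    obtain ⟨C, hC⟩ := f.hasCompactSupport.exists_bound_of_continuous f.continuous
    have h1 := hlim' _ hGt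
    have h2 := hlim' _ hG
    have h3 : ∀ R, cubeAverage d (fun z => G (t +ᵥ z)) R lam = cubeAverage d G R (t +ᵥ lam) := by
      intro R
      unfold cubeAverage
      simp only [vadd_vadd, add_comm]
    simp only [h3] at h1
    have h4 : Tendsto (fun R => cubeAverage d G R (t +ᵥ lam) - cubeAverage d G R lam) U (𝓝 0) := by
      have hGb : ∀ z, |G z| ≤ C := fun z => by
        by_cases hz : z ∈ μ.support
        · exact (congrArg abs (hGf ⟨z, hz⟩)).le.trans (hC _)
        · rw [show G z = 0 from Function.extend_apply' _ _ _ fun ⟨a, ha⟩ => hz (ha ▸ a.2), abs_zero]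
          exact (norm_nonneg _).trans (hC z₀)
      exact (tendsto_cubeAverage_vadd_sub hGb t lam (continuous_orbit hG hlam).measurable).mono_left hU
    have h5 := tendsto_nhds_unique (h1.sub h2) h4
    have h6 : ∀ z, f (T t z) = G (t +ᵥ z.1) := fun z => (hGf (T t z)).symm
    simp only [h6, ← hGf]
    linarith
  have hval := measurableEmbedding_support_val (μ := μ)
  -- Unique ergodicity applies: the limit is a translation invariant probability measure carried by
  -- the support.
  have hνμ : ρ.map Subtype.val = μ := by
    refine hu _ ⟨?_⟩ ⟨fun t A hA => ?_⟩ ?_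
    · rw [hval.map_apply, Set.preimage_univ, hρ1]
    · rw [hval.map_apply, hval.map_apply]
      conv_rhs => rw [← hρT t, Measure.map_apply (hT t).measurable (hval.measurable hA)]
      rfl
    · rw [hval.map_apply]
      convert measure_empty (μ := ρ)
      ext z; simp
  have := hlim' F hF
  rw [← hval.integral_map, hνμ] at this
  exact this

end Invariant

/-- Almost every configuration is generic. -/
theorem ae_isGeneric [IsProbabilityMeasure μ] [ErgodicVAdd (Space d) (PointMeasure d m) μ]
    (hc : IsCompact μ.support) : ∀ᵐ lam ∂μ, IsGeneric μ lam := by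
  have : CompactSpace μ.support := isCompact_iff_compactSpace.1 hc
  -- The ergodic theorem is applied to countably many functions, so a single null set serves them
  -- all. Uniform density on the support extends the convergence to every continuous function there.
  obtain ⟨D, hDc, hDd⟩ := TopologicalSpace.exists_countable_dense C(μ.support, ℝ)
  let ext : C(μ.support, ℝ) → PointMeasure d m → ℝ := fun G => Function.extend Subtype.val G 0
  have hext : ∀ (G : C(μ.support, ℝ)) (z : μ.support), ext G z = G z := fun G z =>
    Subtype.val_injective.extend_apply _ _ _
  have hextm : ∀ G, Measurable (ext G) := fun G =>
    measurableEmbedding_support_val.measurable_extend G.continuous.measurable measurable_const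
  have hextb : ∀ G z, |ext G z| ≤ ‖G‖ := fun G z => by
    by_cases hz : z ∈ μ.support
    · rw [show z = ((⟨z, hz⟩ : μ.support) : PointMeasure d m) from rfl, hext]
      exact G.norm_coe_le_norm _
    · rw [show ext G z = 0 from Function.extend_apply' _ _ _ fun ⟨a, ha⟩ => hz (ha ▸ a.2)]
      simp
  have hall : ∀ᵐ lam ∂μ, ∀ G ∈ D,
      Tendsto (fun R => cubeAverage d (ext G) R lam) atTop (𝓝 (∫ z, ext G z ∂μ)) :=
    (ae_ball_iff hDc).2 fun G _ =>
      ae_tendsto_cubeAverage measurable_vadd_pointMeasure (hextm G) (hextb G)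
  filter_upwards [hall, Measure.support_mem_ae] with lam hlam hsupp
  refine ⟨hsupp, fun F hF => ?_⟩
  rw [Metric.tendsto_nhds]
  intro ε hε
  let F' : C(μ.support, ℝ) := ⟨μ.support.domRestrict F, continuousOn_iff_continuous_domRestrict.1 hF⟩
  obtain ⟨G, hGD, hG⟩ := Metric.mem_closure_iff.1 (hDd F') (ε / 3) (by positivity)
  have hFG : ∀ z ∈ μ.support, |F z - ext G z| ≤ ε / 3 := fun z hz => by
    have := (ContinuousMap.dist_apply_le_dist (f := F') (g := G) ⟨z, hz⟩).trans hG.le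
    rw [Real.dist_eq] at this
    rw [show z = ((⟨z, hz⟩ : μ.support) : PointMeasure d m) from rfl, hext]
    exact this
  have hext_on : ContinuousOn (ext G) μ.support := by
    rw [continuousOn_iff_continuous_domRestrict]
    exact G.continuous.congr fun z => (hext G z).symm
  obtain ⟨C, hC⟩ := exists_bound_on_support hc hF
  have hFi : Integrable F μ := by
    have hm : AEStronglyMeasurable F μ := by
      have h1 := hF.aestronglyMeasurable (μ := μ) Measure.isClosed_support.measurableSet
      have h2 : μ.restrict μ.support = μ := Measure.restrict_eq_self_of_ae_mem Measure.support_mem_ae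
      rwa [h2] at h1
    exact Integrable.of_bound hm C (by filter_upwards [Measure.support_mem_ae] with z hz using hC z hz)
  have hGi : Integrable (ext G) μ :=
    Integrable.of_bound (hextm G).aestronglyMeasurable ‖G‖ (ae_of_all _ (hextb G))
  have hint : |∫ z, F z ∂μ - ∫ z, ext G z ∂μ| ≤ ε / 3 := by
    rw [← integral_sub hFi hGi]
    have := norm_integral_le_of_norm_le_const (μ := μ) (f := fun z => F z - ext G z) (C := ε / 3)
      (by filter_upwards [Measure.support_mem_ae] with z hz using hFG z hz)
    simpa using this
  filter_upwards [Metric.tendsto_nhds.1 (hlam G hGD) (ε / 3) (by positivity),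
    eventually_gt_atTop 0] with R h1 hR
  have h2 := abs_cubeAverage_sub_le hR (integrableOn_orbit_support hc hF hsupp R)
    (integrableOn_orbit_support hc hext_on hsupp R)
    fun t => hFG _ (vadd_mem_support t hsupp)
  rw [Real.dist_eq] at h1 ⊢
  rw [abs_le] at hint h2
  rw [abs_lt] at h1 ⊢
  constructor <;> linarith

end Generic

/-! ### Palm measures and the refined Campbell formula. -/

section Campbell

instance : MeasurableVAdd₂ (Space d) (PointMeasure d m) := ⟨measurable_vadd_pointMeasure⟩

variable {μ : Measure (PointMeasure d m)}

theorem measurable_campbell (i : Fin m) {Φ : PointMeasure d m → ℝ≥0∞} (hΦ : Measurable Φ)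
    {Z : Type*} [MeasurableSpace Z] {k : Z → Space d → ℝ≥0∞} (hk : Measurable (Function.uncurry k)) :
    Measurable fun q : Z × PointMeasure d m =>
      ∫⁻ y, k q.1 y * Φ (-y +ᵥ q.2) ∂(comp i q.2) := by
  have h1 : Measurable fun p : (Z × PointMeasure d m) × Space d => Function.uncurry k (p.1.1, p.2) :=
    hk.comp (by fun_prop)
  have h2 : Measurable fun p : (Z × PointMeasure d m) × Space d => -p.2 +ᵥ p.1.2 :=
    measurable_snd.neg.vadd (measurable_snd.comp measurable_fst)
  have h3 : Measurable fun p : (Z × PointMeasure d m) × Space d => Φ (-p.2 +ᵥ p.1.2) := hΦ.comp h2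
  exact measurable_lintegral_comp i (Λ := fun q : Z × PointMeasure d m => q.2) measurable_snd
    (f := fun q y => k q.1 y * Φ (-y +ᵥ q.2)) (h1.mul h3)

theorem measurable_campbell' (i : Fin m) {Φ : PointMeasure d m → ℝ≥0∞} (hΦ : Measurable Φ)
    {k : Space d → ℝ≥0∞} (hk : Measurable k) :
    Measurable fun lam => ∫⁻ y, k y * Φ (-y +ᵥ lam) ∂(comp i lam) :=
  (measurable_campbell i hΦ (Z := Unit) (k := fun _ => k) (hk.comp measurable_snd)).comp
    (measurable_prodMk_left (x := ()))

theorem measurable_palm_aux (i : Fin m) : Measurable fun lam : PointMeasure d m =>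
    ((comp i lam).restrict (cube d 1)).map fun x : Space d => (-x) +ᵥ lam := by
  refine Measure.measurable_of_measurable_coe _ fun A hA => ?_
  have hmap : ∀ lam : PointMeasure d m, Measurable fun x : Space d => (-x) +ᵥ lam := fun lam =>
    (by fun_prop : Continuous fun x : Space d => (-x) +ᵥ lam).measurable
  have heq : (fun lam : PointMeasure d m =>
      (((comp i lam).restrict (cube d 1)).map fun x : Space d => (-x) +ᵥ lam) A) =
      fun lam => ∫⁻ y, (cube d 1).indicator 1 y * A.indicator 1 (-y +ᵥ lam) ∂(comp i lam) := by
    funext lam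
    rw [← lintegral_indicator_one hA, lintegral_map (measurable_one.indicator hA) (hmap lam),
      ← lintegral_indicator (measurableSet_cube 1)]
    refine lintegral_congr fun y => ?_
    by_cases hy : y ∈ cube d 1 <;> simp [hy]
  rw [heq]
  exact measurable_campbell' i (measurable_one.indicator hA)
    (measurable_one.indicator (measurableSet_cube 1))

theorem lintegral_palm (i : Fin m) {Φ : PointMeasure d m → ℝ≥0∞} (hΦ : Measurable Φ) :
    ∫⁻ lam, Φ lam ∂(palm μ i) =
      ∫⁻ lam, ∫⁻ y, (cube d 1).indicator 1 y * Φ (-y +ᵥ lam) ∂(comp i lam) ∂μ := by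
  have hmap : ∀ lam : PointMeasure d m, Measurable fun x : Space d => (-x) +ᵥ lam := fun lam =>
    (by fun_prop : Continuous fun x : Space d => (-x) +ᵥ lam).measurable
  rw [palm, Measure.lintegral_bind (measurable_palm_aux i).aemeasurable hΦ.aemeasurable]
  refine lintegral_congr fun lam => ?_
  rw [lintegral_map hΦ (hmap lam), ← lintegral_indicator (measurableSet_cube 1)]
  refine lintegral_congr fun y => ?_
  by_cases hy : y ∈ cube d 1 <;> simp [hy]

theorem campbell_swap [SFinite μ] (i : Fin m) {Φ : PointMeasure d m → ℝ≥0∞} (hΦ : Measurable Φ)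
    {k : Space d → Space d → ℝ≥0∞} (hk : Measurable (Function.uncurry k)) :
    ∫⁻ t, ∫⁻ lam, ∫⁻ y, k t y * Φ (-y +ᵥ lam) ∂(comp i lam) ∂μ =
      ∫⁻ lam, ∫⁻ y, (∫⁻ t, k t y) * Φ (-y +ᵥ lam) ∂(comp i lam) ∂μ := by
  rw [lintegral_lintegral_swap (measurable_campbell i hΦ hk).aemeasurable]
  refine lintegral_congr fun lam => ?_
  have hmap : Measurable fun x : Space d => (-x) +ᵥ lam :=
    (by fun_prop : Continuous fun x : Space d => (-x) +ᵥ lam).measurable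
  rw [lintegral_lintegral_swap (hk.mul ((hΦ.comp hmap).comp measurable_snd)).aemeasurable]
  refine lintegral_congr fun y => ?_
  exact lintegral_mul_const _ (by exact hk.comp measurable_prodMk_right)

theorem lintegral_cube_one_indicator : ∫⁻ t : Space d, (cube d 1).indicator 1 t = 1 := by
  rw [lintegral_indicator_one (measurableSet_cube 1), volume_cube]
  simp

variable [VAddInvariantMeasure (Space d) (PointMeasure d m) μ]

theorem lintegral_vadd_eq (t : Space d) {G : PointMeasure d m → ℝ≥0∞} (hG : Measurable G) :
    ∫⁻ lam, G (t +ᵥ lam) ∂μ = ∫⁻ lam, G lam ∂μ := by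
  have hm : Measurable fun lam : PointMeasure d m => t +ᵥ lam :=
    (continuous_const_vadd t).measurable
  rw [← lintegral_map hG hm]
  congr 1
  ext A hA
  rw [Measure.map_apply hm hA]
  exact VAddInvariantMeasure.measure_preimage_vadd t hA

/-- Translating the configuration by `t` moves the point `y` to `t + y` but leaves the configuration
seen from that point, `-y +ᵥ lam`, unchanged. Invariance of `μ` then allows the window `k` to be
shifted. -/
theorem campbell_shift (i : Fin m) {Φ : PointMeasure d m → ℝ≥0∞} (hΦ : Measurable Φ)
    {k : Space d → ℝ≥0∞} (hk : Measurable k) (t : Space d) :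
    ∫⁻ lam, ∫⁻ y, k (t + y) * Φ (-y +ᵥ lam) ∂(comp i lam) ∂μ =
      ∫⁻ lam, ∫⁻ y, k y * Φ (-y +ᵥ lam) ∂(comp i lam) ∂μ := by
  rw [← lintegral_vadd_eq t (measurable_campbell' i hΦ hk)]
  refine lintegral_congr fun lam => ?_
  rw [lintegral_comp_vadd]
  refine lintegral_congr fun y => ?_
  rw [vadd_vadd, neg_add_rev, neg_add_cancel_right]

/-- The refined Campbell formula. -/
theorem lintegral_campbell [SFinite μ] (i : Fin m) {Φ : PointMeasure d m → ℝ≥0∞}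
    (hΦ : Measurable Φ) {ψ : Space d → ℝ≥0∞} (hψ : Measurable ψ) :
    ∫⁻ lam, ∫⁻ y, ψ y * Φ (-y +ᵥ lam) ∂(comp i lam) ∂μ =
      (∫⁻ y, ψ y) * ∫⁻ lam, Φ lam ∂(palm μ i) := by
  set χ : Space d → ℝ≥0∞ := (cube d 1).indicator 1 with hχdef
  have hχ : Measurable χ := measurable_one.indicator (measurableSet_cube 1)
  have hχsymm : ∀ x, χ (-x) = χ x := fun x => Set.indicator_eq_indicator neg_mem_cube_iff rfl
  -- Averaging over shifts of `ψ` with the weight `χ` of total mass 1 changes nothing.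
  have h1 : ∫⁻ t, ∫⁻ lam, ∫⁻ y, (χ t * ψ (t + y)) * Φ (-y +ᵥ lam) ∂(comp i lam) ∂μ =
      ∫⁻ lam, ∫⁻ y, ψ y * Φ (-y +ᵥ lam) ∂(comp i lam) ∂μ := by
    have : ∀ t, ∫⁻ lam, ∫⁻ y, (χ t * ψ (t + y)) * Φ (-y +ᵥ lam) ∂(comp i lam) ∂μ =
        χ t * ∫⁻ lam, ∫⁻ y, ψ y * Φ (-y +ᵥ lam) ∂(comp i lam) ∂μ := by
      intro t
      rw [← campbell_shift i hΦ hψ t, ← lintegral_const_mul _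
        (measurable_campbell' i hΦ (by exact hψ.comp (measurable_const_add t)))]
      refine lintegral_congr fun lam => ?_
      have hmap : Measurable fun x : Space d => (-x) +ᵥ lam :=
        (by fun_prop : Continuous fun x : Space d => (-x) +ᵥ lam).measurable
      rw [← lintegral_const_mul _ (by exact (hψ.comp (measurable_const_add t)).mul (hΦ.comp hmap))]
      simp only [mul_assoc]
    simp only [this]
    rw [lintegral_mul_const _ hχ, lintegral_cube_one_indicator, one_mul]
  -- Averaging over shifts of the unit cube with the weight `ψ` multiplies the Palm integral by `∫
  -- ψ`.
  have h2 : ∫⁻ u, ∫⁻ lam, ∫⁻ y, (ψ u * χ (-u + y)) * Φ (-y +ᵥ lam) ∂(comp i lam) ∂μ =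
      (∫⁻ y, ψ y) * ∫⁻ lam, Φ lam ∂(palm μ i) := by
    have : ∀ u, ∫⁻ lam, ∫⁻ y, (ψ u * χ (-u + y)) * Φ (-y +ᵥ lam) ∂(comp i lam) ∂μ =
        ψ u * ∫⁻ lam, Φ lam ∂(palm μ i) := by
      intro u
      rw [lintegral_palm i hΦ, ← campbell_shift i hΦ hχ (-u), ← lintegral_const_mul _
        (measurable_campbell' i hΦ (by exact hχ.comp (measurable_const_add (-u))))]
      refine lintegral_congr fun lam => ?_
      have hmap : Measurable fun x : Space d => (-x) +ᵥ lam :=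
        (by fun_prop : Continuous fun x : Space d => (-x) +ᵥ lam).measurable
      rw [← lintegral_const_mul _ (by exact (hχ.comp (measurable_const_add (-u))).mul (hΦ.comp hmap))]
      simp only [mul_assoc]
    simp only [this]
    rw [lintegral_mul_const _ hψ]
  rw [← h1, ← h2, campbell_swap i hΦ (by
      exact (hχ.comp measurable_fst).mul (hψ.comp (by fun_prop))),
    campbell_swap i hΦ (by exact (hψ.comp measurable_fst).mul (hχ.comp (by fun_prop)))]
  refine lintegral_congr fun lam => lintegral_congr fun y => ?_
  congr 1
  -- Both windows are the same convolution of `χ` and `ψ` at `y`, because the cube is symmetric.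
  rw [← lintegral_sub_right_eq_self (fun t => χ t * ψ (t + y)) y]
  refine lintegral_congr fun t => ?_
  rw [sub_add_cancel, mul_comm, ← hχsymm (-t + y)]
  congr 2
  abel

end Campbell

open ProbabilityTheory

/-! ### Vague convergence tested on complex and on decaying functions. -/

section VagueConvergence

variable {E : Type*} [TopologicalSpace E] [MeasurableSpace E] [BorelSpace E] {ι : Type*}
  {l : Filter ι} {ν : ι → Measure E} [∀ i, IsFiniteMeasureOnCompacts (ν i)] {ρ : Measure E}
  [IsFiniteMeasureOnCompacts ρ]

theorem tendsto_integral_real_of_nonneg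
    (h : ∀ f : C_c(E, ℝ), (∀ x, 0 ≤ f x) → Tendsto (fun i => ∫ x, f x ∂(ν i)) l (𝓝 (∫ x, f x ∂ρ)))
    (f : C_c(E, ℝ)) : Tendsto (fun i => ∫ x, f x ∂(ν i)) l (𝓝 (∫ x, f x ∂ρ)) := by
  let p : C_c(E, ℝ) := ⟨⟨fun x => max (f x) 0, by fun_prop⟩,
    f.hasCompactSupport.comp_left (g := fun y : ℝ => max y 0) (by simp)⟩
  let n : C_c(E, ℝ) := ⟨⟨fun x => max (-f x) 0, by fun_prop⟩,
    f.hasCompactSupport.comp_left (g := fun y : ℝ => max (-y) 0) (by simp)⟩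
  have hpn : ∀ x, f x = p x - n x := fun x => by
    change f x = max (f x) 0 - max (-f x) 0
    rcases le_total (f x) 0 with h | h
    · rw [max_eq_right h, max_eq_left (neg_nonneg.2 h)]; ring
    · rw [max_eq_left h, max_eq_right (neg_nonpos.2 h)]; ring
  have hint : ∀ (κ : Measure E) [IsFiniteMeasureOnCompacts κ],
      ∫ x, f x ∂κ = ∫ x, p x ∂κ - ∫ x, n x ∂κ := fun κ _ => by
    rw [← integral_sub (integrable_compactlySupported κ p) (integrable_compactlySupported κ n)]
    exact integral_congr_ae (ae_of_all _ hpn)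
  simp only [hint]
  exact (h p fun x => le_max_right _ _).sub (h n fun x => le_max_right _ _)

theorem tendsto_integral_complex
    (h : ∀ f : C_c(E, ℝ), Tendsto (fun i => ∫ x, f x ∂(ν i)) l (𝓝 (∫ x, f x ∂ρ)))
    (f : C_c(E, ℂ)) : Tendsto (fun i => ∫ x, f x ∂(ν i)) l (𝓝 (∫ x, f x ∂ρ)) := by
  let p : C_c(E, ℝ) := ⟨⟨fun x => (f x).re, by fun_prop⟩,
    f.hasCompactSupport.comp_left (g := Complex.re) (by simp)⟩
  let n : C_c(E, ℝ) := ⟨⟨fun x => (f x).im, by fun_prop⟩,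
    f.hasCompactSupport.comp_left (g := Complex.im) (by simp)⟩
  have hint : ∀ (κ : Measure E) [IsFiniteMeasureOnCompacts κ],
      ∫ x, f x ∂κ = ((∫ x, p x ∂κ : ℝ) : ℂ) + ((∫ x, n x ∂κ : ℝ) : ℂ) * Complex.I := fun κ _ =>
    (integral_re_add_im (𝕜 := ℂ) (integrable_compactlySupported κ f)).symm
  simp only [hint]
  have h1 := (Complex.continuous_ofReal.tendsto _).comp (h p)
  have h2 := (Complex.continuous_ofReal.tendsto _).comp (h n)
  exact h1.add (h2.mul_const _)

end VagueConvergence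

theorem isTranslationBounded_of_cube {ν : Measure (Space d)} [SFinite ν] {r : ℝ} (hr : 0 < r)
    {N : ℝ≥0∞} (hN : N < ∞) (h : ∀ t, ν ((fun x => t + x) '' cube d r) ≤ N) :
    IsTranslationBounded ν := by
  intro K hK
  obtain ⟨D, hD, hb⟩ := exists_measure_translate_le hr hK.isBounded
  exact ⟨N * D, ENNReal.mul_lt_top hN hD, hb ν N h⟩

theorem IsTranslationBounded.isFiniteMeasureOnCompacts {ν : Measure (Space d)}
    (h : IsTranslationBounded ν) : IsFiniteMeasureOnCompacts ν :=
  ⟨fun K hK => by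
    obtain ⟨C, hC, hb⟩ := h K hK
    have := hb 0
    simp only [zero_add, Set.image_id'] at this
    exact this.trans_lt hC⟩

theorem integrable_of_decay {ν : Measure (Space d)} [SFinite ν] {r : ℝ} (hr : 0 < r)
    {N : ℝ≥0∞} (hN : N < ∞) (h : ∀ t, ν ((fun x => t + x) '' cube d r) ≤ N) {f : Space d → ℂ}
    (hf : Continuous f) {C : ℝ} (hC : ∀ x, ‖f x‖ ≤ C * decay x) : Integrable f ν := by
  obtain ⟨D, hD, hb⟩ := exists_lintegral_decay_le (d := d) hr
  have hdec : Integrable (decay : Space d → ℝ) ν := by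
    refine ⟨continuous_decay.measurable.aestronglyMeasurable, ?_⟩
    rw [hasFiniteIntegral_iff_ofReal (ae_of_all _ fun x => (decay_pos x).le)]
    exact (hb ν N h).trans_lt (ENNReal.mul_lt_top hN hD)
  exact (hdec.const_mul C).mono' hf.measurable.aestronglyMeasurable (ae_of_all _ hC)

theorem norm_integral_le_decay {ν : Measure (Space d)} {D : ℝ≥0∞} (hD : D < ∞)
    (h : ∫⁻ x, ENNReal.ofReal (decay x) ∂ν ≤ D) {f : Space d → ℂ} {C : ℝ} (hC0 : 0 ≤ C)
    (hC : ∀ x, ‖f x‖ ≤ C * decay x) : ‖∫ x, f x ∂ν‖ ≤ C * D.toReal := by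
  have h1 : ∫⁻ x, ‖f x‖ₑ ∂ν ≤ ENNReal.ofReal C * D := by
    calc ∫⁻ x, ‖f x‖ₑ ∂ν ≤ ∫⁻ x, ENNReal.ofReal C * ENNReal.ofReal (decay x) ∂ν := by
          refine lintegral_mono fun x => ?_
          rw [← ENNReal.ofReal_mul hC0, ← ofReal_norm]
          exact ENNReal.ofReal_le_ofReal (hC x)
      _ = ENNReal.ofReal C * ∫⁻ x, ENNReal.ofReal (decay x) ∂ν :=
          lintegral_const_mul _ continuous_decay.measurable.ennreal_ofReal
      _ ≤ _ := by gcongr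
  have h2 := ENNReal.toReal_mono (ENNReal.mul_lt_top ENNReal.ofReal_lt_top hD).ne
    ((enorm_integral_le_lintegral_enorm f).trans h1)
  rwa [ENNReal.toReal_mul, ENNReal.toReal_ofReal hC0, toReal_enorm] at h2

/-- For uniformly translation bounded measures, vague convergence extends to rapidly decreasing
continuous functions. -/
theorem tendsto_integral_of_decay {ι : Type*} {l : Filter ι} {ν : ι → Measure (Space d)}
    [∀ i, SFinite (ν i)] [∀ i, IsFiniteMeasureOnCompacts (ν i)] {ρ : Measure (Space d)} [SFinite ρ]
    [IsFiniteMeasureOnCompacts ρ] {r : ℝ} (hr : 0 < r) {N : ℝ≥0∞} (hN : N < ∞)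
    (hν : ∀ᶠ i in l, ∀ t, ν i ((fun x => t + x) '' cube d r) ≤ N)
    (hρ : ∀ t, ρ ((fun x => t + x) '' cube d r) ≤ N)
    (h : ∀ f : C_c(Space d, ℝ), Tendsto (fun i => ∫ x, f x ∂(ν i)) l (𝓝 (∫ x, f x ∂ρ)))
    {f : Space d → ℂ} (hf : Continuous f) {C : ℝ} (hC : ∀ x, (1 + ‖x‖) * ‖f x‖ ≤ C * decay x) :
    Tendsto (fun i => ∫ x, f x ∂(ν i)) l (𝓝 (∫ x, f x ∂ρ)) := by
  obtain ⟨D, hD, hb⟩ := exists_lintegral_decay_le (d := d) hr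
  have hND : N * D < ∞ := ENNReal.mul_lt_top hN hD
  have hC0 : 0 ≤ C := by
    have h1 := hC 0
    have h2 : 0 ≤ C * decay (0 : Space d) := le_trans (by positivity) h1
    exact nonneg_of_mul_nonneg_left h2 (decay_pos 0)
  have hC1 : ∀ x, ‖f x‖ ≤ C * decay x := fun x =>
    le_trans (le_mul_of_one_le_left (norm_nonneg _) (by linarith [norm_nonneg x])) (hC x)
  rw [Metric.tendsto_nhds]
  intro ε hε
  -- The extra factor `1 + ‖x‖` in the hypothesis bounds the part of `f` outside the ball of radius
  -- `n` by `C/(n+1) * decay`. Its integral against any of the measures is at most `C/(n+1) * N *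
  -- D`, made smaller than `ε/3` here.
  obtain ⟨n, hn⟩ := exists_nat_gt (3 * (C * (N * D).toReal) / ε)
  obtain ⟨χ, hχ1, hχ⟩ := exists_cutoff (isCompact_closedBall (0 : Space d) n)
  let g : C_c(Space d, ℂ) := ⟨⟨fun x => (χ x : ℂ) * f x, by fun_prop⟩,
    (χ.hasCompactSupport.comp_left (g := fun y : ℝ => (y : ℂ)) (by simp)).mul_right⟩
  have hfg : ∀ x, ‖f x - g x‖ ≤ C / (n + 1) * decay x := by
    intro x
    have h1 : f x - g x = ((1 - χ x : ℝ) : ℂ) * f x := by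
      change f x - (χ x : ℂ) * f x = _
      push_cast; ring
    rw [h1, norm_mul, Complex.norm_real, Real.norm_of_nonneg (sub_nonneg.2 (hχ x).2)]
    by_cases hx : ‖x‖ ≤ n
    · rw [hχ1 x (by simpa using hx), sub_self, zero_mul]
      exact mul_nonneg (by positivity) (decay_pos x).le
    · rw [div_mul_eq_mul_div, le_div_iff₀ (by positivity)]
      have h2 := hC x
      have h3 : (n : ℝ) + 1 ≤ 1 + ‖x‖ := by linarith
      calc (1 - χ x) * ‖f x‖ * (n + 1) ≤ 1 * ‖f x‖ * (1 + ‖x‖) := by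
            gcongr
            linarith [(hχ x).1]
        _ ≤ C * decay x := by linarith
  have key : ∀ (κ : Measure (Space d)) [SFinite κ] [IsFiniteMeasureOnCompacts κ],
      (∀ t, κ ((fun x => t + x) '' cube d r) ≤ N) →
      ‖∫ x, f x ∂κ - ∫ x, g x ∂κ‖ < ε / 3 := by
    intro κ _ _ hκ
    rw [← integral_sub (integrable_of_decay hr hN hκ hf hC1) (integrable_compactlySupported κ g)]
    refine (norm_integral_le_decay hND (hb κ N hκ) (by positivity) hfg).trans_lt ?_
    rw [div_lt_iff₀ hε] at hn
    rw [div_mul_eq_mul_div, div_lt_iff₀ (by positivity)]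
    nlinarith
  filter_upwards [hν, Metric.tendsto_nhds.1 (tendsto_integral_complex h g) (ε / 3) (by positivity)]
    with i h1 h2
  have h3 := key (ν i) h1
  have h4 := key ρ hρ
  rw [← dist_eq_norm] at h3 h4
  calc dist (∫ x, f x ∂(ν i)) (∫ x, f x ∂ρ)
      ≤ dist (∫ x, f x ∂(ν i)) (∫ x, g x ∂(ν i)) + dist (∫ x, g x ∂(ν i)) (∫ x, g x ∂ρ) +
        dist (∫ x, g x ∂ρ) (∫ x, f x ∂ρ) := dist_triangle4 _ _ _ _
    _ < ε := by rw [dist_comm (∫ x, g x ∂ρ)]; linarith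

/-! ### First moment measures of the Palm measures. -/

section Moment

variable {μ : Measure (PointMeasure d m)}

/-- The first moment measure of colour `j` of the Palm measure of colour `i`. -/
def momentMeasure (μ : Measure (PointMeasure d m)) (i j : Fin m) : Measure (Space d) :=
  (palm μ i).bind (compKernel d j)

theorem lintegral_momentMeasure (i j : Fin m) {f : Space d → ℝ≥0∞} (hf : Measurable f) :
    ∫⁻ x, f x ∂(momentMeasure μ i j) = ∫⁻ lam, ∫⁻ x, f x ∂(comp j lam) ∂(palm μ i) :=
  Measure.lintegral_bind (Kernel.aemeasurable _) hf.aemeasurable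

theorem integral_momentMeasure (i j : Fin m) {f : Space d → ℂ}
    (hf : Integrable f (momentMeasure μ i j)) :
    ∫ x, f x ∂(momentMeasure μ i j) = ∫ lam, ∫ x, f x ∂(comp j lam) ∂(palm μ i) := by
  rw [momentMeasure, Measure.comp_eq_comp_const_apply] at hf ⊢
  rw [Kernel.integral_comp hf]
  simp [compKernel_apply]

/-- Rewrites the signed object as a finite real combination of positive measures on `ℝᵈ`, so that
bounds and limits can be treated colour pair by colour pair. -/
theorem weightedMoment_eq_sum (w : Fin m → ℝ) {f : Space d → ℂ}
    (hf : ∀ i j, Integrable f (momentMeasure μ i j)) :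
    weightedMoment μ w f =
      ∑ i, ∑ j, (w i : ℂ) * (w j : ℂ) * ∫ x, f x ∂(momentMeasure μ i j) := by
  unfold weightedMoment weightedPalm count
  refine Finset.sum_congr rfl fun i _ => ?_
  have hint : ∀ j, Integrable (fun lam => ∫ x, f x ∂(comp j lam)) (palm μ i) := by
    intro j
    have := hf i j
    rw [momentMeasure, Measure.comp_eq_comp_const_apply] at this
    simpa [compKernel_apply] using this.integral_comp
  rw [integral_finsetSum _ fun j _ => (hint j).const_mul _, Finset.mul_sum]
  refine Finset.sum_congr rfl fun j _ => ?_
  rw [integral_const_mul, integral_momentMeasure i j (hf i j), mul_assoc]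

theorem momentIntegrable_of_integrable {f : Space d → ℂ} (hfm : Measurable f)
    (hf : ∀ i j, Integrable f (momentMeasure μ i j)) : MomentIntegrable μ f := by
  intro i j
  rw [← lintegral_momentMeasure i j hfm.enorm]
  exact (hf i j).2

theorem comp_translate_cube_le {r : ℝ} {lam : PointMeasure d m}
    (h : lam ∈ uniformlyDiscrete d m r) (i : Fin m) (t : Space d) :
    comp i lam ((fun x => t + x) '' cube d r) ≤ 1 := by
  rw [comp_apply i lam (isOpen_translate_cube t r).measurableSet]
  exact (measure_mono (Set.prod_mono subset_rfl (Set.subset_univ _))).trans (h t)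

/-- The Palm measure is built from translates `-y +ᵥ lam` of configurations of the support, which is
translation invariant. The hard-core bound thus holds for Palm-almost every configuration. -/
theorem ae_palm_mem_support [VAddInvariantMeasure (Space d) (PointMeasure d m) μ] (i : Fin m) :
    ∀ᵐ lam ∂(palm μ i), lam ∈ μ.support := by
  have hms : MeasurableSet μ.supportᶜ := Measure.isClosed_support.measurableSet.compl
  rw [ae_iff]
  change palm μ i μ.supportᶜ = 0
  rw [← lintegral_indicator_one hms, lintegral_palm i (measurable_one.indicator hms)]
  rw [lintegral_eq_zero_iff (measurable_campbell' i (measurable_one.indicator hms)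
    (measurable_one.indicator (measurableSet_cube 1)))]
  filter_upwards [Measure.support_mem_ae (μ := μ)] with lam hlam
  have : ∀ y : Space d, μ.supportᶜ.indicator (1 : PointMeasure d m → ℝ≥0∞) (-y +ᵥ lam) = 0 :=
    fun y => Set.indicator_of_notMem (Set.notMem_compl_iff.2 (vadd_mem_support (-y) hlam)) _
  simp [this]

theorem palm_univ_lt_top [IsProbabilityMeasure μ] {r : ℝ} (hr : 0 < r)
    (hud : μ.support ⊆ uniformlyDiscrete d m r) (i : Fin m) : palm μ i Set.univ < ∞ := by
  obtain ⟨D, hD, hb⟩ := exists_measure_translate_le hr (isBounded_cube (d := d) 1)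
  rw [← lintegral_one, lintegral_palm i measurable_const]
  refine lt_of_le_of_lt (b := ∫⁻ _lam, 1 * D ∂μ) (lintegral_mono_ae ?_) (by simpa using hD)
  filter_upwards [Measure.support_mem_ae (μ := μ)] with lam hlam
  have := hb (comp i lam) 1 (comp_translate_cube_le (hud hlam) i) 0
  simp only [mul_one]
  rw [lintegral_indicator_one (measurableSet_cube 1)]
  simpa using this

theorem momentMeasure_translate_cube_le [VAddInvariantMeasure (Space d) (PointMeasure d m) μ]
    {r : ℝ} (hud : μ.support ⊆ uniformlyDiscrete d m r) (i j : Fin m) (t : Space d) :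
    momentMeasure μ i j ((fun x => t + x) '' cube d r) ≤ palm μ i Set.univ := by
  have hm := (isOpen_translate_cube t r).measurableSet
  rw [← lintegral_indicator_one hm, lintegral_momentMeasure i j (measurable_one.indicator hm),
    ← lintegral_one]
  refine lintegral_mono_ae ?_
  filter_upwards [ae_palm_mem_support i] with lam hlam
  rw [lintegral_indicator_one hm]
  exact comp_translate_cube_le (hud hlam) j t

end Moment

/-! ### Finite-volume autocorrelations and pair sums. -/

section Autocorrelation

/-- The pair `(i, j)` contribution to the finite volume autocorrelation. -/
def autocorrMeasure (lam : PointMeasure d m) (i j : Fin m) (R : ℝ) : Measure (Space d) :=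
  ENNReal.ofReal (R ^ d)⁻¹ •
    (((comp i lam).restrict (cube d R)).prod ((comp j lam).restrict (cube d R))).map
      fun p => p.1 - p.2

instance (lam : PointMeasure d m) (i : Fin m) (R : ℝ) :
    IsFiniteMeasure ((comp i lam).restrict (cube d R)) :=
  ⟨by simpa using comp_lt_top_of_isBounded i lam (isBounded_cube R)⟩

instance (lam : PointMeasure d m) (i j : Fin m) (R : ℝ) :
    IsFiniteMeasure (autocorrMeasure lam i j R) := by
  have : IsFiniteMeasure ((((comp i lam).restrict (cube d R)).prod
    ((comp j lam).restrict (cube d R))).map fun p => p.1 - p.2) := Measure.isFiniteMeasure_map _ _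
  exact Measure.smul_finite _ ENNReal.ofReal_ne_top

theorem integral_autocorrMeasure (lam : PointMeasure d m) (i j : Fin m) {R : ℝ} (hR : 0 ≤ R)
    {f : Space d → ℂ} (hf : Continuous f) {C : ℝ} (hC : ∀ x, ‖f x‖ ≤ C) :
    ∫ z, f z ∂(autocorrMeasure lam i j R) = ((R ^ d)⁻¹ : ℝ) *
      ∫ x in cube d R, ∫ y in cube d R, f (x - y) ∂(comp j lam) ∂(comp i lam) := by
  have hsub : Measurable fun p : Space d × Space d => p.1 - p.2 := by fun_prop
  rw [autocorrMeasure, integral_smul_measure, integral_map hsub.aemeasurable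
    hf.measurable.aestronglyMeasurable, integral_prod, ENNReal.toReal_ofReal (by positivity)]
  · rfl
  · exact Integrable.of_bound (hf.measurable.comp hsub).aestronglyMeasurable C
      (ae_of_all _ fun p => hC _)

theorem autocorrelationAt_eq_sum (w : Fin m → ℝ) (lam : PointMeasure d m) {R : ℝ} (hR : 0 ≤ R)
    {f : Space d → ℂ} (hf : Continuous f) {C : ℝ} (hC : ∀ x, ‖f x‖ ≤ C) :
    autocorrelationAt w lam R f =
      ∑ i, ∑ j, (w i : ℂ) * (w j : ℂ) * ∫ z, f z ∂(autocorrMeasure lam i j R) := by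
  unfold autocorrelationAt count
  simp only [integral_indicator (measurableSet_cube R)]
  have hint : ∀ i j, Integrable (fun x => ∫ y in cube d R, f (x - y) ∂(comp j lam))
      ((comp i lam).restrict (cube d R)) := fun i j =>
    Integrable.integral_prod_left (f := fun p : Space d × Space d => f (p.1 - p.2))
      (ν := (comp j lam).restrict (cube d R))
      (Integrable.of_bound (hf.measurable.comp (by fun_prop)).aestronglyMeasurable C
        (ae_of_all _ fun p => hC _))
  rw [Finset.mul_sum]
  refine Finset.sum_congr rfl fun i _ => ?_
  rw [integral_finsetSum _ fun j _ => (hint i j).const_mul _, Finset.mul_sum, Finset.mul_sum]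
  refine Finset.sum_congr rfl fun j _ => ?_
  rw [integral_const_mul, integral_autocorrMeasure lam i j hR hf hC, ← measureReal_def,
    volume_real_cube hR]
  push_cast
  ring

/-- For fixed `x`, at most one `y` has `x - y` in a given translate of `C_r`, and `C_R` contains at
most `r⁻ᵈ (R + r)ᵈ` points `x`. Division by `Rᵈ` leaves at most `r⁻ᵈ (1 + r)ᵈ` when `R ≥ 1`,
uniformly in the configuration. -/
theorem exists_autocorrMeasure_translate_le {r : ℝ} (hr : 0 < r) : ∃ N : ℝ≥0∞, N < ∞ ∧
    ∀ lam ∈ uniformlyDiscrete d m r, ∀ (i j : Fin m) (R : ℝ), 1 ≤ R → ∀ t,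
      autocorrMeasure lam i j R ((fun x => t + x) '' cube d r) ≤ N := by
  refine ⟨(ENNReal.ofReal r ^ d)⁻¹ * ENNReal.ofReal ((1 + r) ^ d), ENNReal.mul_lt_top
    (ENNReal.inv_lt_top.2 (by positivity)) ENNReal.ofReal_lt_top, fun lam hlam i j R hR t => ?_⟩
  have hR0 : 0 < R := by linarith
  have hm := (isOpen_translate_cube t r).measurableSet
  have hsub : Measurable fun p : Space d × Space d => p.1 - p.2 := by fun_prop
  have h1 : ∀ x, ((comp j lam).restrict (cube d R)) (Prod.mk x ⁻¹' ((fun p : Space d × Space d =>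
      p.1 - p.2) ⁻¹' ((fun x => t + x) '' cube d r))) ≤ 1 := by
    intro x
    refine (Measure.restrict_apply_le _ _).trans ?_
    refine le_trans (measure_mono fun y hy => ?_) (comp_translate_cube_le hlam j (x - t))
    have hy' : x - y ∈ (fun x => t + x) '' cube d r := hy
    rw [mem_translate] at hy' ⊢
    rw [← neg_mem_cube_iff]
    convert hy' using 1
    abel
  have h2 : comp i lam (cube d R) ≤ (ENNReal.ofReal r ^ d)⁻¹ * ENNReal.ofReal ((R + r) ^ d) := by
    have := lintegral_le_of_translate_cube_le hr (comp_translate_cube_le hlam i)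
      (measurable_one.indicator (measurableSet_cube R))
      (measurable_one.indicator (measurableSet_cube (R + r))) fun y s hys => by
        by_cases hy : y ∈ cube d R
        · have : s ∈ cube d (R + r) := by
            have := sub_mem_cube hy hys le_rfl
            simpa using this
          rw [Set.indicator_of_mem hy, Set.indicator_of_mem this]
          exact le_rfl
        · rw [Set.indicator_of_notMem hy]
          exact zero_le
    rw [lintegral_indicator_one (measurableSet_cube R),
      lintegral_indicator_one (measurableSet_cube _), volume_cube, one_mul,
      ← ENNReal.ofReal_pow (p := R + r) (by positivity)] at this
    exact this
  rw [autocorrMeasure, Measure.smul_apply, smul_eq_mul, Measure.map_apply hsub hm,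
    Measure.prod_apply (hsub hm)]
  calc _ ≤ ENNReal.ofReal (R ^ d)⁻¹ * ∫⁻ _x in cube d R, 1 ∂(comp i lam) := by
        gcongr with x; exact h1 x
    _ ≤ ENNReal.ofReal (R ^ d)⁻¹ *
        ((ENNReal.ofReal r ^ d)⁻¹ * ENNReal.ofReal ((R + r) ^ d)) := by
        rw [setLIntegral_one]; gcongr
    _ = (ENNReal.ofReal r ^ d)⁻¹ * ENNReal.ofReal ((R ^ d)⁻¹ * (R + r) ^ d) := by
        rw [mul_left_comm, ← ENNReal.ofReal_mul (by positivity)]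
    _ ≤ _ := by
        gcongr
        rw [inv_mul_le_iff₀ (by positivity), ← mul_pow]
        refine pow_le_pow_left₀ (by positivity) ?_ d
        nlinarith

theorem exists_normalized_bump (d : ℕ) : ∃ ψ : C_c(Space d, ℝ), (∀ x, 0 ≤ ψ x) ∧
    ∫⁻ x, ENNReal.ofReal (ψ x) = 1 := by
  obtain ⟨φ, hφ1, hφ⟩ := exists_cutoff (isCompact_singleton (x := (0 : Space d)))
  have hpos : 0 < ∫ x, φ x := φ.continuous.integral_pos_of_hasCompactSupport_nonneg_nonzero
    φ.hasCompactSupport (fun x => (hφ x).1) (x := 0) (by rw [hφ1 0 rfl]; exact one_ne_zero)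
  refine ⟨(∫ x, φ x)⁻¹ • φ, fun x => mul_nonneg (by positivity) (hφ x).1, ?_⟩
  have hint : Integrable (fun x => ((∫ x, φ x)⁻¹ • φ) x) :=
    integrable_compactlySupported volume _
  rw [← ofReal_integral_eq_lintegral_ofReal hint
    (ae_of_all _ fun x => mul_nonneg (by positivity) (hφ x).1)]
  have : ∫ x, ((∫ x, φ x)⁻¹ • φ) x = (∫ x, φ x)⁻¹ * ∫ x, φ x := integral_const_mul _ _
  rw [this, inv_mul_cancel₀ hpos.ne', ENNReal.ofReal_one]

/-- A function on `ℝᵈ` placed on the points of colour `i`. -/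
theorem continuous_colour_indicator (i : Fin m) {Z : Type*} [TopologicalSpace Z]
    {g : Z × ColSpace d m → ℝ} (hg : Continuous g) :
    Continuous fun q : Z × ColSpace d m =>
      (Prod.snd ⁻¹' {i} : Set (ColSpace d m)).indicator (fun p => g (q.1, p)) q.2 := by
  have hcl : IsClopen {q : Z × ColSpace d m | q.2.2 = i} :=
    (isClopen_discrete {i}).preimage (continuous_snd.comp continuous_snd)
  refine (hg.indicator (s := {q | q.2.2 = i}) fun a ha => ?_)
  rw [hcl.frontier_eq] at ha
  exact ha.elim

theorem continuous_integral_comp (i : Fin m) (f : C_c(Space d, ℝ)) :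
    Continuous fun lam : PointMeasure d m => ∫ x, f x ∂(comp i lam) := by
  rw [show (fun lam : PointMeasure d m => ∫ x, f x ∂(comp i lam)) = fun lam =>
      ∫ p, (Prod.snd ⁻¹' {i} : Set (ColSpace d m)).indicator (fun p => f p.1) p ∂lam.1 from
    funext fun lam => integral_comp i lam f.continuous.measurable.stronglyMeasurable]
  have hg : Continuous fun q : PointMeasure d m × ColSpace d m => f q.2.1 := by fun_prop
  refine continuous_integral_param continuous_id
    (h := fun _ p => (Prod.snd ⁻¹' {i} : Set (ColSpace d m)).indicator (fun p => f p.1) p)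
    (continuous_colour_indicator i hg) fun _ => ⟨tsupport f ×ˢ Set.univ,
      f.hasCompactSupport.prod isCompact_univ, Eventually.of_forall fun _ p hp => ?_⟩
  refine Set.indicator_apply_eq_zero.2 fun _ => image_eq_zero_of_notMem_tsupport fun h => hp ⟨h, trivial⟩

/-- The number of pairs of a `ψ`-weighted point of colour `j` and an `f`-weighted point, relative to
it, of colour `i`. -/
def pairSum (i j : Fin m) (f ψ : Space d → ℝ) (lam : PointMeasure d m) : ℝ :=
  ∫ y, ψ y * ∫ x, f x ∂(comp i (-y +ᵥ lam)) ∂(comp j lam)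

/-- The configuration enters both as the measure of integration and through the translates in the
integrand. The integrand is jointly continuous because the action is, and `tsupport ψ` confines it
to a fixed compact set, so `continuous_integral_param` applies. -/
theorem continuous_pairSum (i j : Fin m) (f ψ : C_c(Space d, ℝ)) :
    Continuous (pairSum i j f ψ : PointMeasure d m → ℝ) := by
  have hH := continuous_integral_comp (m := m) i f
  have hg : Continuous fun q : PointMeasure d m × ColSpace d m =>
      ψ q.2.1 * ∫ x, f x ∂(comp i (-q.2.1 +ᵥ q.1)) :=
    (by fun_prop : Continuous fun q : PointMeasure d m × ColSpace d m => ψ q.2.1).mul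
      (hH.comp (by fun_prop : Continuous fun q : PointMeasure d m × ColSpace d m => -q.2.1 +ᵥ q.1))
  have heq : (pairSum i j f ψ : PointMeasure d m → ℝ) = fun lam =>
      ∫ p, (Prod.snd ⁻¹' {j} : Set (ColSpace d m)).indicator
        (fun p => ψ p.1 * ∫ x, f x ∂(comp i (-p.1 +ᵥ lam))) p ∂lam.1 := by
    funext lam
    have hc : Continuous fun y : Space d => ψ y * ∫ x, f x ∂(comp i (-y +ᵥ lam)) :=
      ψ.continuous.mul (hH.comp (by fun_prop : Continuous fun y : Space d => -y +ᵥ lam))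
    exact integral_comp j lam hc.measurable.stronglyMeasurable
  rw [heq]
  refine continuous_integral_param continuous_id (continuous_colour_indicator j hg) fun _ =>
    ⟨tsupport ψ ×ˢ Set.univ, ψ.hasCompactSupport.prod isCompact_univ,
      Eventually.of_forall fun _ p hp => ?_⟩
  refine Set.indicator_apply_eq_zero.2 fun _ => ?_
  rw [image_eq_zero_of_notMem_tsupport fun h => hp ⟨h, trivial⟩, zero_mul]

theorem pairSum_nonneg (i j : Fin m) {f ψ : Space d → ℝ} (hf : ∀ x, 0 ≤ f x) (hψ : ∀ x, 0 ≤ ψ x)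
    (lam : PointMeasure d m) : 0 ≤ pairSum i j f ψ lam :=
  integral_nonneg fun y => mul_nonneg (hψ y) (integral_nonneg hf)

theorem ofReal_pairSum (i j : Fin m) {f ψ : C_c(Space d, ℝ)} (hf : ∀ x, 0 ≤ f x)
    (hψ : ∀ x, 0 ≤ ψ x) (lam : PointMeasure d m) :
    ENNReal.ofReal (pairSum i j f ψ lam) = ∫⁻ y, ENNReal.ofReal (ψ y) *
      ∫⁻ x, ENNReal.ofReal (f x) ∂(comp i (-y +ᵥ lam)) ∂(comp j lam) := by
  have hc : Continuous fun y : Space d => ψ y * ∫ x, f x ∂(comp i (-y +ᵥ lam)) :=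
    ψ.continuous.mul ((continuous_integral_comp (m := m) i f).comp
      (by fun_prop : Continuous fun y : Space d => -y +ᵥ lam))
  rw [pairSum, ofReal_integral_eq_lintegral_ofReal
    (hc.integrable_of_hasCompactSupport ψ.hasCompactSupport.mul_right)
    (ae_of_all _ fun y => mul_nonneg (hψ y) (integral_nonneg hf))]
  refine lintegral_congr fun y => ?_
  rw [ENNReal.ofReal_mul (hψ y), ofReal_integral_eq_lintegral_ofReal
    (integrable_compactlySupported _ f) (ae_of_all _ hf)]

end Autocorrelation

/-! ### Orbit averages of pair sums are autocorrelations. -/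

section PairAverage

/-- Translation leaves the difference `x - y` of a pair fixed and only moves the window, so the
integral over `t` acts on `ψ` alone. -/
theorem setLIntegral_pairSum_orbit (i j : Fin m) {f ψ : C_c(Space d, ℝ)} (hf : ∀ x, 0 ≤ f x)
    (hψ : ∀ x, 0 ≤ ψ x) (lam : PointMeasure d m) (R : ℝ) :
    ∫⁻ t in cube d R, ENNReal.ofReal (pairSum i j f ψ (t +ᵥ lam)) =
      ∫⁻ y, (∫⁻ t in cube d R, ENNReal.ofReal (ψ (t + y))) *
        ∫⁻ x, ENNReal.ofReal (f (-y + x)) ∂(comp i lam) ∂(comp j lam) := by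
  have h1 : ∀ t, ENNReal.ofReal (pairSum i j f ψ (t +ᵥ lam)) = ∫⁻ y, ENNReal.ofReal (ψ (t + y)) *
      ∫⁻ x, ENNReal.ofReal (f (-y + x)) ∂(comp i lam) ∂(comp j lam) := by
    intro t
    rw [ofReal_pairSum i j hf hψ, lintegral_comp_vadd]
    refine lintegral_congr fun y => ?_
    rw [vadd_vadd, neg_add_rev, neg_add_cancel_right, lintegral_comp_vadd]
  have hψm : Measurable fun p : Space d × Space d => ENNReal.ofReal (ψ (p.1 + p.2)) :=
    ((by fun_prop : Continuous fun p : Space d × Space d => ψ (p.1 + p.2)).measurable).ennreal_ofReal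
  have hfm : Measurable fun p : Space d × Space d => ENNReal.ofReal (f (-p.1 + p.2)) :=
    ((by fun_prop : Continuous fun p : Space d × Space d => f (-p.1 + p.2)).measurable).ennreal_ofReal
  have hΦ : Measurable fun y => ∫⁻ x, ENNReal.ofReal (f (-y + x)) ∂(comp i lam) :=
    hfm.lintegral_prod_right'
  simp only [h1]
  rw [lintegral_lintegral_swap (hψm.mul (hΦ.comp measurable_snd)).aemeasurable]
  refine lintegral_congr fun y => ?_
  exact lintegral_mul_const _ (by exact hψm.comp measurable_prodMk_right)

theorem lintegral_autocorrMeasure (lam : PointMeasure d m) (i j : Fin m) (R : ℝ)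
    {f : Space d → ℝ≥0∞} (hf : Measurable f) :
    ∫⁻ z, f z ∂(autocorrMeasure lam i j R) = ENNReal.ofReal (R ^ d)⁻¹ *
      ∫⁻ y in cube d R, ∫⁻ x in cube d R, f (-y + x) ∂(comp i lam) ∂(comp j lam) := by
  have hsub : Measurable fun p : Space d × Space d => p.1 - p.2 := by fun_prop
  rw [autocorrMeasure, lintegral_smul_measure, lintegral_map hf hsub,
    lintegral_prod_symm' (fun p : Space d × Space d => f (p.1 - p.2)) (by exact hf.comp hsub)]
  simp only [sub_eq_neg_add, smul_eq_mul]

theorem ofReal_integral_autocorrMeasure (lam : PointMeasure d m) (i j : Fin m) (R : ℝ)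
    {f : C_c(Space d, ℝ)} (hf : ∀ x, 0 ≤ f x) :
    ENNReal.ofReal (∫ z, f z ∂(autocorrMeasure lam i j R)) = ENNReal.ofReal (R ^ d)⁻¹ *
      ∫⁻ y in cube d R, ∫⁻ x in cube d R, ENNReal.ofReal (f (-y + x)) ∂(comp i lam)
        ∂(comp j lam) := by
  rw [ofReal_integral_eq_lintegral_ofReal (integrable_compactlySupported _ f) (ae_of_all _ hf),
    lintegral_autocorrMeasure _ _ _ _ (f := fun x => ENNReal.ofReal (f x))
      f.continuous.measurable.ennreal_ofReal]

/-- If `y ∈ C_R` and `t + y` lies in the support of `ψ`, then `t ∈ C_{R+c}`. Every pair inside `C_R`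
is therefore counted with full weight `∫ ψ = 1`. -/
theorem setLIntegral_pair_le (i j : Fin m) {f ψ : C_c(Space d, ℝ)} (hf : ∀ x, 0 ≤ f x)
    (hψ : ∀ x, 0 ≤ ψ x) (hψ1 : ∫⁻ x, ENNReal.ofReal (ψ x) = 1) {c : ℝ}
    (hψc : ∀ x, x ∉ cube d c → ψ x = 0) (lam : PointMeasure d m) (R : ℝ) :
    ∫⁻ y in cube d R, ∫⁻ x in cube d R, ENNReal.ofReal (f (-y + x)) ∂(comp i lam) ∂(comp j lam) ≤
      ∫⁻ t in cube d (R + c), ENNReal.ofReal (pairSum i j f ψ (t +ᵥ lam)) := by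
  rw [setLIntegral_pairSum_orbit i j hf hψ, ← lintegral_indicator (measurableSet_cube R)]
  refine lintegral_mono fun y => ?_
  by_cases hy : y ∈ cube d R
  · rw [Set.indicator_of_mem hy]
    have : ∫⁻ t in cube d (R + c), ENNReal.ofReal (ψ (t + y)) = 1 := by
      rw [setLIntegral_eq_of_support_subset, lintegral_add_right_eq_self
        (fun x => ENNReal.ofReal (ψ x)), hψ1]
      intro t ht
      by_contra h
      refine ht ?_
      change ENNReal.ofReal (ψ (t + y)) = 0
      rw [hψc _ fun hc => h ?_, ENNReal.ofReal_zero]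
      simpa using sub_mem_cube hc hy (add_comm c R).le
    rw [this, one_mul]
    exact setLIntegral_le_lintegral _ _
  · rw [Set.indicator_of_notMem hy]
    exact zero_le

/-- Only `y ∈ C_{R+c}` receives weight, which is at most 1, and a partner `x` with `f(x - y) ≠ 0`
lies within another `C_c`, hence in `C_{R+2c}`. -/
theorem setLIntegral_pairSum_orbit_le (i j : Fin m) {f ψ : C_c(Space d, ℝ)} (hf : ∀ x, 0 ≤ f x)
    (hψ : ∀ x, 0 ≤ ψ x) (hψ1 : ∫⁻ x, ENNReal.ofReal (ψ x) = 1) {c : ℝ} (hc : 0 ≤ c)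
    (hψc : ∀ x, x ∉ cube d c → ψ x = 0) (hfc : ∀ x, x ∉ cube d c → f x = 0)
    (lam : PointMeasure d m) (R : ℝ) :
    ∫⁻ t in cube d R, ENNReal.ofReal (pairSum i j f ψ (t +ᵥ lam)) ≤
      ∫⁻ y in cube d (R + 2 * c), ∫⁻ x in cube d (R + 2 * c), ENNReal.ofReal (f (-y + x))
        ∂(comp i lam) ∂(comp j lam) := by
  rw [setLIntegral_pairSum_orbit i j hf hψ, ← lintegral_indicator (measurableSet_cube _)]
  refine lintegral_mono fun y => ?_
  by_cases hy : y ∈ cube d (R + c)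
  · rw [Set.indicator_of_mem (cube_mono (by linarith) hy)]
    have h1 : ∫⁻ t in cube d R, ENNReal.ofReal (ψ (t + y)) ≤ 1 := by
      refine (setLIntegral_le_lintegral _ _).trans ?_
      rw [lintegral_add_right_eq_self (fun x => ENNReal.ofReal (ψ x)), hψ1]
    refine (mul_le_of_le_one_left' h1).trans ?_
    rw [setLIntegral_eq_of_support_subset]
    intro x hx
    by_contra h
    refine hx ?_
    change ENNReal.ofReal (f (-y + x)) = 0
    rw [hfc _ fun hc => h ?_, ENNReal.ofReal_zero]
    simpa using add_mem_cube hy hc (by linarith)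
  · have : ∫⁻ t in cube d R, ENNReal.ofReal (ψ (t + y)) = 0 := by
      rw [setLIntegral_congr_fun (g := fun _ => 0) (measurableSet_cube R), lintegral_zero]
      intro t ht
      change ENNReal.ofReal (ψ (t + y)) = 0
      rw [hψc _ fun hc => hy ?_, ENNReal.ofReal_zero]
      simpa using sub_mem_cube hc ht (add_comm c R).le
    rw [this, zero_mul]
    exact zero_le

variable {μ : Measure (PointMeasure d m)} [VAddInvariantMeasure (Space d) (PointMeasure d m) μ]

theorem ofReal_cubeAverage_pairSum (hc : IsCompact μ.support) (i j : Fin m) {f ψ : C_c(Space d, ℝ)}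
    (hf : ∀ x, 0 ≤ f x) (hψ : ∀ x, 0 ≤ ψ x) {lam : PointMeasure d m} (hlam : lam ∈ μ.support)
    {R : ℝ} (hR : 0 ≤ R) :
    ENNReal.ofReal (cubeAverage d (pairSum i j f ψ) R lam) = ENNReal.ofReal (R ^ d)⁻¹ *
      ∫⁻ t in cube d R, ENNReal.ofReal (pairSum i j f ψ (t +ᵥ lam)) := by
  rw [cubeAverage, ENNReal.ofReal_mul (by positivity), ofReal_integral_eq_lintegral_ofReal
    (integrableOn_orbit_support hc (continuous_pairSum i j f ψ).continuousOn hlam R)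
    (ae_of_all _ fun t => pairSum_nonneg i j hf hψ _)]

/-- The Campbell formula for points of colour `j` with window `ψ`. The base point `y` has colour `j`
and the counted point `x` has colour `i`, hence the order `j i` in the moment measure. -/
theorem integral_pairSum [IsProbabilityMeasure μ] (hc : IsCompact μ.support) (i j : Fin m)
    [IsFiniteMeasureOnCompacts (momentMeasure μ j i)] {f ψ : C_c(Space d, ℝ)}
    (hf : ∀ x, 0 ≤ f x) (hψ : ∀ x, 0 ≤ ψ x) (hψ1 : ∫⁻ x, ENNReal.ofReal (ψ x) = 1) :
    ∫ lam, pairSum i j f ψ lam ∂μ = ∫ x, f x ∂(momentMeasure μ j i) := by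
  have hcont := continuous_pairSum (m := m) i j f ψ
  have hint : Integrable (pairSum i j f ψ) μ := by
    obtain ⟨C, hC⟩ := exists_bound_on_support hc hcont.continuousOn
    refine Integrable.of_bound hcont.measurable.aestronglyMeasurable C ?_
    filter_upwards [Measure.support_mem_ae (μ := μ)] with lam hlam using hC lam hlam
  rw [← ENNReal.ofReal_eq_ofReal_iff (integral_nonneg fun lam => pairSum_nonneg i j hf hψ lam)
    (integral_nonneg hf), ofReal_integral_eq_lintegral_ofReal hint
    (ae_of_all _ fun lam => pairSum_nonneg i j hf hψ lam),
    ofReal_integral_eq_lintegral_ofReal (integrable_compactlySupported _ f) (ae_of_all _ hf),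
    lintegral_momentMeasure _ _ (f := fun x => ENNReal.ofReal (f x))
      f.continuous.measurable.ennreal_ofReal]
  simp only [ofReal_pairSum i j hf hψ]
  rw [lintegral_campbell j (Φ := fun lam => ∫⁻ x, ENNReal.ofReal (f x) ∂(comp i lam))
    (ψ := fun y => ENNReal.ofReal (ψ y))
    (measurable_lintegral_comp i measurable_id
      (by exact f.continuous.measurable.ennreal_ofReal.comp measurable_snd))
    ψ.continuous.measurable.ennreal_ofReal, hψ1, one_mul]

/-- The autocorrelation at `R` is squeezed between the volume-corrected orbit averages of `pairSum`
at `R - 2c` and `R + c`. Genericity and the ratios of volumes give both bounds the same limit. -/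
theorem IsGeneric.tendsto_autocorrMeasure_of_nonneg [IsProbabilityMeasure μ]
    (hc : IsCompact μ.support) {lam : PointMeasure d m} (h : IsGeneric μ lam) (i j : Fin m)
    [IsFiniteMeasureOnCompacts (momentMeasure μ j i)] {f : C_c(Space d, ℝ)} (hf : ∀ x, 0 ≤ f x) :
    Tendsto (fun R => ∫ x, f x ∂(autocorrMeasure lam i j R)) atTop
      (𝓝 (∫ x, f x ∂(momentMeasure μ j i))) := by
  obtain ⟨ψ, hψ, hψ1⟩ := exists_normalized_bump d
  obtain ⟨c, hcpos, hsub⟩ := exists_subset_cube (f.hasCompactSupport.isCompact.isBounded.union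
    ψ.hasCompactSupport.isCompact.isBounded)
  have hfc : ∀ x, x ∉ cube d c → f x = 0 := fun x hx =>
    image_eq_zero_of_notMem_tsupport fun h => hx (hsub (Or.inl h))
  have hψc : ∀ x, x ∉ cube d c → ψ x = 0 := fun x hx =>
    image_eq_zero_of_notMem_tsupport fun h => hx (hsub (Or.inr h))
  have hA := h.2 _ (continuous_pairSum i j f ψ).continuousOn
  rw [integral_pairSum hc i j hf hψ hψ1] at hA
  set A : ℝ → ℝ := fun R => cubeAverage d (pairSum i j f ψ) R lam with hAdef
  have hshift : ∀ b : ℝ, Tendsto (fun R => (R + b) ^ d / R ^ d * A (R + b)) atTop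
      (𝓝 (∫ x, f x ∂(momentMeasure μ j i))) := fun b => by
    simpa using (tendsto_cube_ratio (d := d) b).mul
      (hA.comp (tendsto_atTop_add_const_right _ b tendsto_id))
  have hnn : ∀ R, 0 ≤ R → 0 ≤ A R := fun R hR => mul_nonneg (by positivity)
    (integral_nonneg fun t => pairSum_nonneg i j hf hψ _)
  have hinv : ∀ {R S : ℝ}, 0 < R → 0 < S → ENNReal.ofReal (R ^ d)⁻¹ =
      ENNReal.ofReal (S ^ d / R ^ d) * ENNReal.ofReal (S ^ d)⁻¹ := fun {R S} hR hS => by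
    rw [← ENNReal.ofReal_mul (by positivity)]
    congr 1
    field_simp
  refine tendsto_of_tendsto_of_tendsto_of_le_of_le' (hshift (-(2 * c))) (hshift c) ?_ ?_
  · filter_upwards [eventually_gt_atTop (2 * c)] with R hR
    have hR0 : 0 < R := by linarith
    have hS0 : 0 < R + -(2 * c) := by linarith
    rw [← ENNReal.ofReal_le_ofReal_iff (integral_nonneg hf), ENNReal.ofReal_mul (by positivity),
      ofReal_cubeAverage_pairSum hc i j hf hψ h.1 hS0.le, ← mul_assoc, ← hinv hR0 hS0,
      ofReal_integral_autocorrMeasure _ _ _ _ hf]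
    refine mul_le_mul' le_rfl ?_
    simpa using setLIntegral_pairSum_orbit_le i j hf hψ hψ1 hcpos.le hψc hfc lam (R + -(2 * c))
  · filter_upwards [eventually_gt_atTop 0] with R hR
    have hS0 : 0 < R + c := by linarith
    rw [← ENNReal.ofReal_le_ofReal_iff (mul_nonneg (by positivity) (hnn _ hS0.le)),
      ENNReal.ofReal_mul (by positivity), ofReal_cubeAverage_pairSum hc i j hf hψ h.1 hS0.le,
      ← mul_assoc, ← hinv hR hS0, ofReal_integral_autocorrMeasure _ _ _ _ hf]
    refine mul_le_mul' le_rfl ?_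
    exact setLIntegral_pair_le i j hf hψ hψ1 hψc lam R

theorem IsGeneric.tendsto_autocorrMeasure [IsProbabilityMeasure μ]
    (hc : IsCompact μ.support) {lam : PointMeasure d m} (h : IsGeneric μ lam) (i j : Fin m)
    [IsFiniteMeasureOnCompacts (momentMeasure μ j i)] (f : C_c(Space d, ℝ)) :
    Tendsto (fun R => ∫ x, f x ∂(autocorrMeasure lam i j R)) atTop
      (𝓝 (∫ x, f x ∂(momentMeasure μ j i))) :=
  tendsto_integral_real_of_nonneg
    (fun _ hf => h.tendsto_autocorrMeasure_of_nonneg hc i j hf) f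

theorem IsGeneric.hasAutocorrelation [IsProbabilityMeasure μ]
    (hc : IsCompact μ.support) {lam : PointMeasure d m} (h : IsGeneric μ lam)
    [∀ i j, IsFiniteMeasureOnCompacts (momentMeasure μ i j)] (w : Fin m → ℝ) :
    HasAutocorrelation w lam (weightedMoment μ w) := by
  intro f
  obtain ⟨C, hC⟩ := f.hasCompactSupport.exists_bound_of_continuous f.continuous
  -- Pairs `(i, j)` of the autocorrelation converge to the moment measure of `(j, i)`; the order of
  -- summation is exchanged to match.
  rw [weightedMoment_eq_sum w fun i j => integrable_compactlySupported _ f, Finset.sum_comm]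
  have hlim : Tendsto (fun R => ∑ i, ∑ j, (w i : ℂ) * (w j : ℂ) *
      ∫ z, f z ∂(autocorrMeasure lam i j R)) atTop
      (𝓝 (∑ i, ∑ j, (w j : ℂ) * (w i : ℂ) * ∫ x, f x ∂(momentMeasure μ j i))) := by
    refine tendsto_finsetSum _ fun i _ => tendsto_finsetSum _ fun j _ => ?_
    rw [mul_comm (w j : ℂ)]
    exact (tendsto_integral_complex (h.tendsto_autocorrMeasure hc i j) f).const_mul _
  refine hlim.congr' ?_
  filter_upwards [eventually_ge_atTop 0] with R hR
  exact (autocorrelationAt_eq_sum w lam hR f.continuous hC).symm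

end PairAverage

/-! ### Autocorrelations as quadratic forms. -/

section QuadraticForm

open ComplexConjugate

/-- Fubini for a weighted squared modulus of a linear combination of integrals. -/
theorem integral_mul_normSq_sum {U E : Type*} [MeasurableSpace U] [MeasurableSpace E]
    {τ : Measure U} [SFinite τ] (ν : Fin m → Measure E) [∀ i, IsFiniteMeasure (ν i)] (w : Fin m → ℝ)
    {ρ : U → ℂ} (hρ : Integrable ρ τ) {G : U → E → ℂ} (hG : Measurable (Function.uncurry G)) {M : ℝ}
    (hM : ∀ u x, ‖G u x‖ ≤ M) :
    ∫ u, ρ u * (Complex.normSq (∑ i, (w i : ℂ) * ∫ x, G u x ∂(ν i)) : ℂ) ∂τ =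
      ∑ i, ∑ j, (w i : ℂ) * (w j : ℂ) *
        ∫ p, ∫ u, ρ u * (G u p.1 * conj (G u p.2)) ∂τ ∂((ν i).prod (ν j)) := by
  have hprod : ∀ i j, Integrable (fun q : U × E × E => ρ q.1 * (G q.1 q.2.1 * conj (G q.1 q.2.2)))
      (τ.prod ((ν i).prod (ν j))) := by
    intro i j
    have hm : Measurable fun q : U × E × E => G q.1 q.2.1 * conj (G q.1 q.2.2) := by
      refine Measurable.mul (by exact hG.comp (by fun_prop : Measurable fun q : U × E × E =>
        (q.1, q.2.1))) ?_
      exact Complex.continuous_conj.measurable.comp (hG.comp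
        (by fun_prop : Measurable fun q : U × E × E => (q.1, q.2.2)))
    refine (hρ.comp_fst ((ν i).prod (ν j))).mul_bdd (c := M * M) hm.aestronglyMeasurable
      (ae_of_all _ fun q => ?_)
    rw [norm_mul, RCLike.norm_conj]
    exact mul_le_mul (hM _ _) (hM _ _) (norm_nonneg _) ((norm_nonneg _).trans (hM q.1 q.2.1))
  have hexp : ∀ u, ρ u * (Complex.normSq (∑ i, (w i : ℂ) * ∫ x, G u x ∂(ν i)) : ℂ) =
      ∑ i, ∑ j, (w i : ℂ) * (w j : ℂ) *
        ∫ p, ρ u * (G u p.1 * conj (G u p.2)) ∂((ν i).prod (ν j)) := by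
    intro u
    rw [← Complex.mul_conj, map_sum, Finset.sum_mul_sum, Finset.mul_sum]
    refine Finset.sum_congr rfl fun i _ => ?_
    rw [Finset.mul_sum]
    refine Finset.sum_congr rfl fun j _ => ?_
    rw [integral_const_mul, integral_prod_mul (G u) (fun y => conj (G u y)), integral_conj, map_mul,
      Complex.conj_ofReal]
    ring
  simp only [hexp]
  have hint : ∀ i j, Integrable (fun u => (w i : ℂ) * (w j : ℂ) *
      ∫ p, ρ u * (G u p.1 * conj (G u p.2)) ∂((ν i).prod (ν j))) τ := fun i j =>
    (hprod i j).integral_prod_left.const_mul _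
  rw [integral_finsetSum _ fun i _ => integrable_finsetSum _ fun j _ => hint i j]
  refine Finset.sum_congr rfl fun i _ => ?_
  rw [integral_finsetSum _ fun j _ => hint i j]
  refine Finset.sum_congr rfl fun j _ => ?_
  rw [integral_const_mul, integral_integral_swap (by exact hprod i j)]

theorem integral_autocorrMeasure_prod (lam : PointMeasure d m) (i j : Fin m) {R : ℝ} (hR : 0 ≤ R)
    {f : Space d → ℂ} (hf : Continuous f) :
    ∫ z, f z ∂(autocorrMeasure lam i j R) = ((R ^ d)⁻¹ : ℝ) *
      ∫ p, f (p.1 - p.2) ∂(((comp i lam).restrict (cube d R)).prod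
        ((comp j lam).restrict (cube d R))) := by
  have hsub : Measurable fun p : Space d × Space d => p.1 - p.2 := by fun_prop
  rw [autocorrMeasure, integral_smul_measure, integral_map hsub.aemeasurable
    hf.measurable.aestronglyMeasurable, ENNReal.toReal_ofReal (by positivity)]
  rfl

/-- The autocorrelation in a cube of a function of positive type. -/
theorem sum_integral_autocorrMeasure (w : Fin m → ℝ) (lam : PointMeasure d m) {R : ℝ} (hR : 0 ≤ R)
    {H : Space d → ℂ} (hH : Continuous H) {ρ : Space d → ℂ} (hρ : Integrable ρ)
    {G : Space d → Space d → ℂ} (hG : Measurable (Function.uncurry G)) {M : ℝ}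
    (hM : ∀ u x, ‖G u x‖ ≤ M) (h : ∀ x ∈ cube d R, ∀ y ∈ cube d R,
      ∫ u, ρ u * (G u x * conj (G u y)) = H (x - y)) :
    ∑ i, ∑ j, (w i : ℂ) * (w j : ℂ) * ∫ z, H z ∂(autocorrMeasure lam i j R) =
      ((R ^ d)⁻¹ : ℝ) * ∫ u, ρ u *
        (Complex.normSq (∑ i, (w i : ℂ) * ∫ x in cube d R, G u x ∂(comp i lam)) : ℂ) := by
  -- The factorization of `H (x - y)` turns the double sum over pairs into an integral of squared
  -- moduli. It is used with translates of `g` for positive definiteness and with characters for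
  -- diffraction.
  rw [integral_mul_normSq_sum (fun i => (comp i lam).restrict (cube d R)) w hρ hG hM,
    Finset.mul_sum]
  refine Finset.sum_congr rfl fun i _ => ?_
  rw [Finset.mul_sum]
  refine Finset.sum_congr rfl fun j _ => ?_
  rw [integral_autocorrMeasure_prod lam i j hR hH, Measure.prod_restrict,
    setIntegral_congr_fun ((measurableSet_cube R).prod (measurableSet_cube R))
      fun p hp => (h p.1 hp.1 p.2 hp.2).symm]
  ring

end QuadraticForm

/-! ### Positive definiteness. -/

section PositiveDefinite

open ComplexConjugate

/-- `g * g̃` for continuous compactly supported `g`. -/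
def selfConvolution (g : C_c(Space d, ℂ)) : C_c(Space d, ℂ) where
  toFun x := ∫ y, g y * (starRingEnd ℂ) (g (y - x))
  continuous_toFun := by
    have h : ∀ x, ∫ y, g y * conj (g (y - x)) = ∫ y in tsupport g, g y * conj (g (y - x)) := by
      intro x
      rw [setIntegral_eq_integral_of_forall_compl_eq_zero]
      intro y hy
      rw [image_eq_zero_of_notMem_tsupport hy, zero_mul]
    simp only [h]
    exact continuous_parametric_integral_of_continuous
      (by fun_prop : Continuous fun p : Space d × Space d => g p.2 * conj (g (p.2 - p.1)))
      g.hasCompactSupport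
  hasCompactSupport' := by
    refine HasCompactSupport.intro ((g.hasCompactSupport.isCompact.prod
      g.hasCompactSupport.isCompact).image continuous_sub) fun x hx => ?_
    refine integral_eq_zero_of_ae (ae_of_all _ fun y => ?_)
    by_cases hy : y ∈ tsupport g
    · have : y - x ∉ tsupport g := fun hyx => hx ⟨(y, y - x), ⟨hy, hyx⟩, sub_sub_cancel y x⟩
      simp [image_eq_zero_of_notMem_tsupport this]
    · simp [image_eq_zero_of_notMem_tsupport hy]

theorem exists_autocorrelationAt_selfConvolution (w : Fin m → ℝ) (lam : PointMeasure d m)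
    (g : C_c(Space d, ℂ)) {R : ℝ} (hR : 0 ≤ R) : ∃ c : ℝ, 0 ≤ c ∧
      autocorrelationAt w lam R (selfConvolution g) = (c : ℂ) := by
  obtain ⟨C, hC⟩ := (selfConvolution g).hasCompactSupport.exists_bound_of_continuous
    (selfConvolution g).continuous
  obtain ⟨M, hM⟩ := g.hasCompactSupport.exists_bound_of_continuous g.continuous
  obtain ⟨c, hc, hgc⟩ := exists_subset_cube g.hasCompactSupport.isCompact.isBounded
  -- For `x ∈ C_R`, `g(u + x) ≠ 0` forces `u ∈ C_{c+R}`. Truncation to `B` provides an integrable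
  -- weight without changing the integral.
  set B := cube d (c + R) with hB
  have hG : Measurable (Function.uncurry fun u x : Space d => g (u + x)) :=
    (by fun_prop : Continuous fun p : Space d × Space d => g (p.1 + p.2)).measurable
  have hρ : Integrable (B.indicator fun _ => (1 : ℂ) : Space d → ℂ) :=
    (integrable_indicator_iff (measurableSet_cube _)).2
      (integrableOn_const (volume_cube_ne_top _))
  rw [autocorrelationAt_eq_sum w lam hR (f := fun x => selfConvolution g x)
      (selfConvolution g).continuous hC,
    sum_integral_autocorrMeasure w lam hR (H := fun x => selfConvolution g x)
      (selfConvolution g).continuous hρ hG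
      (fun u x => hM (u + x))]
  · refine ⟨(R ^ d)⁻¹ * ∫ u, B.indicator (fun _ => (1 : ℝ)) u * Complex.normSq (∑ i, (w i : ℂ) *
      ∫ x in cube d R, g (u + x) ∂(comp i lam)), mul_nonneg (by positivity)
      (integral_nonneg fun u => mul_nonneg (Set.indicator_nonneg (fun _ _ => zero_le_one) _)
        (Complex.normSq_nonneg _)), ?_⟩
    rw [Complex.ofReal_mul]
    congr 1
    refine Eq.trans ?_ (integral_ofReal (𝕜 := ℂ))
    refine integral_congr_ae (ae_of_all _ fun u => ?_)
    by_cases hu : u ∈ B <;> simp [hu]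
  · intro x hx y hy
    have h1 : ∀ u, (B.indicator fun _ => (1 : ℂ)) u * (g (u + x) * conj (g (u + y))) =
        g (u + x) * conj (g (u + x - (x - y))) := by
      intro u
      rw [show u + x - (x - y) = u + y by abel]
      by_cases hu : u ∈ B
      · rw [Set.indicator_of_mem hu, one_mul]
      · have : g (u + x) = 0 := image_eq_zero_of_notMem_tsupport fun h => hu <| by
          simpa using sub_mem_cube (hgc h) hx le_rfl
        simp [this]
    simp only [h1]
    exact integral_add_right_eq_self (fun v => g v * conj (g (v - (x - y)))) x

/-- Autocorrelations are positive definite. -/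
theorem HasAutocorrelation.isPositiveDefinite {w : Fin m → ℝ} {lam : PointMeasure d m}
    {γ : (Space d → ℂ) → ℂ} (h : HasAutocorrelation w lam γ) : IsPositiveDefinite γ := by
  intro g
  -- The half-line `[0, ∞)` is closed in `ℂ`, so nonnegativity passes to the limit.
  have hcl : IsClosed ((fun c : ℝ => (c : ℂ)) '' Set.Ici 0) :=
    Complex.isometry_ofReal.isClosedEmbedding.isClosedMap _ isClosed_Ici
  obtain ⟨c, hc, hγ⟩ := hcl.mem_of_tendsto (h (selfConvolution g)) (by
    filter_upwards [eventually_ge_atTop 0] with R hR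
    obtain ⟨c, hc, h⟩ := exists_autocorrelationAt_selfConvolution w lam g hR
    exact ⟨c, hc, h.symm⟩)
  exact ⟨c, hc, hγ.symm⟩

end PositiveDefinite

/-! ### The weighted moment as a Radon measure. -/

section Radon

variable {μ : Measure (PointMeasure d m)}

theorem isRadonMeasure_weightedMoment (w : Fin m → ℝ)
    [∀ i j, IsFiniteMeasureOnCompacts (momentMeasure μ i j)] :
    IsRadonMeasure (weightedMoment μ w) where
  map_add f g := by
    have hf := fun i j => integrable_compactlySupported (momentMeasure μ i j) f
    have hg := fun i j => integrable_compactlySupported (momentMeasure μ i j) g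
    rw [weightedMoment_eq_sum w hf, weightedMoment_eq_sum w hg,
      weightedMoment_eq_sum w (f := fun x => f x + g x) fun i j => (hf i j).add (hg i j)]
    simp only [← Finset.sum_add_distrib, ← mul_add]
    refine Finset.sum_congr rfl fun i _ => Finset.sum_congr rfl fun j _ => ?_
    rw [← integral_add (hf i j) (hg i j)]
  map_smul c f := by
    have hf := fun i j => integrable_compactlySupported (momentMeasure μ i j) f
    rw [weightedMoment_eq_sum w hf, weightedMoment_eq_sum w fun i j => (hf i j).const_mul c]
    simp only [Finset.mul_sum, integral_const_mul]
    refine Finset.sum_congr rfl fun i _ => Finset.sum_congr rfl fun j _ => ?_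
    ring
  bounded K hK := by
    refine ⟨∑ i, ∑ j, |w i| * |w j| * (momentMeasure μ i j).real K, fun f hfK M hM => ?_⟩
    rw [weightedMoment_eq_sum w fun i j => integrable_compactlySupported _ f, Finset.sum_mul]
    refine (norm_sum_le _ _).trans (Finset.sum_le_sum fun i _ => ?_)
    rw [Finset.sum_mul]
    refine (norm_sum_le _ _).trans (Finset.sum_le_sum fun j _ => ?_)
    rw [norm_mul, norm_mul, Complex.norm_real, Complex.norm_real, Real.norm_eq_abs,
      Real.norm_eq_abs, mul_assoc _ _ M]
    refine mul_le_mul_of_nonneg_left ?_ (by positivity)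
    rw [← setIntegral_eq_integral_of_forall_compl_eq_zero (s := K) fun x hx =>
      image_eq_zero_of_notMem_tsupport fun h => hx (hfK h), mul_comm]
    exact norm_setIntegral_le_of_norm_le_const hK.measure_lt_top fun x _ => hM x

end Radon

/-! ### Finite-volume diffraction. -/

section Diffraction

open ComplexConjugate

/-- The exponential sum of the weighted points in a cube. -/
def exponentialSum (w : Fin m → ℝ) (lam : PointMeasure d m) (R : ℝ) (k : Space d) : ℂ :=
  ∑ i, (w i : ℂ) * ∫ x in cube d R, (Real.fourierChar (-inner ℝ k x) : ℂ) ∂(comp i lam)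

theorem continuous_exponentialSum (w : Fin m → ℝ) (lam : PointMeasure d m) (R : ℝ) :
    Continuous (exponentialSum w lam R) := by
  refine continuous_finsetSum _ fun i _ => continuous_const.mul ?_
  refine continuous_of_dominated (bound := fun _ => 1) (fun k => ?_) (fun k => ae_of_all _ fun x => ?_)
    (integrable_const _) (ae_of_all _ fun x => ?_)
  · exact (by fun_prop : Continuous fun x : Space d =>
      (Real.fourierChar (-inner ℝ k x) : ℂ)).measurable.aestronglyMeasurable
  · rw [Circle.norm_coe]
  · fun_prop

/-- The intensity of the exponential sum, normalized by the volume. -/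
def intensityDensity (w : Fin m → ℝ) (lam : PointMeasure d m) (R : ℝ) (k : Space d) : ℝ :=
  (R ^ d)⁻¹ * Complex.normSq (exponentialSum w lam R k)

/-- The finite volume diffraction measure. -/
def diffractionAt (w : Fin m → ℝ) (lam : PointMeasure d m) (R : ℝ) : Measure (Space d) :=
  volume.withDensity fun k => ENNReal.ofReal (intensityDensity w lam R k)

theorem continuous_intensityDensity (w : Fin m → ℝ) (lam : PointMeasure d m) (R : ℝ) :
    Continuous (intensityDensity w lam R) :=
  continuous_const.mul (Complex.continuous_normSq.comp (continuous_exponentialSum w lam R))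

instance (w : Fin m → ℝ) (lam : PointMeasure d m) (R : ℝ) :
    IsLocallyFiniteMeasure (diffractionAt w lam R) :=
  IsLocallyFiniteMeasure.withDensity_ofReal (continuous_intensityDensity w lam R)

/-- The finite volume diffraction is the Fourier transform of the finite volume autocorrelation. -/
theorem integral_diffractionAt (w : Fin m → ℝ) (lam : PointMeasure d m) {R : ℝ} (hR : 0 ≤ R)
    {f : Space d → ℂ} (hf : Integrable f) (hf' : Continuous (𝓕 f)) :
    ∫ k, f k ∂(diffractionAt w lam R) =
      ∑ i, ∑ j, (w i : ℂ) * (w j : ℂ) * ∫ z, 𝓕 f z ∂(autocorrMeasure lam i j R) := by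
  have hG : Measurable (Function.uncurry fun k x : Space d =>
      (Real.fourierChar (-inner ℝ k x) : ℂ)) :=
    (by fun_prop : Continuous fun p : Space d × Space d =>
      (Real.fourierChar (-inner ℝ p.1 p.2) : ℂ)).measurable
  rw [sum_integral_autocorrMeasure w lam hR hf' hf hG (fun k x => (Circle.norm_coe _).le),
    diffractionAt, integral_withDensity_eq_integral_toReal_smul
      (continuous_intensityDensity w lam R).measurable.ennreal_ofReal
      (ae_of_all _ fun _ => ENNReal.ofReal_lt_top), ← integral_const_mul]
  · refine integral_congr_ae (ae_of_all _ fun k => ?_)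
    have h0 : 0 ≤ intensityDensity w lam R k :=
      mul_nonneg (by positivity) (Complex.normSq_nonneg _)
    simp only [ENNReal.toReal_ofReal h0]
    rw [intensityDensity, exponentialSum, Complex.real_smul, Complex.ofReal_mul]
    ring
  -- A character at `x` times the conjugate character at `y` is the character at `x - y`, so its
  -- integral against `f` is `𝓕 f (x - y)`.
  · intro x _ y _
    rw [Real.fourier_eq]
    refine integral_congr_ae (ae_of_all _ fun k => ?_)
    simp only
    rw [Circle.smul_def, smul_eq_mul, mul_comm, ← Circle.coe_inv_eq_conj, ← Circle.coe_mul,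
      ← AddChar.map_neg_eq_inv, ← AddChar.map_add_eq_mul, inner_sub_right]
    congr 3
    ring

/-- The seminorm of order `d + 2` supplies the `d + 1` powers of `decay` and one more for the tail
estimate in `tendsto_integral_of_decay`. -/
theorem exists_decay_bound (f : 𝓢(Space d, ℂ)) :
    ∃ C : ℝ, 0 ≤ C ∧ ∀ x, (1 + ‖x‖) * ‖f x‖ ≤ C * decay x := by
  refine ⟨2 ^ (d + 2) * ((Finset.Iic ((d + 2, 0) : ℕ × ℕ)).sup fun m =>
    SchwartzMap.seminorm ℝ m.1 m.2) f, by positivity, fun x => ?_⟩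
  have h := SchwartzMap.one_add_le_sup_seminorm_apply (𝕜 := ℝ) (m := (d + 2, 0)) le_rfl le_rfl f x
  rw [norm_iteratedFDeriv_zero] at h
  rw [decay, ← div_eq_mul_inv, le_div_iff₀ (by positivity)]
  refine le_trans (le_of_eq ?_) h
  ring

theorem exists_decay_bound' (f : 𝓢(Space d, ℂ)) :
    ∃ C : ℝ, 0 ≤ C ∧ ∀ x, ‖f x‖ ≤ C * decay x := by
  obtain ⟨C, hC0, hC⟩ := exists_decay_bound f
  refine ⟨C, hC0, fun x => le_trans ?_ (hC x)⟩
  exact le_mul_of_one_le_left (norm_nonneg _) (by linarith [norm_nonneg x])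

/-- Translation becomes modulation, which preserves the modulus. This makes the bounds on the
diffraction independent of the translate. -/
theorem norm_fourier_comp_add_right (f : Space d → ℂ) (v z : Space d) :
    ‖𝓕 (fun x => f (x + v)) z‖ = ‖𝓕 f z‖ := by
  have h := congrFun (VectorFourier.fourierIntegral_comp_add_right Real.fourierChar volume
    (innerₗ (Space d)) f v) z
  have h1 : 𝓕 (fun x => f (x + v)) z = VectorFourier.fourierIntegral Real.fourierChar volume
    (innerₗ (Space d)) (f ∘ fun x => x + v) z := rfl
  rw [h1, h, Circle.norm_smul]
  rfl

/-- A smooth compactly supported function majorizing the unit cube. -/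
theorem exists_schwartz_majorant (d : ℕ) : ∃ (φ : C_c(Space d, ℝ)) (h : 𝓢(Space d, ℂ)),
    (∀ x, 0 ≤ φ x) ∧ (∀ x ∈ closure (cube d 1), 1 ≤ φ x) ∧ ∀ x, h x = φ x := by
  -- The unit cube lies in the ball of radius `d`; one is added so that the inner radius is positive
  -- also for `d = 0`.
  let b : ContDiffBump (0 : Space d) := ⟨d + 1, d + 2, by positivity, by linarith⟩
  have hc : HasCompactSupport fun x => (b x : ℂ) :=
    b.hasCompactSupport.comp_left (g := fun y : ℝ => (y : ℂ)) Complex.ofReal_zero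
  refine ⟨⟨⟨b, b.continuous⟩, b.hasCompactSupport⟩, hc.toSchwartzMap
    (Complex.ofRealCLM.contDiff.comp b.contDiff), fun x => b.nonneg, fun x hx => ?_, fun x => rfl⟩
  refine (b.one_of_mem_closedBall ?_).ge
  rw [mem_closedBall_zero_iff]
  have hcl : closure (cube d 1) ⊆ {x | ‖x‖ ≤ d * |1|} :=
    closure_minimal (fun x hx => norm_le_of_mem_cube hx) (isClosed_le continuous_norm continuous_const)
  have : ‖x‖ ≤ d * |1| := hcl hx
  rw [abs_one, mul_one] at this
  exact this.trans (by change (d : ℝ) ≤ d + 1; linarith)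

end Diffraction

/-! ### Translation boundedness and passage to the limit. -/

section DiffractionLimit

/-- The translate `φ(· - t)` of a compactly supported function. -/
def translateCompact (φ : C_c(Space d, ℝ)) (t : Space d) : C_c(Space d, ℝ) :=
  ⟨⟨fun x => φ (x + -t), by fun_prop⟩,
    φ.hasCompactSupport.comp_homeomorph (Homeomorph.addRight (-t))⟩

theorem measure_translate_cube_le (ν : Measure (Space d)) [IsFiniteMeasureOnCompacts ν]
    {φ : C_c(Space d, ℝ)} (hφ : ∀ x, 0 ≤ φ x) (hφ1 : ∀ x ∈ closure (cube d 1), 1 ≤ φ x)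
    (t : Space d) : ν ((fun x => t + x) '' cube d 1) ≤
      ENNReal.ofReal (∫ x, translateCompact φ t x ∂ν) := by
  have hK : IsCompact ((fun x => t + x) '' closure (cube d 1)) :=
    (isBounded_cube 1).isCompact_closure.image (continuous_const_add t)
  refine (measure_mono (Set.image_mono subset_closure)).trans
    (measure_le_ofReal_integral ν (f := translateCompact φ t) (fun x => hφ (x + -t)) hK ?_)
  rintro _ ⟨x, hx, rfl⟩
  change 1 ≤ φ (t + x + -t)
  rw [add_neg_cancel_comm]
  exact hφ1 x hx

/-- By duality the integral of a translate of `φ` is a weighted sum of integrals of its Fourier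
transform against finite-volume autocorrelations. The modulus of that transform does not depend on
the translate and decays rapidly, while the autocorrelations are uniformly translation bounded. -/
theorem exists_integral_diffractionAt_le {r : ℝ} (hr : 0 < r) (w : Fin m → ℝ)
    {φ : C_c(Space d, ℝ)} {h : 𝓢(Space d, ℂ)} (hφh : ∀ x, h x = φ x) : ∃ B : ℝ,
    ∀ lam ∈ uniformlyDiscrete d m r, ∀ R, 1 ≤ R → ∀ t,
      ∫ x, translateCompact φ t x ∂(diffractionAt w lam R) ≤ B := by
  obtain ⟨N, hN, hb⟩ := exists_autocorrMeasure_translate_le (d := d) (m := m) hr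
  obtain ⟨D, hD, hdec⟩ := exists_lintegral_decay_le (d := d) hr
  have hND : N * D < ∞ := ENNReal.mul_lt_top hN hD
  obtain ⟨C, hC0, hC⟩ := exists_decay_bound' (𝓕 h)
  rw [SchwartzMap.fourier_coe] at hC
  refine ⟨∑ i, ∑ j, |w i| * |w j| * (C * (N * D).toReal), fun lam hlam R hR t => ?_⟩
  have heq : (fun x => h (x + -t)) = fun x => (translateCompact φ t x : ℂ) :=
    funext fun x => hφh _
  have hint : Integrable (fun x => h (x + -t)) := h.integrable.comp_add_right (-t)
  have hcont : Continuous (𝓕 fun x => h (x + -t)) :=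
    VectorFourier.fourierIntegral_continuous Real.continuous_fourierChar
      (by exact continuous_inner) hint
  have hkey := integral_diffractionAt w lam (by linarith : 0 ≤ R) hint hcont
  have h1 : ‖∫ x, h (x + -t) ∂(diffractionAt w lam R)‖ ≤
      ∑ i, ∑ j, |w i| * |w j| * (C * (N * D).toReal) := by
    rw [hkey]
    refine (norm_sum_le _ _).trans (Finset.sum_le_sum fun i _ => (norm_sum_le _ _).trans
      (Finset.sum_le_sum fun j _ => ?_))
    rw [norm_mul, norm_mul, Complex.norm_real, Complex.norm_real, Real.norm_eq_abs,
      Real.norm_eq_abs]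
    refine mul_le_mul_of_nonneg_left ?_ (by positivity)
    refine norm_integral_le_decay hND (hdec _ N (hb lam hlam i j R hR)) hC0 fun z => ?_
    exact (norm_fourier_comp_add_right h (-t) z).le.trans (hC z)
  have h2 : ∫ x, (translateCompact φ t x : ℂ) ∂(diffractionAt w lam R) =
      (∫ x, translateCompact φ t x ∂(diffractionAt w lam R) : ℝ) := integral_ofReal (𝕜 := ℂ)
  rw [heq, h2] at h1
  refine (le_abs_self _).trans (le_trans (le_of_eq ?_) h1)
  exact (Complex.norm_real _).symm

variable {μ : Measure (PointMeasure d m)}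

/-- The weighted moment is the Fourier transform of a translation bounded measure, the diffraction
of a generic configuration. -/
theorem exists_isMomentFourierTransform [IsProbabilityMeasure μ]
    [VAddInvariantMeasure (Space d) (PointMeasure d m) μ] {r : ℝ} (hr : 0 < r)
    (hud : μ.support ⊆ uniformlyDiscrete d m r) (hc : IsCompact μ.support) (w : Fin m → ℝ)
    [∀ i j, IsFiniteMeasureOnCompacts (momentMeasure μ i j)] [∀ i j, SFinite (momentMeasure μ i j)]
    {lam : PointMeasure d m} (hgen : IsGeneric μ lam) :
    ∃ σ, IsMomentFourierTransform μ w σ ∧ IsTranslationBounded σ := by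
  obtain ⟨φ, h, hφ0, hφ1, hφh⟩ := exists_schwartz_majorant d
  obtain ⟨B, hB⟩ := exists_integral_diffractionAt_le hr w hφh
  have hlam := hud hgen.1
  have hBσ : ∀ R, 1 ≤ R → ∀ t,
      diffractionAt w lam R ((fun x => t + x) '' cube d 1) ≤ ENNReal.ofReal B := fun R hR t =>
    (measure_translate_cube_le _ hφ0 hφ1 t).trans (ENNReal.ofReal_le_ofReal (hB lam hlam R hR t))
  -- An ultrafilter finer than `atTop` yields a vague limit directly, since the diffraction measures
  -- are uniformly translation bounded.
  let U : Ultrafilter ℝ := Ultrafilter.of atTop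
  have hU : (U : Filter ℝ) ≤ atTop := Ultrafilter.of_le _
  have hU1 : ∀ᶠ R in (U : Filter ℝ), 1 ≤ R := hU (eventually_ge_atTop 1)
  obtain ⟨σ, hσ, hlim⟩ := exists_vague_limit U (diffractionAt w lam) fun f => by
    obtain ⟨D, hD, hDb⟩ := exists_measure_translate_le one_pos
      f.hasCompactSupport.isCompact.isBounded
    obtain ⟨C, hC⟩ := f.hasCompactSupport.exists_bound_of_continuous f.continuous
    have hC0 : 0 ≤ C := (norm_nonneg _).trans (hC 0)
    refine ⟨C * (ENNReal.ofReal B * D).toReal, ?_⟩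
    filter_upwards [hU1] with R hR
    have hm := hDb (diffractionAt w lam R) _ (hBσ R hR) 0
    simp only [zero_add, Set.image_id'] at hm
    have hfin : ENNReal.ofReal B * D < ∞ := ENNReal.mul_lt_top ENNReal.ofReal_lt_top hD
    rw [← setIntegral_eq_integral_of_forall_compl_eq_zero (s := tsupport f) fun x hx =>
      image_eq_zero_of_notMem_tsupport hx, ← Real.norm_eq_abs]
    refine (norm_setIntegral_le_of_norm_le_const (hm.trans_lt hfin) fun x _ => hC x).trans ?_
    exact mul_le_mul_of_nonneg_left (ENNReal.toReal_mono hfin.ne hm) hC0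
  have hσB : ∀ t, σ ((fun x => t + x) '' cube d 1) ≤ ENNReal.ofReal B := fun t =>
    (measure_translate_cube_le σ hφ0 hφ1 t).trans (ENNReal.ofReal_le_ofReal
      (le_of_tendsto (hlim _) (hU1.mono fun R hR => hB lam hlam R hR t)))
  refine ⟨σ, fun f => ?_, isTranslationBounded_of_cube one_pos ENNReal.ofReal_lt_top hσB⟩
  obtain ⟨C, -, hC⟩ := exists_decay_bound f
  obtain ⟨C', -, hC'⟩ := exists_decay_bound' f
  obtain ⟨K, -, hK⟩ := exists_decay_bound (𝓕 f)
  obtain ⟨K', -, hK'⟩ := exists_decay_bound' (𝓕 f)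
  have hcont := (𝓕 f).continuous
  rw [SchwartzMap.fourier_coe] at hK hK' hcont
  have hint : ∀ i j, Integrable (𝓕 (f : Space d → ℂ)) (momentMeasure μ i j) := fun i j =>
    integrable_of_decay hr (palm_univ_lt_top hr hud i) (momentMeasure_translate_cube_le hud i j)
      hcont hK'
  refine ⟨momentIntegrable_of_integrable hcont.measurable hint,
    integrable_of_decay one_pos ENNReal.ofReal_lt_top hσB f.continuous hC', ?_⟩
  -- The identity of `integral_diffractionAt` holds at every `R ≥ 1`. Here and in `hA` its two sides
  -- are taken to the limit along `U`; uniform translation bounds permit the rapidly decreasing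
  -- functions `f` and `𝓕 f` as test functions.
  have hL := tendsto_integral_of_decay one_pos ENNReal.ofReal_lt_top
    (hU1.mono fun R hR => hBσ R hR) hσB hlim f.continuous hC
  obtain ⟨N, hN, hb⟩ := exists_autocorrMeasure_translate_le (d := d) (m := m) hr
  have hA : ∀ i j, Tendsto (fun R => ∫ z, 𝓕 (f : Space d → ℂ) z ∂(autocorrMeasure lam i j R)) U
      (𝓝 (∫ z, 𝓕 (f : Space d → ℂ) z ∂(momentMeasure μ j i))) := fun i j =>
    tendsto_integral_of_decay hr (max_lt hN (palm_univ_lt_top hr hud j))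
      (hU1.mono fun R hR t => (hb lam hlam i j R hR t).trans (le_max_left _ _))
      (fun t => (momentMeasure_translate_cube_le hud j i t).trans (le_max_right _ _))
      (fun g => (hgen.tendsto_autocorrMeasure hc i j g).mono_left hU) hcont hK
  rw [weightedMoment_eq_sum w hint, Finset.sum_comm]
  refine tendsto_nhds_unique hL (Tendsto.congr' (hU1.mono fun R hR =>
    (integral_diffractionAt w lam (by linarith) f.integrable hcont).symm) ?_)
  refine tendsto_finsetSum _ fun i _ => tendsto_finsetSum _ fun j _ => ?_
  rw [mul_comm (w j : ℂ)]
  exact (hA i j).const_mul _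

end DiffractionLimit

theorem exists_translationBounded_eq_weightedMoment (w : Fin 1 → ℝ) (hw : ∀ i, w i = 1)
    {μ : Measure (PointMeasure d 1)} [IsProbabilityMeasure μ]
    [VAddInvariantMeasure (Space d) (PointMeasure d 1) μ] {r : ℝ} (hr : 0 < r)
    (hud : μ.support ⊆ uniformlyDiscrete d 1 r)
    [∀ i j, IsFiniteMeasureOnCompacts (momentMeasure μ i j)] [∀ i j, SFinite (momentMeasure μ i j)] :
    ∃ ν : Measure (Space d), IsTranslationBounded ν ∧ ∀ f : C_c(Space d, ℂ),
      weightedMoment μ w f = ∫ x, f x ∂ν := by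
  refine ⟨momentMeasure μ 0 0, isTranslationBounded_of_cube hr (palm_univ_lt_top hr hud 0)
    (momentMeasure_translate_cube_le hud 0 0), fun f => ?_⟩
  rw [weightedMoment_eq_sum w fun i j => integrable_compactlySupported _ f]
  simp [hw]

end PointProcess

end

/-! ### Assembly of the theorem. -/

theorem theorem5p1 {d m : ℕ} {Ω : Type*} [MeasurableSpace Ω] (P : Measure Ω)
    [IsProbabilityMeasure P] (ξ : Ω → PointProcess.PointMeasure d m) (hξ : Measurable ξ)
    (μ : Measure (PointProcess.PointMeasure d m)) (hμ : μ = P.map ξ)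
    (hpp : PointProcess.IsUniformlyDiscreteErgodic μ) (w : Fin m → ℝ) :
    PointProcess.IsRadonMeasure (PointProcess.weightedMoment μ w) ∧
    PointProcess.IsPositiveDefinite (PointProcess.weightedMoment μ w) ∧
    (∃ σ : Measure (PointProcess.Space d),
      PointProcess.IsMomentFourierTransform μ w σ ∧ PointProcess.IsTranslationBounded σ) ∧
    (∀ᵐ lam ∂μ, PointProcess.HasAutocorrelation w lam (PointProcess.weightedMoment μ w)) ∧
    (PointProcess.IsUniquelyErgodic μ → ∀ lam ∈ μ.support,
      PointProcess.HasAutocorrelation w lam (PointProcess.weightedMoment μ w)) ∧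
    (m = 1 → (∀ i, w i = 1) → ∃ ν : Measure (PointProcess.Space d),
      PointProcess.IsTranslationBounded ν ∧ ∀ f : C_c(PointProcess.Space d, ℂ),
        PointProcess.weightedMoment μ w f = ∫ x, f x ∂ν) := by
  obtain ⟨⟨r, hr, hud⟩, herg, -⟩ := hpp
  have hprob : IsProbabilityMeasure μ := hμ ▸ Measure.isProbabilityMeasure_map hξ.aemeasurable
  have hsub : μ.support ⊆ PointProcess.uniformlyDiscrete d m r := hud
  have hc : IsCompact μ.support :=
    (PointProcess.isCompact_uniformlyDiscrete hr).of_isClosed_subset Measure.isClosed_support hsub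
  have hs : ∀ i j, SFinite (PointProcess.momentMeasure μ i j) := fun i j => by
    have : IsFiniteMeasure (PointProcess.palm μ i) := ⟨PointProcess.palm_univ_lt_top hr hsub i⟩
    unfold PointProcess.momentMeasure
    infer_instance
  have hfin : ∀ i j, IsFiniteMeasureOnCompacts (PointProcess.momentMeasure μ i j) := fun i j =>
    (PointProcess.isTranslationBounded_of_cube hr (PointProcess.palm_univ_lt_top hr hsub i)
      (PointProcess.momentMeasure_translate_cube_le hsub i j)).isFiniteMeasureOnCompacts
  have hae := PointProcess.ae_isGeneric hc
  -- One generic configuration suffices for positive definiteness and for the Fourier transform,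
  -- which are statements about `weightedMoment μ w` alone.
  obtain ⟨lam, hlam⟩ := hae.exists
  refine ⟨PointProcess.isRadonMeasure_weightedMoment w,
    (hlam.hasAutocorrelation hc w).isPositiveDefinite,
    PointProcess.exists_isMomentFourierTransform hr hsub hc w hlam,
    hae.mono fun lam h => h.hasAutocorrelation hc w,
    fun hu lam h => (PointProcess.isGeneric_of_isUniquelyErgodic hc hu h).hasAutocorrelation hc w,
    ?_⟩
  rintro rfl hw
  exact PointProcess.exists_translationBounded_eq_weightedMoment w hw hr hsub
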